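/- Let $(ID,\ast)$ be the classical infinitely divisible laws on $\mathbb R$ and $(ID,\boxplus)$ the $\boxplus$-infinitely divisible ones; $V_\nu$ denotes the Voiculescu transform. The free counterpart $\tilde\mu$ of $\mu\in(ID,\ast)$ is the probability measure with $V_{\tilde\mu}(it)=it^2\int_0^\infty\log\phi_\mu(-u)e^{-tu}\,du$, $t>0$, where $\phi_\mu$ is the characteristic function of $\mu$. For $k\ge1$ let $(\mathbb U_k,\ast)$ be the class of weak limits, as $n\to\infty$, of $T_{1/n}(\nu_1\ast\dots\ast\nu_n)^{\ast n^{-k}}$ with $\nu_j\in(ID,\ast)$, where $T_c\mu$ is the law of $cX$ when $X$ has law $\mu$, and let $(\mathbb U_k,\boxplus)$ be the class of free counterparts of the measures in $(\mathbb U_k,\ast)$. Let $a\in\mathbb R$ and let $m$ be a finite Borel measure on $\mathbb R$. Let $Y$ be a Lévy process such that $Y(1)$ has Lévy–Khintchine parameters $(a,m)$, that is, $$\log\phi_{Y(1)}(u)=iua+\int_{\mathbb R}\Big(e^{iux}-1-\frac{iux}{1+x^2}\Big)\frac{1+x^2}{x^2}\,m(dx)$$ (the integrand being $-u^2/2$ at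 $x=0$). For $k\ge1$ let $\nu_k$ be the law of $\int_{(0,1]}t\,dY(t^k)$. Then the free counterpart $\tilde\nu_k$ exists, $\tilde\nu_k\in(\mathbb U_k,\boxplus)$, and for every $t>0$ $$\lim_{k\to\infty}V_{\tilde\nu_k}(it)=a+\int_{\mathbb R}\frac{1+itx}{it-x}\,m(dx).$$ As $(a,m)$ varies, the functions of $t>0$ on the right-hand side are exactly the transforms $t\mapsto V_\nu(it)$ of the measures $\nu\in(ID,\boxplus)$. Consequently $\overline{\bigcup_{k\ge1}(\mathbb U_k,\boxplus)}=(ID,\boxplus)$, both for the closure among probability measures in the topology of weak convergence, and for the closure within $(ID,\boxplus)$ in the topology of pointwise convergence of the transforms $t\mapsto V_\nu(it)$ on $(0,\infty)$. -/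

import Mathlib

open Filter Topology MeasureTheory

/-! Classical side: convolution, infinite divisibility, the classes `𝕌_k`. -/

/-- Convolution `μ ∗ ν` of two probability measures on the line. -/
noncomputable def pmConv (μ ν : ProbabilityMeasure ℝ) : ProbabilityMeasure ℝ :=
  ⟨(μ : Measure ℝ).conv (ν : Measure ℝ), inferInstance⟩

/-- The dilation `T_c μ`, the law of `c X` where `X` has law `μ`. -/
noncomputable def pmScale (c : ℝ) (μ : ProbabilityMeasure ℝ) : ProbabilityMeasure ℝ :=
  μ.map (f := fun x : ℝ => c * x) (measurable_const_mul c).aemeasurable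

/-- The convolution `ν 1 ∗ ν 2 ∗ ⋯ ∗ ν n` (the point mass at `0` for `n = 0`). -/
noncomputable def pmConvUpTo (ν : ℕ → ProbabilityMeasure ℝ) : ℕ → ProbabilityMeasure ℝ
  | 0 => ⟨Measure.dirac 0, inferInstance⟩
  | n + 1 => pmConv (pmConvUpTo ν n) (ν (n + 1))

/-- Classical infinite divisibility: `μ` has a convolution root of every order `n ≥ 1`. -/
def IsInfDiv (μ : ProbabilityMeasure ℝ) : Prop :=
  ∀ n : ℕ, 1 ≤ n → ∃ ν : ProbabilityMeasure ℝ, pmConvUpTo (fun _ => ν) n = μ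

/-- `ψ` is `log φ_μ`: the (unique) continuous logarithm, vanishing at `0`, of the characteristic
function of `μ`. It exists exactly when the characteristic function has no zero, in particular
for every infinitely divisible `μ`. -/
def IsLogCharFun (μ : ProbabilityMeasure ℝ) (ψ : ℝ → ℂ) : Prop :=
  Continuous ψ ∧ ψ 0 = 0 ∧ ∀ u : ℝ, charFun (μ : Measure ℝ) u = Complex.exp (ψ u)

/-- `ρ` is the convolution power `μ^{∗ s}` for a real exponent `s`: `log φ_ρ = s log φ_μ`. -/
def IsConvPow (μ : ProbabilityMeasure ℝ) (s : ℝ) (ρ : ProbabilityMeasure ℝ) : Prop :=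
  ∃ ψ : ℝ → ℂ, IsLogCharFun μ ψ ∧ ∀ u : ℝ, charFun (ρ : Measure ℝ) u = Complex.exp (s * ψ u)

/-- The class `(𝕌_k, ∗)`: all weak limits, as `n → ∞`, of
`T_{1/n} (ν_1 ∗ ν_2 ∗ ⋯ ∗ ν_n)^{∗ n^{-k}}` with infinitely divisible `ν_1, ν_2, …`. -/
def classicalU (k : ℕ) : Set (ProbabilityMeasure ℝ) :=
  {μ | ∃ ν η : ℕ → ProbabilityMeasure ℝ,
    (∀ n, 1 ≤ n → IsInfDiv (ν n)) ∧
    (∀ n, 1 ≤ n → IsConvPow (pmConvUpTo ν n) (((n : ℝ) ^ k)⁻¹) (η n)) ∧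
    Tendsto (fun n : ℕ => pmScale ((n : ℝ)⁻¹) (η n)) atTop (𝓝 μ)}

/-- `ρ` is the law of the random integral `∫_{(0,1]} h(t) dY(r(t))`, for `h` continuous on `[0,1]`
and `r` nondecreasing and continuous there, where `Y` is a Lévy process with `Y(1)` of law `ν`.
The integral is the limit of the Riemann-Stieltjes sums
`∑_{j=1}^n h(j/n) (Y(r(j/n)) - Y(r((j-1)/n)))`; the increments of `Y` being independent and
stationary, the law of such a sum is the convolution, over `1 ≤ j ≤ n`, of the measures
`T_{h(j/n)} ν^{∗ (r(j/n) - r((j-1)/n))}`. -/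
def IsRandomIntegralLaw (h r : ℝ → ℝ) (ν ρ : ProbabilityMeasure ℝ) : Prop :=
  ∃ ξ : ℕ → ℕ → ProbabilityMeasure ℝ,
    (∀ n j : ℕ, 1 ≤ j → j ≤ n →
      IsConvPow ν (r ((j : ℝ) / n) - r (((j : ℝ) - 1) / n)) (ξ n j)) ∧
    Tendsto (fun n : ℕ => pmConvUpTo (fun j => pmScale (h ((j : ℝ) / n)) (ξ n j)) n) atTop (𝓝 ρ)

/-- The Lévy-Khintchine kernel `(e^{iux} - 1 - iux/(1+x²)) (1+x²)/x²`, with its limiting value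
`-u²/2` at `x = 0`. -/
noncomputable def lkKernel (u x : ℝ) : ℂ :=
  if x = 0 then -(u : ℂ) ^ 2 / 2
  else (Complex.exp (Complex.I * u * x) - 1 - Complex.I * u * x / (1 + (x : ℂ) ^ 2)) *
    ((1 + (x : ℂ) ^ 2) / (x : ℂ) ^ 2)

/-- `μ` is the infinitely divisible law with Lévy-Khintchine parameters `a` and `m`. -/
def HasLevyKhintchine (μ : ProbabilityMeasure ℝ) (a : ℝ) (m : FiniteMeasure ℝ) : Prop :=
  ∀ u : ℝ, charFun (μ : Measure ℝ) u =
    Complex.exp (Complex.I * u * a + ∫ x, lkKernel u x ∂(m : Measure ℝ))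

/-! Free side: Voiculescu transforms, free additive convolution, free infinite divisibility. -/

/-- The Cauchy transform `G_μ(z) = ∫ μ(dx) / (z - x)`. -/
noncomputable def cauchyG (μ : ProbabilityMeasure ℝ) (z : ℂ) : ℂ :=
  ∫ x : ℝ, (z - (x : ℂ))⁻¹ ∂(μ : Measure ℝ)

/-- The reciprocal Cauchy transform `F_μ = 1 / G_μ`. -/
noncomputable def recipF (μ : ProbabilityMeasure ℝ) (z : ℂ) : ℂ :=
  (cauchyG μ z)⁻¹

/-- The truncated cone `Γ_{α,β} = {x + iy : y > β, |x| < α y}`. -/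
def truncCone (α β : ℝ) : Set ℂ :=
  {z | β < z.im ∧ |z.re| < α * z.im}

/-- `V` agrees on some truncated cone with the Voiculescu transform `F_μ⁻¹(z) - z`, where `F_μ⁻¹`
is the right inverse of `F_μ` with `F_μ⁻¹(z) = z (1 + o(1))` at infinity. -/
def IsVoiculescuNearInfty (μ : ProbabilityMeasure ℝ) (V : ℂ → ℂ) : Prop :=
  ∃ α β : ℝ, 0 < α ∧ 0 < β ∧
    DifferentiableOn ℂ V (truncCone α β) ∧
    (∀ z ∈ truncCone α β, 0 < (z + V z).im ∧ recipF μ (z + V z) = z) ∧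
    Tendsto (fun z => V z / z) (Bornology.cobounded ℂ ⊓ 𝓟 (truncCone α β)) (𝓝 0)

/-- `V` is, on the whole upper half-plane, the (analytically continued) Voiculescu transform
`V_μ`. Such a continuation is unique on the upper half-plane if it exists. -/
def IsVoiculescuTransform (μ : ProbabilityMeasure ℝ) (V : ℂ → ℂ) : Prop :=
  DifferentiableOn ℂ V {z | 0 < z.im} ∧ IsVoiculescuNearInfty μ V

/-- `ρ` is the free additive convolution `μ_1 ⊞ ⋯ ⊞ μ_n`: the Voiculescu transforms add up on a
truncated cone. -/
def IsFreeConv {n : ℕ} (μ : Fin n → ProbabilityMeasure ℝ) (ρ : ProbabilityMeasure ℝ) : Prop :=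
  ∃ V : Fin n → ℂ → ℂ, (∀ i, IsVoiculescuNearInfty (μ i) (V i)) ∧
    IsVoiculescuNearInfty ρ (fun z => ∑ i, V i z)

/-- `(ID, ⊞)`: the probability measures that have a `⊞`-root of every order `n ≥ 1`. -/
def freeID : Set (ProbabilityMeasure ℝ) :=
  {ρ | ∀ n : ℕ, 1 ≤ n → ∃ μ : ProbabilityMeasure ℝ, IsFreeConv (fun _ : Fin n => μ) ρ}

/-- `μ'` is the free counterpart of the classical infinitely divisible law `μ`:
`V_{μ'}(it) = i t² ∫_0^∞ log φ_μ(-u) e^{-tu} du` for all `t > 0`. -/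
def IsFreeCounterpart (μ μ' : ProbabilityMeasure ℝ) : Prop :=
  ∃ (ψ : ℝ → ℂ) (V : ℂ → ℂ), IsLogCharFun μ ψ ∧ IsVoiculescuTransform μ' V ∧
    ∀ t : ℝ, 0 < t → V (t * Complex.I) =
      Complex.I * (t : ℂ) ^ 2 *
        ∫ u in Set.Ioi (0 : ℝ), ψ (-u) * Complex.exp (-((t : ℂ) * (u : ℂ)))

/-- `(𝕌_k, ⊞)`: the free counterparts of the measures in `(𝕌_k, ∗)`. -/
def freeU (k : ℕ) : Set (ProbabilityMeasure ℝ) :=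
  {μ' | ∃ μ ∈ classicalU k, IsFreeCounterpart μ μ'}

/-- `ν'` is the free counterpart of the law of `∫_{(0,1]} t dY(t^k)`, where `Y` is the Lévy
process for which the law of `Y(1)` has Lévy-Khintchine parameters `a` and `m`. -/
def HasBackground (k : ℕ) (a : ℝ) (m : FiniteMeasure ℝ) (ν' : ProbabilityMeasure ℝ) : Prop :=
  ∃ ν ρ : ProbabilityMeasure ℝ, HasLevyKhintchine ν a m ∧
    IsRandomIntegralLaw (fun t => t) (fun t => t ^ k) ν ρ ∧ IsFreeCounterpart ρ ν'

/-- The function `a + ∫ (1 + itx) / (it - x) m(dx)` of `t`. -/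
noncomputable def freeLK (a : ℝ) (m : FiniteMeasure ℝ) (t : ℝ) : ℂ :=
  a + ∫ x : ℝ, (1 + Complex.I * t * x) / (Complex.I * t - x) ∂(m : Measure ℝ)

/-- The transforms `t ↦ V_ν(it)`, `t > 0`, of the measures `ν` in a set `S`. -/
def transformsOf (S : Set (ProbabilityMeasure ℝ)) : Set (Set.Ioi (0 : ℝ) → ℂ) :=
  {v | ∃ ν ∈ S, ∃ V : ℂ → ℂ, IsVoiculescuTransform ν V ∧
    ∀ t : Set.Ioi (0 : ℝ), v t = V (((t : ℝ) : ℂ) * Complex.I)}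

/-! Both sides of the correspondence are parametrised by the same pairs `(a, m)`. Integrating the
Lévy-Khintchine kernel against `it² e^{-tu}` gives exactly `(1 + itx) / (it - x)`, so the free
counterpart of the law with exponent `levyExp a m` has transform `nevV a m`
(`freeTransform_levyExp`). If `ψ` is the exponent of `Y(1)`, that of `∫ t dY(t^k)` is `∫_0^1
ψ(v^{1/k} u) dv`. Since `v^{1/k} → 1`, it converges to `ψ(u)`, and the bound `C (1 + u²)`, uniform
in `k`, carries the convergence to the transforms (`tendsto_freeTransform_randomIntegralExp`). The
integral belongs to the `k`-th class because the choice of `ν_j` with exponent `(j^k - (j-1)^k)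
ψ(ju)` turns the normalised sums into its Riemann-Stieltjes sums (`mem_classicalU_of_isLogCharFun`).

The rest is the analysis that makes these transforms those of actual measures. A holomorphic map of
the upper half-plane into the closed lower one has the form `nevV a m z - b z` with `b ≥ 0`
(`exists_nevV_of_im_nonpos`, from the Herglotz formula on the disc). Such functions are compact once
one value is controlled: on the circle no mass can escape, and mass going to infinity on the line
reappears as `b` (`exists_nevV_limit`). In each application a growth condition at infinity forces `b
= 0`.

The free infinitely divisible laws are those with transform `nevV a m` (`mem_freeID_iff`). Every
pair occurs, because `w + V(w)` can be inverted over the whole half-plane and the inverse is a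
reciprocal Cauchy transform (`exists_recipF_add_nevV_eq`). Conversely, subordination for the `n`-th
roots exhibits the transform as a limit of Nevanlinna functions. The counterparts of the `k`-th
class are of this kind since their exponents are limits of compound Poisson exponents
(`exists_nevV_of_mem_classicalU`).

For the closures, `freeID` is weakly closed by compactness. In the other direction, convergence of
the transforms on the imaginary axis spreads to the half-plane, then to the reciprocal Cauchy
transforms, and finally gives weak convergence (`tendsto_of_tendsto_nevV`). -/

/-! ## Nevanlinna functions with a given pair of parameters -/

/-- The function `a + ∫ (1 + zx) / (z - x) m(dx)`. -/
noncomputable def nevV (a : ℝ) (m : FiniteMeasure ℝ) (z : ℂ) : ℂ :=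
  a + ∫ x : ℝ, (1 + z * x) / (z - x) ∂(m : Measure ℝ)

/-- The function `∫ (1 + x²) / |z - x|² m(dx)`, which is `-Im V(z) / Im z` for `V = nevV a m`. -/
noncomputable def nevA (m : FiniteMeasure ℝ) (z : ℂ) : ℝ :=
  ∫ x : ℝ, (1 + x ^ 2) / Complex.normSq (z - x) ∂(m : Measure ℝ)

/-- The open upper half-plane as a subset of `ℂ`. -/
def upperHalf : Set ℂ := {z | 0 < z.im}

theorem mem_upperHalf {z : ℂ} : z ∈ upperHalf ↔ 0 < z.im := Iff.rfl

theorem isOpen_upperHalf : IsOpen upperHalf :=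
  isOpen_lt continuous_const Complex.continuous_im

theorem isPreconnected_upperHalf : IsPreconnected upperHalf :=
  (convex_halfSpace_im_gt 0).isPreconnected

theorem normSq_sub_ofReal (z : ℂ) (x : ℝ) :
    Complex.normSq (z - x) = (z.re - x) ^ 2 + z.im ^ 2 := by
  rw [Complex.normSq_apply]; simp; ring

theorem normSq_sub_ofReal_pos {z : ℂ} (hz : 0 < z.im) (x : ℝ) : 0 < Complex.normSq (z - x) := by
  rw [normSq_sub_ofReal]; positivity

theorem sub_ofReal_ne_zero {z : ℂ} (hz : 0 < z.im) (x : ℝ) : z - x ≠ 0 :=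
  Complex.normSq_pos.1 (normSq_sub_ofReal_pos hz x)

theorem im_le_norm_sub_ofReal {z : ℂ} (hz : 0 < z.im) (x : ℝ) : z.im ≤ ‖z - x‖ := by
  have := Complex.abs_im_le_norm (z - x)
  simpa [abs_of_pos hz] using this

/-- The core is `x² ≤ 2 (Re z - x)² + 2 (Re z)²`, whose defect is the square of `2 Re z - x`. -/
theorem one_add_sq_le_mul_normSq {z : ℂ} (hz : 0 < z.im) (x : ℝ) :
    1 + x ^ 2 ≤ (2 + (1 + 2 * z.re ^ 2) / z.im ^ 2) * Complex.normSq (z - x) := by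
  rw [normSq_sub_ofReal]
  have h : (1 + 2 * z.re ^ 2) / z.im ^ 2 * z.im ^ 2 = 1 + 2 * z.re ^ 2 := by field_simp
  have h2 : 0 ≤ (1 + 2 * z.re ^ 2) / z.im ^ 2 := by positivity
  nlinarith [sq_nonneg (2 * z.re - x), mul_nonneg h2 (sq_nonneg (z.re - x)), sq_nonneg z.im]

theorem one_add_sq_div_normSq_le {z : ℂ} (hz : 0 < z.im) (x : ℝ) :
    (1 + x ^ 2) / Complex.normSq (z - x) ≤ 2 + (1 + 2 * z.re ^ 2) / z.im ^ 2 := by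
  rw [div_le_iff₀ (normSq_sub_ofReal_pos hz x)]
  exact one_add_sq_le_mul_normSq hz x

/-- From `|z - x|² ≤ 2 (|z|² + x²) ≤ 2 (1 + |z|²) (1 + x²)`. This lower bound lets one value of
`nevA` control the total mass of `m`. -/
theorem one_add_sq_div_normSq_ge {z : ℂ} (hz : 0 < z.im) (x : ℝ) :
    (2 * (1 + ‖z‖ ^ 2))⁻¹ ≤ (1 + x ^ 2) / Complex.normSq (z - x) := by
  rw [le_div_iff₀ (normSq_sub_ofReal_pos hz x), inv_mul_le_iff₀ (by positivity),
    normSq_sub_ofReal, ← Complex.normSq_eq_norm_sq, Complex.normSq_apply]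
  nlinarith [sq_nonneg (z.re + x), sq_nonneg (z.re * x), sq_nonneg (z.im * x), sq_nonneg z.im,
    sq_nonneg z.re, sq_nonneg x]

theorem integrable_nevA (m : FiniteMeasure ℝ) {z : ℂ} (hz : 0 < z.im) :
    Integrable (fun x : ℝ => (1 + x ^ 2) / Complex.normSq (z - x)) (m : Measure ℝ) := by
  refine Integrable.of_bound (C := 2 + (1 + 2 * z.re ^ 2) / z.im ^ 2) ?_ (ae_of_all _ fun x => ?_)
  · have : Continuous fun x : ℝ => (1 + x ^ 2) / Complex.normSq (z - x) :=
      Continuous.div (by fun_prop) (Complex.continuous_normSq.comp (by fun_prop))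
        fun x => (normSq_sub_ofReal_pos hz x).ne'
    exact this.aestronglyMeasurable
  · rw [Real.norm_of_nonneg (div_nonneg (by positivity) (Complex.normSq_nonneg _))]
    exact one_add_sq_div_normSq_le hz x

theorem continuous_nevV_kernel {z : ℂ} (hz : 0 < z.im) :
    Continuous fun x : ℝ => (1 + z * x) / (z - x) :=
  Continuous.div (by fun_prop) (by fun_prop) fun x => sub_ofReal_ne_zero hz x

/-- The product kernel `(1 + x²) / ((z - x) (w - x))`. -/
theorem norm_product_kernel_le {z w : ℂ} (hz : 0 < z.im) (hw : 0 < w.im) (x : ℝ) :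
    ‖((1 + (x : ℂ) ^ 2) / ((z - x) * (w - x)))‖ ≤
      ((1 + x ^ 2) / Complex.normSq (z - x) + (1 + x ^ 2) / Complex.normSq (w - x)) / 2 := by
  have h1 : ‖(1 + (x : ℂ) ^ 2)‖ = 1 + x ^ 2 := by
    have : (1 + (x : ℂ) ^ 2) = ((1 + x ^ 2 : ℝ) : ℂ) := by push_cast; ring
    rw [this, Complex.norm_real, Real.norm_of_nonneg (by positivity)]
  rw [norm_div, norm_mul, h1, Complex.normSq_eq_norm_sq, Complex.normSq_eq_norm_sq]
  have hz' : 0 < ‖z - x‖ := norm_pos_iff.2 (sub_ofReal_ne_zero hz x)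
  have hw' : 0 < ‖w - x‖ := norm_pos_iff.2 (sub_ofReal_ne_zero hw x)
  rw [← sub_nonneg]
  have : ((1 + x ^ 2) / ‖z - x‖ ^ 2 + (1 + x ^ 2) / ‖w - x‖ ^ 2) / 2 -
      (1 + x ^ 2) / (‖z - x‖ * ‖w - x‖) =
      (1 + x ^ 2) * (‖z - x‖⁻¹ - ‖w - x‖⁻¹) ^ 2 / 2 := by
    field_simp; ring
  rw [this]
  positivity

theorem continuous_product_kernel {z w : ℂ} (hz : 0 < z.im) (hw : 0 < w.im) :
    Continuous fun x : ℝ => ((1 + (x : ℂ) ^ 2) / ((z - x) * (w - x))) :=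
  Continuous.div (by fun_prop) (by fun_prop) fun x =>
    mul_ne_zero (sub_ofReal_ne_zero hz x) (sub_ofReal_ne_zero hw x)

theorem integrable_product_kernel (m : FiniteMeasure ℝ) {z w : ℂ} (hz : 0 < z.im)
    (hw : 0 < w.im) :
    Integrable (fun x : ℝ => ((1 + (x : ℂ) ^ 2) / ((z - x) * (w - x)))) (m : Measure ℝ) :=
  Integrable.mono' (((integrable_nevA m hz).add (integrable_nevA m hw)).div_const 2)
    (continuous_product_kernel hz hw).aestronglyMeasurable
    (ae_of_all _ fun x => norm_product_kernel_le hz hw x)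

/-- The numerator is `-i (i - x)`. The kernel being constant at `i`, the value of `nevV` there
displays the drift and the total mass. -/
theorem nevV_kernel_I (x : ℝ) : (1 + Complex.I * x) / (Complex.I - x) = -Complex.I := by
  rw [div_eq_iff (sub_ofReal_ne_zero (by simp) x)]
  ring_nf
  rw [Complex.I_sq]; ring

/-- Since `(1 + zx) / (z - x) = x + (1 + x²) / (z - x)`, this is the resolvent identity weighted by
`1 + x²`. -/
theorem nevV_kernel_sub {z w : ℂ} (hz : 0 < z.im) (hw : 0 < w.im) (x : ℝ) :
    (1 + z * x) / (z - x) - (1 + w * x) / (w - x) =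
      -((z - w) * ((1 + (x : ℂ) ^ 2) / ((z - x) * (w - x)))) := by
  have h1 := sub_ofReal_ne_zero hz x
  have h2 := sub_ofReal_ne_zero hw x
  field_simp
  ring

theorem integrable_nevV (m : FiniteMeasure ℝ) {z : ℂ} (hz : 0 < z.im) :
    Integrable (fun x : ℝ => (1 + z * x) / (z - x)) (m : Measure ℝ) := by
  have hI : 0 < Complex.I.im := by simp
  have h := ((integrable_product_kernel m hz hI).const_mul (z - Complex.I)).neg.add
    (integrable_const (μ := (m : Measure ℝ)) (-Complex.I))
  refine h.congr (ae_of_all _ fun x => ?_)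
  have := nevV_kernel_sub hz hI x
  rw [nevV_kernel_I] at this
  simp only [Pi.add_apply, Pi.neg_apply, ← this]
  ring

theorem nevV_I (a : ℝ) (m : FiniteMeasure ℝ) :
    nevV a m Complex.I = a - (m : Measure ℝ).real Set.univ * Complex.I := by
  simp only [nevV, nevV_kernel_I, integral_const, Complex.real_smul]
  ring

theorem nevA_I (m : FiniteMeasure ℝ) : nevA m Complex.I = (m : Measure ℝ).real Set.univ := by
  have : ∀ x : ℝ, (1 + x ^ 2) / Complex.normSq (Complex.I - x) = 1 := fun x => by
    rw [normSq_sub_ofReal]; simp; rw [add_comm]; exact div_self (by positivity)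
  simp [nevA, this]

theorem nevV_sub (a : ℝ) (m : FiniteMeasure ℝ) {z w : ℂ} (hz : 0 < z.im) (hw : 0 < w.im) :
    nevV a m z - nevV a m w =
      -((z - w) * ∫ x : ℝ, (1 + (x : ℂ) ^ 2) / ((z - x) * (w - x)) ∂(m : Measure ℝ)) := by
  unfold nevV
  rw [add_sub_add_left_eq_sub, ← integral_sub (integrable_nevV m hz) (integrable_nevV m hw),
    ← integral_const_mul, ← integral_neg]
  exact integral_congr_ae (ae_of_all _ fun x => nevV_kernel_sub hz hw x)

/-- The product kernel is at most the mean of its two diagonal values. The resulting Lipschitz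
estimate is the main tool below: it makes `w + V(w)` injective where `nevA < 1`, and it gives growth
bounds, properness and stability under perturbation of `V`. -/
theorem norm_nevV_sub_le (a : ℝ) (m : FiniteMeasure ℝ) {z w : ℂ} (hz : 0 < z.im)
    (hw : 0 < w.im) :
    ‖nevV a m z - nevV a m w‖ ≤ ‖z - w‖ * ((nevA m z + nevA m w) / 2) := by
  rw [nevV_sub a m hz hw, norm_neg, norm_mul]
  gcongr
  unfold nevA
  rw [← integral_add (integrable_nevA m hz) (integrable_nevA m hw), ← integral_div]
  exact norm_integral_le_of_norm_le
    (((integrable_nevA m hz).add (integrable_nevA m hw)).div_const 2)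
    (ae_of_all _ fun x => norm_product_kernel_le hz hw x)

theorem im_nevV (a : ℝ) (m : FiniteMeasure ℝ) {z : ℂ} (hz : 0 < z.im) :
    (nevV a m z).im = -(z.im * nevA m z) := by
  unfold nevV nevA
  rw [Complex.add_im, Complex.ofReal_im, zero_add]
  have h : (∫ x : ℝ, (1 + z * x) / (z - x) ∂(m : Measure ℝ)).im =
      ∫ x : ℝ, ((1 + z * x) / (z - x)).im ∂(m : Measure ℝ) :=
    (integral_im (integrable_nevV m hz)).symm
  rw [h, ← integral_const_mul, ← integral_neg]
  refine integral_congr_ae (ae_of_all _ fun x => ?_)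
  have hn := (normSq_sub_ofReal_pos hz x).ne'
  simp only [Complex.div_im]
  rw [normSq_sub_ofReal] at *
  simp
  field_simp
  ring

theorem nevA_nonneg (m : FiniteMeasure ℝ) (z : ℂ) : 0 ≤ nevA m z :=
  integral_nonneg fun _ => div_nonneg (by positivity) (Complex.normSq_nonneg _)

theorem nevA_eq (a : ℝ) (m : FiniteMeasure ℝ) {z : ℂ} (hz : 0 < z.im) :
    nevA m z = -(nevV a m z).im / z.im := by
  rw [im_nevV a m hz]; field_simp

theorem nevA_le (m : FiniteMeasure ℝ) {z : ℂ} (hz : 0 < z.im) :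
    nevA m z ≤ (2 + (1 + 2 * z.re ^ 2) / z.im ^ 2) * (m : Measure ℝ).real Set.univ := by
  have h := integral_mono (integrable_nevA m hz) (integrable_const _)
    (fun x => one_add_sq_div_normSq_le hz x)
  simpa [nevA, mul_comm] using h

theorem mass_le_nevA (m : FiniteMeasure ℝ) {z : ℂ} (hz : 0 < z.im) :
    (m : Measure ℝ).real Set.univ ≤ 2 * (1 + ‖z‖ ^ 2) * nevA m z := by
  have h := integral_mono (integrable_const _) (integrable_nevA m hz)
    (fun x => one_add_sq_div_normSq_ge hz x)
  rw [integral_const, smul_eq_mul] at h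
  have h' : (m : Measure ℝ).real Set.univ * (2 * (1 + ‖z‖ ^ 2))⁻¹ ≤ nevA m z := h
  rw [mul_inv_le_iff₀ (by positivity)] at h'
  linarith

theorem hasDerivAt_nevV (a : ℝ) (m : FiniteMeasure ℝ) {z : ℂ} (hz : 0 < z.im) :
    HasDerivAt (nevV a m)
      (-∫ x : ℝ, (1 + (x : ℂ) ^ 2) / ((z - x) * (z - x)) ∂(m : Measure ℝ)) z := by
  rw [hasDerivAt_iff_tendsto_slope]
  -- Within `Im z / 2` of `z` one has `|w - x| ≥ |z - x| / 2` for every real `x`, which supplies a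
  -- dominating function independent of `w`.
  have hnear : ∀ᶠ w in 𝓝 z, 0 < w.im ∧ ‖w - z‖ < z.im / 2 := by
    have h1 : ∀ᶠ w in 𝓝 z, 0 < w.im := isOpen_upperHalf.mem_nhds hz
    have h2 : ∀ᶠ w in 𝓝 z, ‖w - z‖ < z.im / 2 := by
      have := Metric.ball_mem_nhds z (half_pos hz)
      filter_upwards [this] with w hw
      simpa [dist_eq_norm] using hw
    exact h1.and h2
  have hlim : Tendsto (fun w : ℂ => -∫ x : ℝ, (1 + (x : ℂ) ^ 2) / ((w - x) * (z - x))
      ∂(m : Measure ℝ)) (𝓝 z)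
      (𝓝 (-∫ x : ℝ, (1 + (x : ℂ) ^ 2) / ((z - x) * (z - x)) ∂(m : Measure ℝ))) := by
    refine Tendsto.neg ?_
    refine tendsto_integral_filter_of_dominated_convergence
      (fun x : ℝ => 2 * ((1 + x ^ 2) / Complex.normSq (z - x))) ?_ ?_
      ((integrable_nevA m hz).const_mul 2) ?_
    · filter_upwards [hnear] with w hw
      exact (continuous_product_kernel hw.1 hz).aestronglyMeasurable
    · filter_upwards [hnear] with w hw
      refine ae_of_all _ fun x => ?_
      have h1 : ‖(1 + (x : ℂ) ^ 2)‖ = 1 + x ^ 2 := by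
        have : (1 + (x : ℂ) ^ 2) = ((1 + x ^ 2 : ℝ) : ℂ) := by push_cast; ring
        rw [this, Complex.norm_real, Real.norm_of_nonneg (by positivity)]
      rw [norm_div, norm_mul, h1, Complex.normSq_eq_norm_sq]
      have hz' : 0 < ‖z - x‖ := norm_pos_iff.2 (sub_ofReal_ne_zero hz x)
      have hzx := im_le_norm_sub_ofReal hz x
      have hwx : ‖z - x‖ / 2 ≤ ‖w - x‖ := by
        have h3 : ‖z - x‖ ≤ ‖w - x‖ + ‖w - z‖ := by
          have := norm_sub_le (w - (x : ℂ)) (w - z)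
          simpa using this
        linarith [hw.2]
      calc (1 + x ^ 2) / (‖w - x‖ * ‖z - x‖) ≤ (1 + x ^ 2) / (‖z - x‖ / 2 * ‖z - x‖) := by
            gcongr
        _ = 2 * ((1 + x ^ 2) / ‖z - x‖ ^ 2) := by field_simp
    · refine ae_of_all _ fun x => ?_
      have : ContinuousAt (fun w : ℂ => (1 + (x : ℂ) ^ 2) / ((w - x) * (z - x))) z :=
        ContinuousAt.div (by fun_prop) (by fun_prop)
          (mul_ne_zero (sub_ofReal_ne_zero hz x) (sub_ofReal_ne_zero hz x))
      exact this
  refine (hlim.mono_left nhdsWithin_le_nhds).congr' ?_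
  filter_upwards [nhdsWithin_le_nhds hnear, self_mem_nhdsWithin] with w hw hne
  have hne' : w - z ≠ 0 := sub_ne_zero.2 hne
  rw [slope_def_field, nevV_sub a m hw.1 hz]
  field_simp

theorem differentiableOn_nevV (a : ℝ) (m : FiniteMeasure ℝ) :
    DifferentiableOn ℂ (nevV a m) upperHalf := fun _ hz =>
  (hasDerivAt_nevV a m hz).differentiableAt.differentiableWithinAt

theorem continuousAt_nevV (a : ℝ) (m : FiniteMeasure ℝ) {z : ℂ} (hz : 0 < z.im) :
    ContinuousAt (nevV a m) z := (hasDerivAt_nevV a m hz).continuousAt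

theorem norm_deriv_nevV_le (a : ℝ) (m : FiniteMeasure ℝ) {z : ℂ} (hz : 0 < z.im) :
    ‖deriv (nevV a m) z‖ ≤ nevA m z := by
  rw [(hasDerivAt_nevV a m hz).deriv, norm_neg]
  refine norm_integral_le_of_norm_le (integrable_nevA m hz) (ae_of_all _ fun x => ?_)
  have := norm_product_kernel_le hz hz x
  linarith

/-! ### Behaviour in cones -/

theorem tendsto_integral_one_add_sq_div (m : FiniteMeasure ℝ) :
    Tendsto (fun q : ℝ => ∫ x : ℝ, (1 + x ^ 2) / (x ^ 2 + q ^ 2) ∂(m : Measure ℝ))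
      atTop (𝓝 0) := by
  have h0 : (0 : ℝ) = ∫ _x : ℝ, (0 : ℝ) ∂(m : Measure ℝ) := by simp
  rw [h0]
  refine tendsto_integral_filter_of_dominated_convergence (fun _ => (1 : ℝ)) ?_ ?_
    (integrable_const _) ?_
  · refine Eventually.of_forall fun q => ?_
    exact Measurable.aestronglyMeasurable (by fun_prop)
  · filter_upwards [eventually_ge_atTop 1] with q hq
    refine ae_of_all _ fun x => ?_
    rw [Real.norm_of_nonneg (by positivity)]
    have : 1 ≤ q ^ 2 := by nlinarith
    rw [div_le_one (by positivity)]
    linarith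
  · refine ae_of_all _ fun x => ?_
    exact Tendsto.const_div_atTop
      (tendsto_atTop_add_const_left _ _ (tendsto_pow_atTop two_ne_zero)) _

theorem sq_add_sq_le_mul_normSq {α : ℝ} {z : ℂ} (hz : |z.re| ≤ α * z.im) (x : ℝ) :
    x ^ 2 + z.im ^ 2 ≤ (3 + 2 * α ^ 2) * Complex.normSq (z - x) := by
  rw [normSq_sub_ofReal]
  have h : z.re ^ 2 ≤ α ^ 2 * z.im ^ 2 := by
    rw [← mul_pow, ← sq_abs z.re]
    exact pow_le_pow_left₀ (abs_nonneg _) hz 2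
  nlinarith [sq_nonneg (2 * z.re - x), mul_nonneg (sq_nonneg α) (sq_nonneg (z.re - x)),
    sq_nonneg z.im, sq_nonneg (z.re - x)]

/-- In a cone `|z - x|²` is bounded below by a multiple of `x² + (Im z)²`, so `nevA` is dominated by
an integral depending on `Im z` alone, which vanishes at infinity. -/
theorem exists_nevA_le_of_cone (m : FiniteMeasure ℝ) (α : ℝ) {ε : ℝ} (hε : 0 < ε) :
    ∃ β : ℝ, 0 < β ∧ ∀ z : ℂ, β ≤ z.im → |z.re| ≤ α * z.im → nevA m z ≤ ε := by
  have h := (tendsto_integral_one_add_sq_div m).const_mul (3 + 2 * α ^ 2)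
  rw [mul_zero] at h
  obtain ⟨β, hβ⟩ := eventually_atTop.1 (h.eventually (eventually_lt_nhds hε))
  refine ⟨max β 1, by positivity, fun z hz hzc => ?_⟩
  have hz0 : 0 < z.im := lt_of_lt_of_le one_pos ((le_max_right _ _).trans hz)
  refine le_trans ?_ (hβ z.im ((le_max_left _ _).trans hz)).le
  unfold nevA
  rw [← integral_const_mul]
  refine integral_mono (integrable_nevA m hz0) ?_ fun x => ?_
  · refine Integrable.const_mul ?_ _
    refine Integrable.of_bound (C := 1 + 1 / z.im ^ 2)
      (Measurable.aestronglyMeasurable (by fun_prop)) (ae_of_all _ fun x => ?_)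
    rw [Real.norm_of_nonneg (by positivity), div_le_iff₀ (by positivity)]
    have : 1 / z.im ^ 2 * z.im ^ 2 = 1 := by field_simp
    have h2 : 0 ≤ 1 / z.im ^ 2 * x ^ 2 := by positivity
    nlinarith [sq_nonneg z.im]
  · have h1 := sq_add_sq_le_mul_normSq hzc x
    have h2 := normSq_sub_ofReal_pos hz0 x
    simp only
    rw [div_le_iff₀ h2, mul_assoc, div_mul_eq_mul_div, mul_div_assoc', le_div_iff₀ (by positivity)]
    nlinarith [sq_nonneg x]

theorem norm_le_of_cone {α : ℝ} {z : ℂ} (hz : |z.re| ≤ α * z.im) (hz0 : 0 < z.im) :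
    ‖z‖ ≤ (1 + α) * z.im := by
  have := Complex.norm_le_abs_re_add_abs_im z
  rw [abs_of_pos hz0] at this
  linarith

/-- Measured from a fixed point `w` high on the imaginary axis, the Lipschitz constant in the cone
is at most `ε / 2`. The fixed contribution `C` of `w` is absorbed by raising the height. -/
theorem exists_norm_nevV_le_of_cone (a : ℝ) (m : FiniteMeasure ℝ) (α : ℝ) {ε : ℝ} (hε : 0 < ε) :
    ∃ β : ℝ, 0 < β ∧ ∀ z : ℂ, β ≤ z.im → |z.re| ≤ α * z.im → ‖nevV a m z‖ ≤ ε * ‖z‖ := by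
  obtain ⟨β₁, hβ₁, h₁⟩ := exists_nevA_le_of_cone m |α| (half_pos hε)
  set w : ℂ := β₁ * Complex.I with hw
  have hw0 : 0 < w.im := by simpa [hw] using hβ₁
  have hwA : nevA m w ≤ ε / 2 := h₁ w (by simp [hw]) (by
    have : w.re = 0 := by simp [hw]
    rw [this, abs_zero]
    exact mul_nonneg (abs_nonneg _) hw0.le)
  set C := ‖nevV a m w‖ + ‖w‖ * (ε / 2) with hC
  refine ⟨max β₁ (C / (ε / 2)), lt_max_of_lt_left hβ₁, fun z hz hzc => ?_⟩
  have hzβ : β₁ ≤ z.im := (le_max_left _ _).trans hz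
  have hz0 : 0 < z.im := hβ₁.trans_le hzβ
  have hzc' : |z.re| ≤ |α| * z.im := hzc.trans (by gcongr; exact le_abs_self α)
  have hzA := h₁ z hzβ hzc'
  have h2 := norm_nevV_sub_le a m hz0 hw0
  have h3 : ‖nevV a m z‖ ≤ ‖nevV a m w‖ + ‖nevV a m z - nevV a m w‖ := by
    have := norm_add_le (nevV a m w) (nevV a m z - nevV a m w)
    simpa using this
  have h4 : ‖z - w‖ * ((nevA m z + nevA m w) / 2) ≤ (‖z‖ + ‖w‖) * (ε / 2) := by
    refine mul_le_mul (norm_sub_le _ _) (by linarith) ?_ (by positivity)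
    have := nevA_nonneg m z
    have := nevA_nonneg m w
    positivity
  have h5 : C ≤ z.im * (ε / 2) := by
    rw [← div_le_iff₀ (half_pos hε)]
    exact (le_max_right _ _).trans hz
  have h6 : z.im ≤ ‖z‖ := (le_abs_self _).trans (Complex.abs_im_le_norm z)
  have h7 : z.im * (ε / 2) ≤ ‖z‖ * (ε / 2) := by gcongr
  nlinarith

theorem tendsto_nevV_div_I (a : ℝ) (m : FiniteMeasure ℝ) :
    Tendsto (fun y : ℝ => nevV a m (y * Complex.I) / (y * Complex.I)) atTop (𝓝 0) := by
  rw [Metric.tendsto_nhds]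
  intro ε hε
  obtain ⟨β, hβ, h⟩ := exists_norm_nevV_le_of_cone a m 0 (half_pos hε)
  filter_upwards [eventually_ge_atTop β] with y hy
  have hy0 : 0 < y := hβ.trans_le hy
  have := h (y * Complex.I) (by simpa using hy) (by simp)
  rw [dist_zero_right, norm_div, div_lt_iff₀ (by simp [hy0.ne'])]
  refine this.trans_lt ?_
  gcongr
  · simp [hy0.ne']
  · linarith

/-! ## Compactness for Nevanlinna functions, by passage to the unit circle -/

noncomputable instance instMeasurableSpaceCircle : MeasurableSpace Circle := borel Circle

instance instBorelSpaceCircle : BorelSpace Circle := ⟨rfl⟩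

theorem continuous_circle_coe : Continuous fun ζ : Circle => (ζ : ℂ) := continuous_subtype_val

/-- The Cayley transform `z ↦ (z - i) / (z + i)`. -/
noncomputable def cayleyMap (z : ℂ) : ℂ := (z - Complex.I) / (z + Complex.I)

theorem add_I_ne_zero {z : ℂ} (hz : 0 ≤ z.im) : z + Complex.I ≠ 0 := fun h => by
  have := congrArg Complex.im h
  simp at this
  linarith

theorem norm_cayleyMap_lt_one {z : ℂ} (hz : 0 < z.im) : ‖cayleyMap z‖ < 1 := by
  rw [cayleyMap, norm_div, div_lt_one (norm_pos_iff.2 (add_I_ne_zero hz.le)),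
    ← sq_lt_sq₀ (norm_nonneg _) (norm_nonneg _), ← Complex.normSq_eq_norm_sq,
    ← Complex.normSq_eq_norm_sq, Complex.normSq_apply, Complex.normSq_apply]
  simp
  nlinarith

theorem norm_cayleyMap_ofReal (x : ℝ) : ‖cayleyMap x‖ = 1 := by
  rw [cayleyMap, norm_div, div_eq_one_iff_eq (norm_ne_zero_iff.2 (add_I_ne_zero (by simp))),
    ← sq_eq_sq₀ (norm_nonneg _) (norm_nonneg _), ← Complex.normSq_eq_norm_sq,
    ← Complex.normSq_eq_norm_sq, Complex.normSq_apply, Complex.normSq_apply]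
  simp

/-- The Cayley transform from the line to the circle. -/
noncomputable def cayleyCircle (x : ℝ) : Circle :=
  ⟨cayleyMap x, mem_sphere_zero_iff_norm.2 (norm_cayleyMap_ofReal x)⟩

theorem coe_cayleyCircle (x : ℝ) : (cayleyCircle x : ℂ) = cayleyMap x := rfl

theorem continuous_cayleyCircle : Continuous cayleyCircle := by
  refine Continuous.subtype_mk ?_ _
  exact Continuous.div (by fun_prop) (by fun_prop) fun x => add_I_ne_zero (by simp)

/-- The inverse Cayley transform from the circle to the line. -/
noncomputable def cayleyInv (ζ : Circle) : ℝ := (Complex.I * (1 + ζ) / (1 - ζ)).re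

theorem measurable_cayleyInv : Measurable cayleyInv := by
  have : Measurable fun ζ : Circle => (ζ : ℂ) := continuous_circle_coe.measurable
  unfold cayleyInv
  fun_prop

theorem one_sub_cayleyMap {z : ℂ} (hz : z + Complex.I ≠ 0) :
    1 - cayleyMap z = 2 * Complex.I / (z + Complex.I) := by
  rw [cayleyMap]; field_simp; ring

theorem one_add_cayleyMap {z : ℂ} (hz : z + Complex.I ≠ 0) :
    1 + cayleyMap z = 2 * z / (z + Complex.I) := by
  rw [cayleyMap]; field_simp; ring

theorem cayleyMap_inv {z : ℂ} (hz : z + Complex.I ≠ 0) :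
    Complex.I * (1 + cayleyMap z) / (1 - cayleyMap z) = z := by
  rw [one_add_cayleyMap hz, one_sub_cayleyMap hz]
  have := Complex.I_ne_zero
  field_simp

theorem coe_ne_one {ζ : Circle} (hζ : ζ ≠ 1) : (1 - ζ : ℂ) ≠ 0 := fun h =>
  hζ (Circle.ext (by simpa using (sub_eq_zero.1 h).symm))

theorem ofReal_cayleyInv {ζ : Circle} (hζ : ζ ≠ 1) :
    ((cayleyInv ζ : ℝ) : ℂ) = Complex.I * (1 + ζ) / (1 - ζ) := by
  refine Complex.conj_eq_iff_re.1 ?_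
  have h := coe_ne_one hζ
  have h0 : (ζ : ℂ) ≠ 0 := Circle.coe_ne_zero ζ
  have hc : (starRingEnd ℂ) (ζ : ℂ) = (ζ : ℂ)⁻¹ := by
    rw [← Circle.coe_inv_eq_conj, Circle.coe_inv]
  rw [map_div₀, map_mul, map_add, map_sub, map_one, hc, Complex.conj_I]
  have h' : (1 - (ζ : ℂ)⁻¹) ≠ 0 := by
    intro h''
    apply h
    have : (ζ : ℂ)⁻¹ = 1 := (sub_eq_zero.1 h'').symm
    rw [inv_eq_one.1 this, sub_self]
  have h2 : (ζ : ℂ) - 1 ≠ 0 := fun h3 => h (by rw [← neg_sub, h3, neg_zero])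
  rw [div_eq_div_iff h' h]
  field_simp
  ring

theorem cayleyCircle_cayleyInv {ζ : Circle} (hζ : ζ ≠ 1) : cayleyCircle (cayleyInv ζ) = ζ := by
  refine Circle.ext ?_
  rw [coe_cayleyCircle, cayleyMap, ofReal_cayleyInv hζ]
  have h := coe_ne_one hζ
  have e1 : Complex.I * (1 + ζ) / (1 - ζ) - Complex.I = 2 * Complex.I * ζ / (1 - ζ) := by
    field_simp; ring
  have e2 : Complex.I * (1 + ζ) / (1 - ζ) + Complex.I = 2 * Complex.I / (1 - ζ) := by
    field_simp; ring
  have := Complex.I_ne_zero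
  rw [e1, e2]
  field_simp

/-- The Herglotz kernel on the circle, in the half-plane variable. -/
noncomputable def circleKernel (z : ℂ) (ζ : Circle) : ℂ :=
  -Complex.I * ((ζ + cayleyMap z) / (ζ - cayleyMap z))

theorem circle_sub_ne_zero (ζ : Circle) {w : ℂ} (hw : ‖w‖ < 1) : (ζ : ℂ) - w ≠ 0 := fun h => by
  have := sub_eq_zero.1 h
  rw [← this, Circle.norm_coe] at hw
  exact lt_irrefl _ hw

theorem continuous_circleKernel {z : ℂ} (hz : 0 < z.im) : Continuous (circleKernel z) := by
  have : Continuous fun ζ : Circle => (ζ : ℂ) := continuous_circle_coe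
  exact continuous_const.mul (Continuous.div (by fun_prop) (by fun_prop)
    fun ζ => circle_sub_ne_zero ζ (norm_cayleyMap_lt_one hz))

theorem circleKernel_cayleyCircle {z : ℂ} (hz : 0 < z.im) (x : ℝ) :
    circleKernel z (cayleyCircle x) = (1 + z * x) / (z - x) := by
  have h1 := add_I_ne_zero hz.le
  have h2 : (x : ℂ) + Complex.I ≠ 0 := add_I_ne_zero (by simp)
  have h3 := sub_ofReal_ne_zero hz x
  have h4 : cayleyMap x - cayleyMap z =
      -2 * Complex.I * (z - x) / ((x + Complex.I) * (z + Complex.I)) := by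
    rw [cayleyMap, cayleyMap]; field_simp; ring
  have h5 : cayleyMap x + cayleyMap z =
      2 * (1 + z * x) / ((x + Complex.I) * (z + Complex.I)) := by
    rw [cayleyMap, cayleyMap]; field_simp; ring_nf; rw [Complex.I_sq]; ring
  rw [circleKernel, coe_cayleyCircle, h4, h5]
  have := Complex.I_ne_zero
  field_simp

/-- The point `1` of the circle is the image of infinity, so an atom there contributes a term linear
in `z`. -/
theorem circleKernel_one {z : ℂ} (hz : 0 < z.im) : circleKernel z 1 = -z := by
  have h1 := add_I_ne_zero hz.le
  have h := cayleyMap_inv h1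
  rw [circleKernel, Circle.coe_one, ← mul_div_assoc, neg_mul, neg_div, h]

theorem integrable_circle {f : Circle → ℂ} (hf : Continuous f) (σ : Measure Circle)
    [IsFiniteMeasure σ] : Integrable f σ := by
  simpa using hf.continuousOn.integrableOn_compact (μ := σ) isCompact_univ

/-- The atom at `1` becomes `b`, and the rest of `σ` is carried to the line. Restricting to the
complement of `1` first makes the arbitrary value of `cayleyInv` at `1` harmless. -/
theorem exists_nevV_of_circle (a : ℝ) (σ : FiniteMeasure Circle) :
    ∃ (m : FiniteMeasure ℝ) (b : ℝ), 0 ≤ b ∧ ∀ z : ℂ, 0 < z.im →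
      a + ∫ ζ, circleKernel z ζ ∂(σ : Measure Circle) = nevV a m z - b * z := by
  refine ⟨(σ.restrict {1}ᶜ).map cayleyInv, (σ : Measure Circle).real {1}, measureReal_nonneg,
    fun z hz => ?_⟩
  have hk := integrable_circle (continuous_circleKernel hz) (σ : Measure Circle)
  have hm : MeasurableSet ({1} : Set Circle) := measurableSet_singleton 1
  rw [← integral_add_compl hm hk, nevV, FiniteMeasure.toMeasure_map,
    integral_map measurable_cayleyInv.aemeasurable
      (continuous_nevV_kernel hz).aestronglyMeasurable, FiniteMeasure.restrict_measure_eq]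
  have h1 : ∫ ζ in {1}, circleKernel z ζ ∂(σ : Measure Circle) =
      -((σ : Measure Circle).real {1} * z) := by
    rw [integral_singleton, circleKernel_one hz, Complex.real_smul]; ring
  have h2 : ∫ ζ in {1}ᶜ, circleKernel z ζ ∂(σ : Measure Circle) =
      ∫ ζ in {1}ᶜ, (1 + z * (cayleyInv ζ : ℝ)) / (z - (cayleyInv ζ : ℝ))
        ∂(σ : Measure Circle) := by
    refine setIntegral_congr_fun hm.compl fun ζ hζ => ?_
    have hζ' : ζ ≠ 1 := hζ
    rw [← circleKernel_cayleyCircle hz, cayleyCircle_cayleyInv hζ']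
  rw [h1, h2]
  ring

theorem nevV_eq_circle (a : ℝ) (m : FiniteMeasure ℝ) {z : ℂ} (hz : 0 < z.im) :
    nevV a m z = a + ∫ ζ, circleKernel z ζ ∂(m.map cayleyCircle : Measure Circle) := by
  rw [FiniteMeasure.toMeasure_map, integral_map continuous_cayleyCircle.measurable.aemeasurable
    (continuous_circleKernel hz).aestronglyMeasurable, nevV]
  simp only [circleKernel_cayleyCircle hz]

/-- Measures of bounded mass on the compact circle form a compact set, and for fixed `z` the kernel
is continuous there. On the line itself mass could escape; here it survives as `b`. -/
theorem exists_circle_limit {ι : Type*} (U : Ultrafilter ι) {a : ι → ℝ}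
    {σ : ι → FiniteMeasure Circle} {M : ℝ} {C : NNReal} (ha : ∀ᶠ i in U, |a i| ≤ M)
    (hσ : ∀ᶠ i in U, (σ i).mass ≤ C) :
    ∃ (a' : ℝ) (m' : FiniteMeasure ℝ) (b : ℝ), 0 ≤ b ∧ ∀ z : ℂ, 0 < z.im →
      Tendsto (fun i => a i + ∫ ζ, circleKernel z ζ ∂(σ i : Measure Circle)) U
        (𝓝 (nevV a' m' z - b * z)) := by
  obtain ⟨a', -, ha'⟩ := (isCompact_Icc (a := -M) (b := M)).ultrafilter_le_nhds (U.map a)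
    (le_principal_iff.2 (ha.mono fun i hi => abs_le.1 hi))
  obtain ⟨σ', -, hσ'⟩ :=
    (isCompact_setOfPred_finiteMeasure_le_of_compactSpace Circle C).ultrafilter_le_nhds
      (U.map σ) (le_principal_iff.2 hσ)
  obtain ⟨m', b, hb, hmb⟩ := exists_nevV_of_circle a' σ'
  refine ⟨a', m', b, hb, fun z hz => ?_⟩
  rw [← hmb z hz]
  have ha2 : Tendsto a U (𝓝 a') := ha'
  have hσ2 : Tendsto σ U (𝓝 σ') := hσ'
  rw [FiniteMeasure.tendsto_iff_forall_integral_rclike_tendsto ℂ] at hσ2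
  exact ((Complex.continuous_ofReal.tendsto _).comp ha2).add
    (hσ2 (BoundedContinuousFunction.mkOfCompact ⟨circleKernel z, continuous_circleKernel hz⟩))

/-- Compactness: if the values at convergent points converge along an ultrafilter, then the
functions converge pointwise, even along convergent points. -/
theorem exists_nevV_limit {ι : Type*} (U : Ultrafilter ι) {a : ι → ℝ} {m : ι → FiniteMeasure ℝ}
    {w : ι → ℂ} {w₀ c : ℂ} (hw₀ : 0 < w₀.im) (hw : Tendsto w U (𝓝 w₀))
    (hV : Tendsto (fun i => nevV (a i) (m i) (w i)) U (𝓝 c)) :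
    ∃ (a' : ℝ) (m' : FiniteMeasure ℝ) (b : ℝ), 0 ≤ b ∧ ∀ (z : ι → ℂ) (z₀ : ℂ), 0 < z₀.im →
      Tendsto z U (𝓝 z₀) →
      Tendsto (fun i => nevV (a i) (m i) (z i)) U (𝓝 (nevV a' m' z₀ - b * z₀)) := by
  have him : Tendsto (fun i => (w i).im) U (𝓝 w₀.im) :=
    (Complex.continuous_im.tendsto _).comp hw
  have hpos : ∀ᶠ i in U, 0 < (w i).im := him.eventually (lt_mem_nhds hw₀)
  -- The imaginary part of the one known value controls `nevA`, hence the masses; the drifts are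
  -- then bounded through the value at `i`.
  have hA : Tendsto (fun i => nevA (m i) (w i)) U (𝓝 (-c.im / w₀.im)) := by
    refine ((((Complex.continuous_im.tendsto _).comp hV).neg).div him hw₀.ne').congr' ?_
    filter_upwards [hpos] with i hi
    exact (nevA_eq (a i) (m i) hi).symm
  have hmass : ∃ C : ℝ, ∀ᶠ i in U, (m i : Measure ℝ).real Set.univ ≤ C := by
    have h := ((hw.norm.pow 2).const_add 1).const_mul 2 |>.mul hA
    exact ⟨_, (hpos.and (h.eventually (gt_mem_nhds (lt_add_one _)))).mono fun i hi =>
      (mass_le_nevA (m i) hi.1).trans hi.2.le⟩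
  obtain ⟨C, hC⟩ := hmass
  have hI : 0 < Complex.I.im := by simp
  have ha : ∃ M : ℝ, ∀ᶠ i in U, |a i| ≤ M := by
    have h := hV.norm.add (((tendsto_const_nhds (x := Complex.I)).sub hw).norm.mul
      ((hA.const_add C).div_const 2))
    refine ⟨‖c‖ + ‖Complex.I - w₀‖ * ((C + -c.im / w₀.im) / 2) + 1, ?_⟩
    · filter_upwards [hpos, hC, h.eventually (gt_mem_nhds (lt_add_one _))] with i hi hCi h2
      refine le_trans ?_ h2.le
      have h3 : |a i| ≤ ‖nevV (a i) (m i) Complex.I‖ := by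
        refine le_trans (le_of_eq ?_) (Complex.abs_re_le_norm _)
        rw [nevV_I]; simp
      have h4 := norm_nevV_sub_le (a i) (m i) hI hi
      rw [nevA_I] at h4
      have h5 : ‖nevV (a i) (m i) Complex.I‖ ≤ ‖nevV (a i) (m i) (w i)‖ +
          ‖nevV (a i) (m i) Complex.I - nevV (a i) (m i) (w i)‖ := by
        have := norm_add_le (nevV (a i) (m i) (w i))
          (nevV (a i) (m i) Complex.I - nevV (a i) (m i) (w i))
        simpa using this
      refine h3.trans (h5.trans ?_)
      gcongr
      refine h4.trans ?_
      gcongr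
  obtain ⟨M, hM⟩ := ha
  obtain ⟨a', m', b, hb, h⟩ := exists_circle_limit U (a := a)
    (σ := fun i => (m i).map cayleyCircle) (C := C.toNNReal) hM (by
      filter_upwards [hC] with i hi
      refine (FiniteMeasure.mass_map_le _ _).trans ?_
      refine NNReal.le_toNNReal_of_coe_le ?_
      exact hi)
  have hpt : ∀ z : ℂ, 0 < z.im →
      Tendsto (fun i => nevV (a i) (m i) z) U (𝓝 (nevV a' m' z - b * z)) := fun z hz => by
    refine (h z hz).congr fun i => ?_
    rw [nevV_eq_circle _ _ hz]
  refine ⟨a', m', b, hb, fun z z₀ hz₀ hz => ?_⟩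
  have hzim : Tendsto (fun i => (z i).im) U (𝓝 z₀.im) :=
    (Complex.continuous_im.tendsto _).comp hz
  have hzre : Tendsto (fun i => (z i).re) U (𝓝 z₀.re) :=
    (Complex.continuous_re.tendsto _).comp hz
  have hzpos : ∀ᶠ i in U, 0 < (z i).im := hzim.eventually (lt_mem_nhds hz₀)
  -- Bounded masses bound the Lipschitz constants near `z₀`, so moving points may replace the fixed
  -- one.
  have hdiff : Tendsto (fun i => nevV (a i) (m i) (z i) - nevV (a i) (m i) z₀) U (𝓝 0) := by
    have hb1 : Tendsto (fun i => ‖z i - z₀‖ *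
        (((2 + (1 + 2 * (z i).re ^ 2) / (z i).im ^ 2) * C +
          (2 + (1 + 2 * z₀.re ^ 2) / z₀.im ^ 2) * C) / 2)) U (𝓝 (‖z₀ - z₀‖ *
        (((2 + (1 + 2 * z₀.re ^ 2) / z₀.im ^ 2) * C +
          (2 + (1 + 2 * z₀.re ^ 2) / z₀.im ^ 2) * C) / 2))) := by
      have e : Tendsto (fun i => (2 + (1 + 2 * (z i).re ^ 2) / (z i).im ^ 2) * C) U
          (𝓝 ((2 + (1 + 2 * z₀.re ^ 2) / z₀.im ^ 2) * C)) :=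
        ((((hzre.pow 2).const_mul 2).const_add 1).div (hzim.pow 2)
          (pow_ne_zero 2 hz₀.ne') |>.const_add 2).mul_const C
      exact (hz.sub_const z₀).norm.mul ((e.add_const _).div_const 2)
    rw [sub_self, norm_zero, zero_mul] at hb1
    refine squeeze_zero_norm' ?_ hb1
    filter_upwards [hzpos, hC] with i hi hCi
    refine (norm_nevV_sub_le (a i) (m i) hi hz₀).trans ?_
    gcongr
    · refine (nevA_le (m i) hi).trans ?_
      gcongr
    · refine (nevA_le (m i) hz₀).trans ?_
      gcongr
  simpa using hdiff.add (hpt z₀ hz₀)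

/-! ## The Nevanlinna representation -/

/-- By the Poisson formula `g` and the Herglotz integral of `Re g` have the same real part, so they
differ by a constant. At the centre the integral is real, which leaves `i Im g(0)`. -/
theorem eq_add_circleAverage_herglotz {g : ℂ → ℂ} {R : ℝ} (hR : 0 < R)
    (hg : DifferentiableOn ℂ g (Metric.closedBall 0 R)) {w : ℂ} (hw : w ∈ Metric.ball 0 R) :
    g w = (g 0).im * Complex.I + Real.circleAverage
      (fun ζ => herglotzRieszKernel 0 w ζ • ((g ζ).re : ℂ)) 0 R := by
  have hgc : ContinuousOn g (Metric.sphere 0 |R|) := by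
    rw [abs_of_pos hR]
    exact hg.continuousOn.mono Metric.sphere_subset_closedBall
  have hgre : ContinuousOn (fun ζ => (g ζ).re) (Metric.sphere 0 |R|) :=
    Complex.continuous_re.comp_continuousOn hgc
  have hci : CircleIntegrable (fun ζ => (g ζ).re) 0 R := hgre.circleIntegrable'
  have hciC : CircleIntegrable (fun ζ => ((g ζ).re : ℂ)) 0 R :=
    (Complex.continuous_ofReal.comp_continuousOn hgre).circleIntegrable'
  set h : ℂ → ℂ := fun w => Real.circleAverage
      (fun ζ => herglotzRieszKernel 0 w ζ • ((g ζ).re : ℂ)) 0 R with hh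
  have hdc : DiffContOnCl ℂ g (Metric.ball 0 R) :=
    (hg.mono Metric.closure_ball_subset_closedBall).diffContOnCl
  have hre : ∀ w ∈ Metric.ball (0 : ℂ) R, (h w).re = (g w).re := fun w hw => by
    rw [hh]
    simp only
    rw [re_circleAverage_herglotzRieszKernel_smul hci hw,
      ← hdc.circleAverage_re_herglotzRieszKernel_smul hw]
    have hk : CircleIntegrable ((Complex.re ∘ herglotzRieszKernel 0 w) • g) 0 R := by
      refine ContinuousOn.circleIntegrable' (ContinuousOn.smul ?_ hgc)
      exact Complex.continuous_re.comp_continuousOn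
        (continuousOn_herglotzRieszKernel_sphere hw)
    have := Complex.reCLM.circleAverage_comp_comm hk
    rw [Complex.reCLM_apply] at this
    rw [← this]
    congr 1
    ext ζ
    simp
  have hga : AnalyticOnNhd ℂ g (Metric.ball 0 R) :=
    (hg.mono Metric.ball_subset_closedBall).analyticOnNhd Metric.isOpen_ball
  have hha : AnalyticOnNhd ℂ h (Metric.ball 0 R) :=
    analyticOnNhd_circleAverage_herglotzRieszKernel_smul hciC
  obtain ⟨c, hc⟩ := (hga.sub hha).eq_const_of_re_eq_const (c₀ := 0)
    (fun w hw => by simp [hre w hw]) Metric.isOpen_ball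
    ((convex_ball (0 : ℂ) R).isConnected ⟨0, Metric.mem_ball_self hR⟩)
  have h0 : (h 0).im = 0 := by
    have : h 0 = Real.circleAverage (fun ζ => ((g ζ).re : ℂ)) 0 R := by
      refine Real.circleAverage_congr_sphere fun ζ hζ => ?_
      have : ζ ≠ 0 := by
        rintro rfl
        simp [eq_comm, hR.ne'] at hζ
      simp [herglotzRieszKernel_def, this]
    rw [this]
    have := Complex.ofRealCLM.circleAverage_comp_comm hci
    simp only [Complex.ofRealCLM_apply] at this
    have e : (Complex.ofRealCLM ∘ fun ζ => (g ζ).re) = fun ζ => ((g ζ).re : ℂ) := rfl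
    rw [e] at this
    rw [this, Complex.ofReal_im]
  have hz0 : (0 : ℂ) ∈ Metric.ball (0 : ℂ) R := Metric.mem_ball_self hR
  have e1 : c = (g 0).im * Complex.I := by
    rw [← hc 0 hz0]
    refine Complex.ext ?_ ?_
    · simp [hre 0 hz0]
    · simp [h0]
  have := hc w hw
  simp only [Pi.sub_apply] at this
  rw [← e1, ← this]
  ring

/-- The measure has density `Re g(R e^{iθ}) / 2π`. Its mass `Re g(0)` does not depend on `R`, which
is what permits `R → 1` afterwards. -/
theorem exists_circle_measure_of_re_nonneg {g : ℂ → ℂ} {R : ℝ} (hR : 0 < R)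
    (hg : DifferentiableOn ℂ g (Metric.closedBall 0 R))
    (hre : ∀ ζ ∈ Metric.closedBall (0 : ℂ) R, 0 ≤ (g ζ).re) :
    ∃ σ : FiniteMeasure Circle, (σ.mass : ℝ) = (g 0).re ∧ ∀ w : ℂ, ‖w‖ < 1 →
      g (R * w) = (g 0).im * Complex.I +
        ∫ ζ : Circle, (ζ + w) / (ζ - w) ∂(σ : Measure Circle) := by
  have hmem : ∀ θ : ℝ, circleMap 0 R θ ∈ Metric.closedBall (0 : ℂ) R := fun θ => by
    simp [abs_of_pos hR]
  set d : ℝ → ℝ := fun θ => (2 * Real.pi)⁻¹ * (g (circleMap 0 R θ)).re with hd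
  have hd0 : ∀ θ, 0 ≤ d θ := fun θ =>
    mul_nonneg (by positivity) (hre _ (hmem θ))
  have hdc : Continuous d := by
    refine continuous_const.mul (Complex.continuous_re.comp ?_)
    exact hg.continuousOn.comp_continuous (continuous_circleMap 0 R) hmem
  set ν : Measure ℝ := (volume.restrict (Set.Ioc 0 (2 * Real.pi))).withDensity
    (fun θ => ENNReal.ofReal (d θ)) with hν
  have hdi : Integrable d (volume.restrict (Set.Ioc 0 (2 * Real.pi))) :=
    (hdc.integrableOn_Icc (a := 0) (b := 2 * Real.pi)).mono_set Set.Ioc_subset_Icc_self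
  have : IsFiniteMeasure ν := isFiniteMeasure_withDensity_ofReal hdi.2
  have hexp : Measurable (fun θ : ℝ => Circle.exp θ) := Circle.exp.continuous.measurable
  have key : ∀ F : Circle → ℂ, Continuous F → ∫ ζ, F ζ ∂(ν.map fun θ : ℝ => Circle.exp θ) =
      ∫ θ in (0 : ℝ)..2 * Real.pi, (d θ : ℂ) * F (Circle.exp θ) := fun F hF => by
    rw [integral_map hexp.aemeasurable hF.aestronglyMeasurable, hν,
      integral_withDensity_eq_integral_toReal_smul (by fun_prop) (by simp),
      intervalIntegral.integral_of_le (by positivity)]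
    refine integral_congr_ae (ae_of_all _ fun θ => ?_)
    simp only [ENNReal.toReal_ofReal (hd0 θ), Complex.real_smul]
  have hF : ∀ w : ℂ, ‖w‖ < 1 → Continuous fun ζ : Circle => ((ζ : ℂ) + w) / (ζ - w) :=
    fun w hw => Continuous.div (continuous_circle_coe.add continuous_const)
      (continuous_circle_coe.sub continuous_const) fun ζ => circle_sub_ne_zero ζ hw
  have hrep : ∀ w : ℂ, ‖w‖ < 1 → g (R * w) = (g 0).im * Complex.I +
      ∫ ζ : Circle, (ζ + w) / (ζ - w) ∂(ν.map fun θ : ℝ => Circle.exp θ) := fun w hw => by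
    rw [eq_add_circleAverage_herglotz hR hg (w := R * w) (by
      simp only [mem_ball_zero_iff, norm_mul, Complex.norm_real, Real.norm_eq_abs, abs_of_pos hR]
      nlinarith), key (fun ζ => (ζ + w) / (ζ - w)) (hF w hw),
      Real.circleAverage_def, ← intervalIntegral.integral_smul]
    congr 1
    refine intervalIntegral.integral_congr fun θ _ => ?_
    have hRC : (R : ℂ) ≠ 0 := by exact_mod_cast hR.ne'
    have hz := circle_sub_ne_zero (Circle.exp θ) hw
    simp only [herglotzRieszKernel_def, sub_zero, hd, circleMap_zero, Circle.coe_exp,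
      Complex.real_smul, smul_eq_mul, Complex.ofReal_mul] at hz ⊢
    rw [← mul_add, ← mul_sub, mul_div_mul_left _ _ hRC]
    push_cast
    ring
  refine ⟨⟨ν.map fun θ : ℝ => Circle.exp θ, inferInstance⟩, ?_, hrep⟩
  have h0 := hrep 0 (by simp)
  have h1 : ∀ ζ : Circle, ((ζ : ℂ) + 0) / (ζ - 0) = 1 := fun ζ => by
    simp [Circle.coe_ne_zero ζ]
  simp only [h1, mul_zero, integral_const, mul_one, Complex.real_smul] at h0
  have h2 := congrArg Complex.re h0
  simp only [Complex.add_re, Complex.mul_re, Complex.ofReal_re, Complex.I_re, Complex.ofReal_im,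
    Complex.I_im, mul_zero, zero_mul, sub_zero, zero_add] at h2
  exact h2.symm

theorem im_cayley_inverse_pos {ζ : ℂ} (hζ : ‖ζ‖ < 1) :
    0 < (Complex.I * (1 + ζ) / (1 - ζ)).im := by
  have hne : 1 - ζ ≠ 0 := fun h => by
    rw [← sub_eq_zero.1 h] at hζ; simp at hζ
  have hpos := Complex.normSq_pos.2 hne
  have h : ζ.re * ζ.re + ζ.im * ζ.im < 1 := by
    rw [← Complex.normSq_apply, Complex.normSq_eq_norm_sq]
    nlinarith [norm_nonneg ζ]
  rw [Complex.div_im, ← sub_div]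
  refine div_pos ?_ hpos
  simp
  nlinarith

/-- **Nevanlinna representation** of a holomorphic function on the upper half-plane with values
in the closed lower half-plane. -/
theorem exists_nevV_of_im_nonpos {f : ℂ → ℂ} (hf : DifferentiableOn ℂ f upperHalf)
    (him : ∀ z ∈ upperHalf, (f z).im ≤ 0) :
    ∃ (a : ℝ) (m : FiniteMeasure ℝ) (b : ℝ), 0 ≤ b ∧
      ∀ z : ℂ, 0 < z.im → f z = nevV a m z - b * z := by
  set ψ : ℂ → ℂ := fun ζ => Complex.I * (1 + ζ) / (1 - ζ) with hψ
  set g : ℂ → ℂ := fun ζ => Complex.I * f (ψ ζ) with hg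
  have hψd : DifferentiableOn ℂ ψ (Metric.ball 0 1) := by
    refine DifferentiableOn.div (by fun_prop) (by fun_prop) fun ζ hζ h => ?_
    rw [← sub_eq_zero.1 h] at hζ
    simp at hζ
  have hψm : Set.MapsTo ψ (Metric.ball 0 1) upperHalf := fun ζ hζ =>
    im_cayley_inverse_pos (by simpa using hζ)
  have hgd : DifferentiableOn ℂ g (Metric.ball 0 1) :=
    (hf.comp hψd hψm).const_mul _
  have hgre : ∀ ζ ∈ Metric.ball (0 : ℂ) 1, 0 ≤ (g ζ).re := fun ζ hζ => by
    have := him _ (hψm hζ)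
    simp only [hg, Complex.mul_re, Complex.I_re, Complex.I_im]
    linarith
  -- `g` need not have boundary values on the unit circle. The formula is applied on smaller discs,
  -- and the measures, all of mass `Re g(0)`, are passed to the limit.
  set R : ℕ → ℝ := fun n => 1 - ((n : ℝ) + 2)⁻¹ with hR
  have hR0 : ∀ n, 0 < R n := fun n => by
    simp only [hR, sub_pos]
    exact inv_lt_one_of_one_lt₀ (by linarith [Nat.cast_nonneg (α := ℝ) n])
  have hR1 : ∀ n, R n < 1 := fun n => by
    simp only [hR]
    have : (0 : ℝ) < ((n : ℝ) + 2)⁻¹ := by positivity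
    linarith
  have hRt : Tendsto R atTop (𝓝 1) := by
    have : Tendsto (fun n : ℕ => ((n : ℝ) + 2)⁻¹) atTop (𝓝 0) :=
      tendsto_inv_atTop_zero.comp
        (tendsto_atTop_add_const_right _ _ tendsto_natCast_atTop_atTop)
    simpa using this.const_sub 1
  have hsub : ∀ n, Metric.closedBall (0 : ℂ) (R n) ⊆ Metric.ball 0 1 := fun n =>
    Metric.closedBall_subset_ball (hR1 n)
  choose σ hσm hσ using fun n => exists_circle_measure_of_re_nonneg (hR0 n)
    (hgd.mono (hsub n)) (fun ζ hζ => hgre ζ (hsub n hζ))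
  set U : Ultrafilter ℕ := hyperfilter ℕ
  have hU : (U : Filter ℕ) ≤ atTop := Nat.hyperfilter_le_atTop
  obtain ⟨a, m, b, hb, h⟩ := exists_circle_limit U (a := fun _ => (g 0).im) (σ := σ)
    (M := |(g 0).im|) (C := (g 0).re.toNNReal) (Eventually.of_forall fun _ => le_rfl)
    (Eventually.of_forall fun n => by
      refine NNReal.le_toNNReal_of_coe_le ?_
      rw [hσm n])
  refine ⟨a, m, b, hb, fun z hz => ?_⟩
  refine tendsto_nhds_unique (f := fun n => f (ψ (R n * cayleyMap z))) (l := (U : Filter ℕ))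
    ?_ ?_
  · have hz1 : ψ (cayleyMap z) = z := cayleyMap_inv (add_I_ne_zero hz.le)
    have hc : ContinuousAt (fun ζ => f (ψ ζ)) (cayleyMap z) :=
      ((hf.comp hψd hψm).differentiableAt
        (Metric.isOpen_ball.mem_nhds (by simpa using norm_cayleyMap_lt_one hz))).continuousAt
    have hc' : Tendsto (fun ζ => f (ψ ζ)) (𝓝 (cayleyMap z)) (𝓝 (f z)) := by
      have := hc.tendsto
      rwa [hz1] at this
    refine hc'.comp ?_
    have : Tendsto (fun n => (R n : ℂ) * cayleyMap z) atTop (𝓝 (((1 : ℝ) : ℂ) * cayleyMap z)) :=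
      ((Complex.continuous_ofReal.tendsto _).comp hRt).mul_const _
    rw [Complex.ofReal_one, one_mul] at this
    exact this.mono_left hU
  · refine (h z hz).congr fun n => ?_
    have h1 := hσ n (cayleyMap z) (norm_cayleyMap_lt_one hz)
    have h2 : f (ψ (R n * cayleyMap z)) = -Complex.I * g (R n * cayleyMap z) := by
      simp only [hg]
      rw [← mul_assoc, neg_mul, Complex.I_mul_I]; ring
    rw [h2, h1, mul_add, ← integral_const_mul]
    congr 1
    rw [mul_comm, mul_assoc, mul_neg, Complex.I_mul_I]; ring

/-! ## Cauchy transforms and their reciprocals -/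

theorem continuous_cauchy_kernel {z : ℂ} (hz : 0 < z.im) :
    Continuous fun x : ℝ => (z - (x : ℂ))⁻¹ :=
  Continuous.inv₀ (by fun_prop) fun x => sub_ofReal_ne_zero hz x

theorem norm_cauchy_kernel_le {z : ℂ} (hz : 0 < z.im) (x : ℝ) : ‖(z - (x : ℂ))⁻¹‖ ≤ z.im⁻¹ := by
  rw [norm_inv]
  exact inv_anti₀ hz (im_le_norm_sub_ofReal hz x)

theorem integrable_cauchy_kernel (μ : Measure ℝ) [IsFiniteMeasure μ] {z : ℂ} (hz : 0 < z.im) :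
    Integrable (fun x : ℝ => (z - (x : ℂ))⁻¹) μ :=
  Integrable.of_bound (continuous_cauchy_kernel hz).aestronglyMeasurable z.im⁻¹
    (ae_of_all _ fun x => norm_cauchy_kernel_le hz x)

/-- Take `m = μ / (1 + x²)`: the weighted kernel is `1 / (z - x) + x / (1 + x²)`, and the drift
cancels the second term. Holomorphy and the formula for the imaginary part are thus inherited from
`nevV`. -/
theorem exists_cauchyG_eq_nevV (μ : ProbabilityMeasure ℝ) :
    ∃ (a : ℝ) (m : FiniteMeasure ℝ), ∀ z : ℂ, 0 < z.im → cauchyG μ z = nevV a m z ∧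
      nevA m z = ∫ x : ℝ, ‖(z - (x : ℂ))⁻¹‖ ^ 2 ∂(μ : Measure ℝ) := by
  set d : ℝ → ℝ := fun x => (1 + x ^ 2)⁻¹ with hd
  have hd0 : ∀ x, 0 ≤ d x := fun x => by positivity
  have hdm : Measurable fun x => ENNReal.ofReal (d x) := by fun_prop
  have hdi : Integrable d (μ : Measure ℝ) :=
    Integrable.of_bound (C := 1) (Measurable.aestronglyMeasurable (by fun_prop))
      (ae_of_all _ fun x => by
        rw [Real.norm_of_nonneg (hd0 x)]
        exact inv_le_one_of_one_le₀ (by nlinarith [sq_nonneg x]))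
  have hfin : IsFiniteMeasure ((μ : Measure ℝ).withDensity fun x => ENNReal.ofReal (d x)) :=
    isFiniteMeasure_withDensity_ofReal hdi.2
  refine ⟨-∫ x, x * d x ∂(μ : Measure ℝ), ⟨_, hfin⟩, fun z hz => ⟨?_, ?_⟩⟩
  · unfold nevV cauchyG
    rw [FiniteMeasure.toMeasure_mk,
      integral_withDensity_eq_integral_toReal_smul hdm (by simp)]
    have hxi : Integrable (fun x : ℝ => ((x * d x : ℝ) : ℂ)) (μ : Measure ℝ) := by
      refine Integrable.ofReal (f := fun x : ℝ => x * d x) (Integrable.of_bound (C := 1)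
        (Measurable.aestronglyMeasurable (by fun_prop)) (ae_of_all _ fun x => ?_))
      rw [norm_mul, Real.norm_of_nonneg (hd0 x), hd, ← div_eq_mul_inv,
        div_le_one (by positivity), Real.norm_eq_abs]
      nlinarith [sq_abs x, sq_nonneg (|x| - 1), abs_nonneg x]
    have e : ∀ x : ℝ, (ENNReal.ofReal (d x)).toReal • ((1 + z * x) / (z - x)) =
        (z - (x : ℂ))⁻¹ + ((x * d x : ℝ) : ℂ) := fun x => by
      rw [ENNReal.toReal_ofReal (hd0 x), Complex.real_smul]
      have h1 := sub_ofReal_ne_zero hz x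
      have h2 : (1 + (x : ℂ) ^ 2) ≠ 0 := by
        have : (1 + (x : ℂ) ^ 2) = ((1 + x ^ 2 : ℝ) : ℂ) := by push_cast; ring
        rw [this]
        exact_mod_cast (by positivity : (1 + x ^ 2 : ℝ) ≠ 0)
      simp only [hd]
      push_cast
      field_simp
      ring
    simp only [e]
    rw [integral_add (integrable_cauchy_kernel _ hz) hxi, integral_complex_ofReal]
    push_cast
    ring
  · unfold nevA
    rw [FiniteMeasure.toMeasure_mk,
      integral_withDensity_eq_integral_toReal_smul hdm (by simp)]
    refine integral_congr_ae (ae_of_all _ fun x => ?_)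
    simp only [ENNReal.toReal_ofReal (hd0 x), smul_eq_mul, norm_inv, inv_pow,
      Complex.normSq_eq_norm_sq]
    simp only [hd]
    have : (1 + x ^ 2) ≠ 0 := by positivity
    field_simp

/-- Cauchy-Schwarz, obtained from the nonnegative variance of `|z - x|⁻¹` under `μ`. -/
theorem norm_cauchyG_sq_le (μ : ProbabilityMeasure ℝ) {z : ℂ} (hz : 0 < z.im) :
    ‖cauchyG μ z‖ ^ 2 ≤ ∫ x : ℝ, ‖(z - (x : ℂ))⁻¹‖ ^ 2 ∂(μ : Measure ℝ) := by
  have hi := (integrable_cauchy_kernel (μ : Measure ℝ) hz).norm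
  have hi2 : Integrable (fun x : ℝ => ‖(z - (x : ℂ))⁻¹‖ ^ 2) (μ : Measure ℝ) := by
    refine Integrable.of_bound (C := z.im⁻¹ ^ 2)
      ((continuous_cauchy_kernel hz).norm.pow 2).aestronglyMeasurable (ae_of_all _ fun x => ?_)
    rw [Real.norm_of_nonneg (by positivity)]
    gcongr
    exact norm_cauchy_kernel_le hz x
  set c := ∫ x : ℝ, ‖(z - (x : ℂ))⁻¹‖ ∂(μ : Measure ℝ) with hc
  have h0 : 0 ≤ ∫ x : ℝ, (‖(z - (x : ℂ))⁻¹‖ - c) ^ 2 ∂(μ : Measure ℝ) :=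
    integral_nonneg fun x => sq_nonneg _
  have e : ∫ x : ℝ, (‖(z - (x : ℂ))⁻¹‖ - c) ^ 2 ∂(μ : Measure ℝ) =
      ∫ x : ℝ, ‖(z - (x : ℂ))⁻¹‖ ^ 2 ∂(μ : Measure ℝ) - c ^ 2 := by
    have : ∀ x : ℝ, (‖(z - (x : ℂ))⁻¹‖ - c) ^ 2 =
        ‖(z - (x : ℂ))⁻¹‖ ^ 2 - 2 * c * ‖(z - (x : ℂ))⁻¹‖ + c ^ 2 := fun x => by ring
    simp only [this]
    have hi3 : Integrable (fun x : ℝ => ‖(z - (x : ℂ))⁻¹‖ ^ 2 - 2 * c * ‖(z - (x : ℂ))⁻¹‖)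
        (μ : Measure ℝ) := hi2.sub (hi.const_mul _)
    rw [integral_add hi3 (integrable_const _), integral_sub hi2 (hi.const_mul _), integral_const_mul, ← hc]
    simp
    ring
  have h1 : ‖cauchyG μ z‖ ≤ c := norm_integral_le_integral_norm _
  have h2 : ‖cauchyG μ z‖ ^ 2 ≤ c ^ 2 := pow_le_pow_left₀ (norm_nonneg _) h1 2
  linarith

theorem im_cauchyG (μ : ProbabilityMeasure ℝ) {z : ℂ} (hz : 0 < z.im) :
    (cauchyG μ z).im = -(z.im * ∫ x : ℝ, ‖(z - (x : ℂ))⁻¹‖ ^ 2 ∂(μ : Measure ℝ)) := by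
  obtain ⟨a, m, h⟩ := exists_cauchyG_eq_nevV μ
  rw [(h z hz).1, im_nevV a m hz, (h z hz).2]

theorem differentiableOn_cauchyG (μ : ProbabilityMeasure ℝ) :
    DifferentiableOn ℂ (cauchyG μ) upperHalf := by
  obtain ⟨a, m, h⟩ := exists_cauchyG_eq_nevV μ
  exact (differentiableOn_nevV a m).congr fun z hz => (h z hz).1

theorem im_cauchyG_neg (μ : ProbabilityMeasure ℝ) {z : ℂ} (hz : 0 < z.im) :
    (cauchyG μ z).im < 0 := by
  rw [im_cauchyG μ hz, neg_lt_zero]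
  refine mul_pos hz ?_
  obtain ⟨a, m, h⟩ := exists_cauchyG_eq_nevV μ
  rw [← (h z hz).2]
  -- If `nevA` vanished at `z`, the mass bound would give `m = 0`, and `nevA` would vanish at `i`
  -- too, where it is the integral of a strictly positive function.
  refine lt_of_le_of_ne (nevA_nonneg m z) fun h0 => ?_
  have hm := mass_le_nevA m hz
  rw [← h0, mul_zero] at hm
  have hm0 : (m : Measure ℝ).real Set.univ = 0 := le_antisymm hm measureReal_nonneg
  have hI : 0 < Complex.I.im := by simp
  have h1 := (h Complex.I hI).2
  rw [nevA_I, hm0] at h1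
  have hpos : 0 < ∫ x : ℝ, ‖(Complex.I - (x : ℂ))⁻¹‖ ^ 2 ∂(μ : Measure ℝ) := by
    rw [integral_pos_iff_support_of_nonneg (fun x => by positivity)]
    · have : Function.support (fun x : ℝ => ‖(Complex.I - (x : ℂ))⁻¹‖ ^ 2) = Set.univ := by
        ext x
        simp [sub_ofReal_ne_zero hI x]
      rw [this]; simp
    · refine Integrable.of_bound (C := Complex.I.im⁻¹ ^ 2)
        ((continuous_cauchy_kernel hI).norm.pow 2).aestronglyMeasurable (ae_of_all _ fun x => ?_)
      rw [Real.norm_of_nonneg (by positivity)]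
      gcongr
      exact norm_cauchy_kernel_le hI x
  linarith

theorem cauchyG_ne_zero (μ : ProbabilityMeasure ℝ) {z : ℂ} (hz : 0 < z.im) : cauchyG μ z ≠ 0 :=
  fun h => by have := im_cauchyG_neg μ hz; rw [h] at this; simp at this

/-- Combine `Im F = -Im G / |G|²` with the Cauchy-Schwarz bound on `|G|²`. Consequently `z - F(z)`
takes values in the closed lower half-plane and has a Nevanlinna representation. -/
theorem im_le_im_recipF (μ : ProbabilityMeasure ℝ) {z : ℂ} (hz : 0 < z.im) :
    z.im ≤ (recipF μ z).im := by
  have hG := cauchyG_ne_zero μ hz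
  rw [recipF, Complex.inv_im, le_div_iff₀ (Complex.normSq_pos.2 hG), im_cauchyG μ hz, neg_neg,
    Complex.normSq_eq_norm_sq]
  exact mul_le_mul_of_nonneg_left (norm_cauchyG_sq_le μ hz) hz.le

theorem im_recipF_pos (μ : ProbabilityMeasure ℝ) {z : ℂ} (hz : 0 < z.im) :
    0 < (recipF μ z).im := hz.trans_le (im_le_im_recipF μ hz)

theorem differentiableOn_recipF (μ : ProbabilityMeasure ℝ) :
    DifferentiableOn ℂ (recipF μ) upperHalf :=
  (differentiableOn_cauchyG μ).inv fun _ hz => cauchyG_ne_zero μ hz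

/-! ### Asymptotics in cones -/

theorem norm_div_sub_le_of_cone {α : ℝ} {z : ℂ} (hz : 0 < z.im) (hc : |z.re| ≤ α * z.im)
    (x : ℝ) : ‖z / (z - x)‖ ≤ 1 + α := by
  rw [norm_div, div_le_iff₀ (norm_pos_iff.2 (sub_ofReal_ne_zero hz x))]
  have hα : 0 ≤ 1 + α := by
    have : 0 ≤ α := by
      by_contra h
      have := (abs_nonneg _).trans hc
      nlinarith
    linarith
  refine (norm_le_of_cone hc hz).trans ?_
  exact mul_le_mul_of_nonneg_left (im_le_norm_sub_ofReal hz x) hα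

theorem tendsto_div_sub_one {ι : Type*} {l : Filter ι} {z : ι → ℂ}
    (hz : Tendsto (fun i => (z i).im) l atTop) (x : ℝ) :
    Tendsto (fun i => z i / (z i - x)) l (𝓝 1) := by
  have hn : Tendsto (fun i => ‖z i - x‖) l atTop :=
    tendsto_atTop_mono' l (by
      filter_upwards [hz.eventually_gt_atTop 0] with i hi
      exact im_le_norm_sub_ofReal hi x) hz
  have h0 : Tendsto (fun i => (x : ℂ) / (z i - x)) l (𝓝 0) := by
    rw [tendsto_zero_iff_norm_tendsto_zero]
    simp only [norm_div]
    exact Tendsto.const_div_atTop hn _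
  have := h0.const_add 1
  rw [add_zero] at this
  refine this.congr' ?_
  filter_upwards [hz.eventually_gt_atTop 0] with i hi
  have := sub_ofReal_ne_zero hi x
  field_simp
  ring

theorem tendsto_integral_cone_kernel (μ : ProbabilityMeasure ℝ) {α : ℝ} {ι : Type*}
    {l : Filter ι} [l.IsCountablyGenerated] {z w : ι → ℂ}
    (hz : Tendsto (fun i => (z i).im) l atTop) (hzc : ∀ᶠ i in l, |(z i).re| ≤ α * (z i).im)
    (hw : Tendsto (fun i => (w i).im) l atTop) (hwc : ∀ᶠ i in l, |(w i).re| ≤ α * (w i).im) :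
    Tendsto (fun i => ∫ x : ℝ, z i / (z i - x) * (w i / (w i - x)) ∂(μ : Measure ℝ)) l
      (𝓝 1) := by
  have h1 : (1 : ℂ) = ∫ _x : ℝ, (1 : ℂ) ∂(μ : Measure ℝ) := by simp
  rw [h1]
  refine tendsto_integral_filter_of_dominated_convergence (fun _ => (1 + α) * (1 + α)) ?_ ?_
    (integrable_const _) ?_
  · filter_upwards [hz.eventually_gt_atTop 0, hw.eventually_gt_atTop 0] with i hi hj
    refine Continuous.aestronglyMeasurable (Continuous.mul ?_ ?_)
    · exact Continuous.div (by fun_prop) (by fun_prop) fun x => sub_ofReal_ne_zero hi x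
    · exact Continuous.div (by fun_prop) (by fun_prop) fun x => sub_ofReal_ne_zero hj x
  · filter_upwards [hz.eventually_gt_atTop 0, hw.eventually_gt_atTop 0, hzc, hwc]
      with i hi hj hi2 hj2
    refine ae_of_all _ fun x => ?_
    have e1 := norm_div_sub_le_of_cone hi hi2 x
    rw [norm_mul]
    exact mul_le_mul e1 (norm_div_sub_le_of_cone hj hj2 x)
      (norm_nonneg _) ((norm_nonneg _).trans e1)
  · refine ae_of_all _ fun x => ?_
    simpa using (tendsto_div_sub_one hz x).mul (tendsto_div_sub_one hw x)

theorem tendsto_mul_cauchyG (μ : ProbabilityMeasure ℝ) {α : ℝ} {ι : Type*}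
    {l : Filter ι} [l.IsCountablyGenerated] {z : ι → ℂ}
    (hz : Tendsto (fun i => (z i).im) l atTop) (hzc : ∀ᶠ i in l, |(z i).re| ≤ α * (z i).im) :
    Tendsto (fun i => z i * cauchyG μ (z i)) l (𝓝 1) := by
  have h1 : (1 : ℂ) = ∫ _x : ℝ, (1 : ℂ) ∂(μ : Measure ℝ) := by simp
  have e : ∀ i, z i * cauchyG μ (z i) = ∫ x : ℝ, z i / (z i - x) ∂(μ : Measure ℝ) := fun i => by
    simp only [cauchyG, ← integral_const_mul, div_eq_mul_inv]
  simp only [e]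
  rw [h1]
  refine tendsto_integral_filter_of_dominated_convergence (fun _ => 1 + α) ?_ ?_
    (integrable_const _) ?_
  · filter_upwards [hz.eventually_gt_atTop 0] with i hi
    exact (Continuous.div (by fun_prop) (by fun_prop)
      fun x => sub_ofReal_ne_zero hi x).aestronglyMeasurable
  · filter_upwards [hz.eventually_gt_atTop 0, hzc] with i hi hi2
    exact ae_of_all _ fun x => norm_div_sub_le_of_cone hi hi2 x
  · exact ae_of_all _ fun x => tendsto_div_sub_one hz x

theorem tendsto_recipF_div (μ : ProbabilityMeasure ℝ) {α : ℝ} {ι : Type*}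
    {l : Filter ι} [l.IsCountablyGenerated] {z : ι → ℂ}
    (hz : Tendsto (fun i => (z i).im) l atTop) (hzc : ∀ᶠ i in l, |(z i).re| ≤ α * (z i).im) :
    Tendsto (fun i => recipF μ (z i) / z i) l (𝓝 1) := by
  have := (tendsto_mul_cauchyG μ hz hzc).inv₀ one_ne_zero
  rw [inv_one] at this
  refine this.congr fun i => ?_
  rw [recipF, mul_inv, div_eq_mul_inv, mul_comm]

theorem tendsto_recipF_div_I (μ : ProbabilityMeasure ℝ) :
    Tendsto (fun y : ℝ => recipF μ (y * Complex.I) / (y * Complex.I)) atTop (𝓝 1) :=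
  tendsto_recipF_div μ (α := 0) (by simp only [Complex.mul_I_im, Complex.ofReal_re]; exact tendsto_id) (by simp)

/-- If `F(z) = F(w)` with `z ≠ w`, then `∫ μ(dx) / ((z - x)(w - x)) = 0`. But `zw` times this
integral tends to `1` as both points go to infinity in the cone. -/
theorem exists_injOn_recipF (μ : ProbabilityMeasure ℝ) (α : ℝ) :
    ∃ β : ℝ, 0 < β ∧ Set.InjOn (recipF μ) (truncCone α β) := by
  by_contra! hcon
  have h : ∀ n : ℕ, ∃ z w : ℂ, z ∈ truncCone α (n + 1) ∧ w ∈ truncCone α (n + 1) ∧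
      recipF μ z = recipF μ w ∧ z ≠ w := fun n => by
    have := hcon ((n : ℝ) + 1) (by positivity)
    simp only [Set.InjOn, not_forall] at this
    obtain ⟨z, hz, w, hw, e, hne⟩ := this
    exact ⟨z, w, hz, hw, e, hne⟩
  choose z w hz hw e hne using h
  have hn : Tendsto (fun n : ℕ => (n : ℝ) + 1) atTop atTop :=
    tendsto_atTop_add_const_right _ _ tendsto_natCast_atTop_atTop
  have hzt : Tendsto (fun n => (z n).im) atTop atTop :=
    tendsto_atTop_mono (fun n => (hz n).1.le) hn
  have hwt : Tendsto (fun n => (w n).im) atTop atTop :=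
    tendsto_atTop_mono (fun n => (hw n).1.le) hn
  have hlim := tendsto_integral_cone_kernel μ (α := α) hzt
    (Eventually.of_forall fun n => (hz n).2.le) hwt (Eventually.of_forall fun n => (hw n).2.le)
  have hzero : ∀ n, ∫ x : ℝ, z n / (z n - x) * (w n / (w n - x)) ∂(μ : Measure ℝ) = 0 :=
      fun n => by
    have hz0 : 0 < (z n).im := lt_trans (by positivity) (hz n).1
    have hw0 : 0 < (w n).im := lt_trans (by positivity) (hw n).1
    have hG : cauchyG μ (z n) = cauchyG μ (w n) := inv_injective (e n)
    have h1 : ∫ x : ℝ, ((z n - (x : ℂ))⁻¹ - (w n - (x : ℂ))⁻¹) ∂(μ : Measure ℝ) = 0 := by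
      rw [integral_sub (integrable_cauchy_kernel _ hz0) (integrable_cauchy_kernel _ hw0)]
      exact sub_eq_zero.2 hG
    have hsub : w n - z n ≠ 0 := sub_ne_zero.2 (hne n).symm
    have h2 : ∀ x : ℝ, z n / (z n - x) * (w n / (w n - x)) =
        z n * w n / (w n - z n) * ((z n - (x : ℂ))⁻¹ - (w n - (x : ℂ))⁻¹) := fun x => by
      have := sub_ofReal_ne_zero hz0 x
      have := sub_ofReal_ne_zero hw0 x
      field_simp
      ring
    simp only [h2]
    rw [integral_const_mul, h1, mul_zero]
  simp only [hzero] at hlim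
  exact zero_ne_one (tendsto_nhds_unique tendsto_const_nhds hlim)

/-! ### Functions that are reciprocal Cauchy transforms -/

/-- The function `1 / F` has a Nevanlinna representation. The real part of `iy / F(iy)` is `y² nevA
+ b y²`; its limit `1` forces `b = 0` and, by monotone convergence, `∫ (1 + x²) dm = 1`. Thus `(1 +
x²) m` is the required law up to an additive constant in `1 / F`, which vanishes because `1 / F`
does so at infinity. -/
theorem exists_recipF_eq {F : ℂ → ℂ} (hF : DifferentiableOn ℂ F upperHalf)
    (him : ∀ z ∈ upperHalf, 0 < (F z).im)
    (hlim : Tendsto (fun y : ℝ => F (y * Complex.I) / (y * Complex.I)) atTop (𝓝 1)) :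
    ∃ μ : ProbabilityMeasure ℝ, ∀ z ∈ upperHalf, recipF μ z = F z := by
  have hF0 : ∀ z ∈ upperHalf, F z ≠ 0 := fun z hz h => by
    have := him z hz; rw [h] at this; simp at this
  obtain ⟨a, m, b, hb, hrep⟩ := exists_nevV_of_im_nonpos (f := fun z => (F z)⁻¹)
    (hF.inv hF0) (fun z hz => by
      rw [Complex.inv_im]
      exact div_nonpos_of_nonpos_of_nonneg (neg_nonpos.2 (him z hz).le) (Complex.normSq_nonneg _))
  have hyim : ∀ y : ℝ, (y * Complex.I : ℂ).im = y := fun y => by simp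
  have hlim1 : Tendsto (fun y : ℝ => y * Complex.I * (F (y * Complex.I))⁻¹) atTop (𝓝 1) := by
    have := hlim.inv₀ one_ne_zero
    rw [inv_one] at this
    refine this.congr fun y => ?_
    rw [inv_div, div_eq_mul_inv]
  have hlim2 : Tendsto (fun y : ℝ => y ^ 2 * nevA m (y * Complex.I) + b * y ^ 2) atTop
      (𝓝 1) := by
    have := (Complex.continuous_re.tendsto _).comp hlim1
    rw [Complex.one_re] at this
    refine this.congr' ?_
    filter_upwards [eventually_gt_atTop 0] with y hy
    have hy' : 0 < (y * Complex.I : ℂ).im := by rw [hyim]; exact hy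
    have h1 := im_nevV a m hy'
    rw [hyim] at h1
    simp only [Function.comp_apply, hrep _ hy']
    simp [h1]
    ring
  have hb0 : b = 0 := by
    refine le_antisymm ?_ hb
    have h3 : Tendsto (fun y : ℝ => (y ^ 2 * nevA m (y * Complex.I) + b * y ^ 2) / y ^ 2) atTop
        (𝓝 0) := hlim2.div_atTop (tendsto_pow_atTop two_ne_zero)
    refine ge_of_tendsto h3 ?_
    filter_upwards [eventually_gt_atTop 0] with y hy
    rw [le_div_iff₀ (by positivity)]
    have := nevA_nonneg m (y * Complex.I)
    nlinarith [mul_nonneg (sq_nonneg y) this]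
  subst hb0
  have hmass : ∫⁻ x : ℝ, ENNReal.ofReal (1 + x ^ 2) ∂(m : Measure ℝ) = 1 := by
    -- With `q = n + 1` this is `(1 + x²) q² / (x² + q²)`, which increases to `1 + x²`.
    set g : ℕ → ℝ → ℝ := fun n x => (n + 1 : ℝ) ^ 2 *
      ((1 + x ^ 2) / Complex.normSq ((((n + 1 : ℝ) : ℂ) * Complex.I) - x)) with hg
    have hgeq : ∀ n x, g n x = (1 + x ^ 2) * ((n + 1) ^ 2 / (x ^ 2 + (n + 1) ^ 2)) := fun n x => by
      rw [hg]
      simp only [normSq_sub_ofReal]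
      simp
      ring
    have hpos : ∀ n : ℕ, 0 < ((((n + 1 : ℝ) : ℂ) * Complex.I)).im := fun n => by
      rw [hyim]; positivity
    refine tendsto_nhds_unique (f := fun n => ∫⁻ x, ENNReal.ofReal (g n x) ∂(m : Measure ℝ))
      (l := atTop) ?_ ?_
    · refine lintegral_tendsto_of_tendsto_of_monotone (fun n => ?_)
        (ae_of_all _ fun x => ?_) (ae_of_all _ fun x => ?_)
      · exact (((integrable_nevA m (hpos n)).const_mul _).aestronglyMeasurable.aemeasurable).ennreal_ofReal
      · intro i j hij
        refine ENNReal.ofReal_le_ofReal ?_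
        rw [hgeq, hgeq]
        refine mul_le_mul_of_nonneg_left ?_ (by positivity)
        rw [div_le_div_iff₀ (by positivity) (by positivity)]
        have h1 : (i : ℝ) ≤ j := by exact_mod_cast hij
        have h2 : ((i : ℝ) + 1) ^ 2 ≤ ((j : ℝ) + 1) ^ 2 := by gcongr
        nlinarith [sq_nonneg x]
      · refine (ENNReal.continuous_ofReal.tendsto _).comp ?_
        have hn : Tendsto (fun n : ℕ => ((n : ℝ) + 1) ^ 2) atTop atTop :=
          (tendsto_pow_atTop two_ne_zero).comp
            (tendsto_atTop_add_const_right _ _ tendsto_natCast_atTop_atTop)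
        have h1 : Tendsto (fun n : ℕ => x ^ 2 / (x ^ 2 + ((n : ℝ) + 1) ^ 2)) atTop (𝓝 0) :=
          Tendsto.const_div_atTop (tendsto_atTop_add_const_left _ _ hn) _
        have h2 := (h1.const_sub 1).const_mul (1 + x ^ 2)
        rw [sub_zero, mul_one] at h2
        refine h2.congr fun n => ?_
        rw [hgeq]
        have : x ^ 2 + ((n : ℝ) + 1) ^ 2 ≠ 0 := by positivity
        field_simp
        ring
    · have hn : Tendsto (fun n : ℕ => (n : ℝ) + 1) atTop atTop :=
        tendsto_atTop_add_const_right _ _ tendsto_natCast_atTop_atTop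
      have h1 := (ENNReal.continuous_ofReal.tendsto _).comp (hlim2.comp hn)
      rw [ENNReal.ofReal_one] at h1
      refine h1.congr fun n => ?_
      simp only [Function.comp_apply, zero_mul, add_zero]
      rw [← ofReal_integral_eq_lintegral_ofReal ((integrable_nevA m (hpos n)).const_mul _)
        (ae_of_all _ fun x => mul_nonneg (by positivity)
          (div_nonneg (by positivity) (Complex.normSq_nonneg _))), integral_const_mul, nevA]
  have hwm : Measurable fun x : ℝ => ENNReal.ofReal (1 + x ^ 2) := by fun_prop
  have hprob : IsProbabilityMeasure
      ((m : Measure ℝ).withDensity fun x : ℝ => ENNReal.ofReal (1 + x ^ 2)) :=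
    ⟨by rw [withDensity_apply _ MeasurableSet.univ, Measure.restrict_univ, hmass]⟩
  set μ : ProbabilityMeasure ℝ := ⟨_, hprob⟩ with hμ
  have hint : Integrable (fun x : ℝ => 1 + x ^ 2) (m : Measure ℝ) :=
    ⟨Measurable.aestronglyMeasurable (by fun_prop), by
      rw [hasFiniteIntegral_iff_ofReal (ae_of_all _ fun x => by positivity), hmass]
      exact ENNReal.one_lt_top⟩
  have hxint : Integrable (fun x : ℝ => (x : ℂ)) (m : Measure ℝ) := by
    refine Integrable.ofReal (Integrable.mono' hint
      (Measurable.aestronglyMeasurable (by fun_prop)) (ae_of_all _ fun x => ?_))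
    rw [Real.norm_eq_abs]
    nlinarith [sq_abs x, sq_nonneg (|x| - 1), abs_nonneg x]
  set c : ℂ := a + ∫ x : ℝ, (x : ℂ) ∂(m : Measure ℝ) with hc
  have hG : ∀ z : ℂ, 0 < z.im → (F z)⁻¹ = c + cauchyG μ z := fun z hz => by
    rw [hrep z hz]
    have h1 : cauchyG μ z = ∫ x : ℝ, (1 + (x : ℂ) ^ 2) / (z - x) ∂(m : Measure ℝ) := by
      unfold cauchyG
      rw [hμ, ProbabilityMeasure.coe_mk,
        integral_withDensity_eq_integral_toReal_smul hwm (by simp)]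
      refine integral_congr_ae (ae_of_all _ fun x => ?_)
      simp only [ENNReal.toReal_ofReal (by positivity : 0 ≤ 1 + x ^ 2), Complex.real_smul]
      push_cast
      rw [div_eq_mul_inv]
    have h2 : ∀ x : ℝ, (1 + (x : ℂ) ^ 2) / (z - x) = (1 + z * x) / (z - x) - x := fun x => by
      have := sub_ofReal_ne_zero hz x
      field_simp
      ring
    rw [h1]
    simp only [h2]
    rw [integral_sub (integrable_nevV m hz) hxint, hc, nevV]
    push_cast
    ring
  have hc0 : c = 0 := by
    have hinv : Tendsto (fun y : ℝ => (y * Complex.I : ℂ)⁻¹) atTop (𝓝 0) := by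
      rw [tendsto_zero_iff_norm_tendsto_zero]
      have : Tendsto (fun y : ℝ => |y|⁻¹) atTop (𝓝 0) :=
        tendsto_inv_atTop_zero.comp tendsto_abs_atTop_atTop
      simpa using this
    have h1 := hinv.mul hlim1
    have h2 := hinv.mul (tendsto_mul_cauchyG μ (α := 0) (l := atTop)
      (z := fun y : ℝ => y * Complex.I) (by simp only [Complex.mul_I_im, Complex.ofReal_re]; exact tendsto_id) (by simp))
    have h3 := h1.sub h2
    rw [mul_one, sub_zero] at h3
    refine tendsto_nhds_unique (l := atTop) ?_ h3
    refine tendsto_const_nhds.congr' ?_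
    filter_upwards [eventually_gt_atTop 0] with y hy
    have hy' : 0 < (y * Complex.I : ℂ).im := by rw [hyim]; exact hy
    have hne : (y * Complex.I : ℂ) ≠ 0 := by simp [hy.ne']
    rw [inv_mul_cancel_left₀ hne, inv_mul_cancel_left₀ hne, hG _ hy']
    ring
  refine ⟨μ, fun z hz => ?_⟩
  have := hG z hz
  rw [hc0, zero_add] at this
  rw [recipF, ← this, inv_inv]

/-! ## Inversion of `w ↦ w + V(w)` and existence of the measure with transform `V` -/

theorem im_add_nevV (a : ℝ) (m : FiniteMeasure ℝ) {w : ℂ} (hw : 0 < w.im) :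
    (w + nevV a m w).im = w.im * (1 - nevA m w) := by
  rw [Complex.add_im, im_nevV a m hw]; ring

theorem nevA_lt_one_of_im_pos {a : ℝ} {m : FiniteMeasure ℝ} {w : ℂ} (hw : 0 < w.im)
    (h : 0 < (w + nevV a m w).im) : nevA m w < 1 := by
  rw [im_add_nevV a m hw] at h
  have := (mul_pos_iff_of_pos_left hw).1 h
  linarith

theorem im_add_nevV_le (a : ℝ) (m : FiniteMeasure ℝ) {w : ℂ} (hw : 0 < w.im) :
    (w + nevV a m w).im ≤ w.im := by
  rw [im_add_nevV a m hw]
  nlinarith [mul_nonneg hw.le (nevA_nonneg m w)]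

/-- Equal images would mean that `V` preserves the distance of the two points, whereas its Lipschitz
constant between them is below `1`. -/
theorem add_nevV_injective {a : ℝ} {m : FiniteMeasure ℝ} {w w' : ℂ} (hw : 0 < w.im)
    (hw' : 0 < w'.im) (hA : nevA m w < 1) (hA' : nevA m w' < 1)
    (h : w + nevV a m w = w' + nevV a m w') : w = w' := by
  by_contra hne
  have hpos : 0 < ‖w - w'‖ := norm_pos_iff.2 (sub_ne_zero.2 hne)
  have h1 := norm_nevV_sub_le a m hw hw'
  have h2 : nevV a m w - nevV a m w' = -(w - w') := by linear_combination h
  rw [h2, norm_neg] at h1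
  nlinarith

/-- The hypothesis gives `nevA < 1` at `w`. Against an anchor `v` with `nevA ≤ 1/2` the Lipschitz
constant is at most `3/4`, whence the factor `4`. This is the properness of `w + V(w)`. -/
theorem exists_norm_le_of_im_add_nevV_pos (a : ℝ) (m : FiniteMeasure ℝ) :
    ∃ C : ℝ, 0 < C ∧ ∀ w : ℂ, 0 < w.im → 0 < (w + nevV a m w).im →
      ‖w‖ ≤ 4 * ‖w + nevV a m w‖ + C := by
  obtain ⟨β, hβ, h⟩ := exists_nevA_le_of_cone m 0 (ε := 1 / 2) (by norm_num)
  set v : ℂ := β * Complex.I with hv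
  have hv0 : 0 < v.im := by simpa [hv] using hβ
  have hvA : nevA m v ≤ 1 / 2 := h v (by simp [hv]) (by simp [hv])
  refine ⟨4 * ‖nevV a m v‖ + 5 * ‖v‖ + 1, by positivity, fun w hw hH => ?_⟩
  have hA := nevA_lt_one_of_im_pos hw hH
  have h1 := norm_nevV_sub_le a m hw hv0
  have h2 : ‖w - v‖ * ((nevA m w + nevA m v) / 2) ≤ ‖w - v‖ * (3 / 4) :=
    mul_le_mul_of_nonneg_left (by linarith) (norm_nonneg _)
  have h3 : ‖w - v‖ ≤ ‖w + nevV a m w‖ + (‖nevV a m w - nevV a m v‖ + (‖nevV a m v‖ + ‖v‖)) := by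
    have e : w - v = (w + nevV a m w) - ((nevV a m w - nevV a m v) + (nevV a m v + v)) := by ring
    rw [e]
    refine (norm_sub_le _ _).trans ?_
    gcongr
    refine (norm_add_le _ _).trans ?_
    gcongr
    exact norm_add_le _ _
  have h4 : ‖w‖ ≤ ‖w - v‖ + ‖v‖ := by simpa using norm_add_le (w - v) v
  linarith

theorem continuousAt_nevA (m : FiniteMeasure ℝ) {w : ℂ} (hw : 0 < w.im) :
    ContinuousAt (nevA m) w := by
  have h : ContinuousAt (fun z => -(nevV 0 m z).im / z.im) w :=
    ((Complex.continuous_im.continuousAt.comp (continuousAt_nevV 0 m hw)).neg).div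
      Complex.continuous_im.continuousAt hw.ne'
  refine h.congr ?_
  filter_upwards [isOpen_upperHalf.mem_nhds hw] with z hz
  exact (nevA_eq 0 m hz).symm

theorem hasStrictDerivAt_add_nevV (a : ℝ) (m : FiniteMeasure ℝ) {w : ℂ} (hw : 0 < w.im) :
    HasStrictDerivAt (fun z => z + nevV a m z) (1 + deriv (nevV a m) w) w := by
  have h : AnalyticAt ℂ (nevV a m) w :=
    (differentiableOn_nevV a m).analyticAt (isOpen_upperHalf.mem_nhds hw)
  exact (hasStrictDerivAt_id w).add h.hasStrictDerivAt

theorem one_add_deriv_nevV_ne_zero {a : ℝ} {m : FiniteMeasure ℝ} {w : ℂ} (hw : 0 < w.im)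
    (hA : nevA m w < 1) : 1 + deriv (nevV a m) w ≠ 0 := fun h => by
  have h1 := norm_deriv_nevV_le a m hw
  have h2 : deriv (nevV a m) w = -1 := by linear_combination h
  rw [h2, norm_neg, norm_one] at h1
  linarith

theorem eventually_mem_of_nevA_lt_one {m : FiniteMeasure ℝ} {w : ℂ} (hw : 0 < w.im)
    (hA : nevA m w < 1) : ∀ᶠ v in 𝓝 w, 0 < v.im ∧ nevA m v < 1 :=
  Eventually.and (isOpen_upperHalf.mem_nhds hw : ∀ᶠ v in 𝓝 w, 0 < v.im) ((continuousAt_nevA m hw).eventually (gt_mem_nhds hA))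

/-- The image of the region `nevA < 1` is open, since the derivative `1 + V'` does not vanish there.
It meets the half-plane, and it is relatively closed in it: properness yields limit points of
preimages, and `Im w ≥ Im (w + V(w))` keeps them off the real axis. Connectedness concludes. -/
theorem exists_add_nevV_eq (a : ℝ) (m : FiniteMeasure ℝ) {z : ℂ} (hz : 0 < z.im) :
    ∃ w : ℂ, 0 < w.im ∧ nevA m w < 1 ∧ w + nevV a m w = z := by
  set H : ℂ → ℂ := fun w => w + nevV a m w with hH
  set S : Set ℂ := H '' {w | 0 < w.im ∧ nevA m w < 1} with hS
  suffices h : upperHalf ⊆ S by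
    obtain ⟨w, ⟨h1, h2⟩, h3⟩ := h hz
    exact ⟨w, h1, h2, h3⟩
  refine isPreconnected_upperHalf.subset_of_closure_inter_subset ?_ ?_ ?_
  · rw [isOpen_iff_mem_nhds]
    rintro _ ⟨w, ⟨hw, hA⟩, rfl⟩
    have h := (hasStrictDerivAt_add_nevV a m hw).map_nhds_eq (one_add_deriv_nevV_ne_zero hw hA)
    change S ∈ 𝓝 ((fun z => z + nevV a m z) w)
    rw [← h]
    exact image_mem_map (eventually_mem_of_nevA_lt_one hw hA)
  · obtain ⟨β, hβ, h⟩ := exists_nevA_le_of_cone m 0 (ε := 1 / 2) (by norm_num)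
    have hv0 : 0 < (β * Complex.I : ℂ).im := by simpa using hβ
    have hvA : nevA m (β * Complex.I) ≤ 1 / 2 := h _ (by simp) (by simp)
    refine ⟨H (β * Complex.I), ?_, _, ⟨hv0, by linarith⟩, rfl⟩
    change 0 < (_ : ℂ).im
    rw [hH]
    simp only
    rw [im_add_nevV a m hv0]
    exact mul_pos hv0 (by linarith)
  · rintro z ⟨hzc, hz⟩
    obtain ⟨u, hu, hut⟩ := mem_closure_iff_seq_limit.1 hzc
    choose w hw hwu using hu
    obtain ⟨C, -, hC⟩ := exists_norm_le_of_im_add_nevV_pos a m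
    have hupos : ∀ n, 0 < (w n + nevV a m (w n)).im := fun n => by
      rw [im_add_nevV a m (hw n).1]
      exact mul_pos (hw n).1 (by linarith [(hw n).2])
    obtain ⟨B, hB⟩ := hut.norm.bddAbove_range
    have hbd : ∀ n, w n ∈ Metric.closedBall (0 : ℂ) (4 * B + C) := fun n => by
      rw [mem_closedBall_zero_iff]
      refine (hC _ (hw n).1 (hupos n)).trans ?_
      have h1 : ‖u n‖ ≤ B := hB ⟨n, rfl⟩
      rw [← hwu n] at h1
      simp only [hH] at h1
      linarith
    obtain ⟨v, -, φ, hφ, hv⟩ := (isCompact_closedBall (0 : ℂ) (4 * B + C)).tendsto_subseq hbd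
    have hvim : z.im ≤ v.im := by
      refine le_of_tendsto_of_tendsto' (((Complex.continuous_im.tendsto _).comp hut).comp
        hφ.tendsto_atTop) ((Complex.continuous_im.tendsto _).comp hv) fun n => ?_
      simp only [Function.comp_apply, ← hwu]
      exact im_add_nevV_le a m (hw _).1
    have hv0 : 0 < v.im := lt_of_lt_of_le hz hvim
    have hHv : H v = z := by
      have h1 : Tendsto (fun n => H (w (φ n))) atTop (𝓝 (H v)) :=
        ((continuousAt_id.add (continuousAt_nevV a m hv0)).tendsto).comp hv
      simp only [hwu] at h1
      exact tendsto_nhds_unique h1 (hut.comp hφ.tendsto_atTop)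
    refine ⟨v, ⟨hv0, nevA_lt_one_of_im_pos (a := a) hv0 ?_⟩, hHv⟩
    have : v + nevV a m v = z := hHv
    rw [this]
    exact hz

/-- Every function `nevV a m` arises by inversion from some reciprocal Cauchy transform. -/
theorem exists_recipF_add_nevV_eq (a : ℝ) (m : FiniteMeasure ℝ) :
    ∃ μ : ProbabilityMeasure ℝ, ∀ z : ℂ, 0 < z.im →
      recipF μ z + nevV a m (recipF μ z) = z := by
  have hex : ∀ z : ℂ, ∃ w : ℂ, 0 < z.im → 0 < w.im ∧ nevA m w < 1 ∧ w + nevV a m w = z :=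
    fun z => by
      by_cases hz : 0 < z.im
      · obtain ⟨w, hw⟩ := exists_add_nevV_eq a m hz
        exact ⟨w, fun _ => hw⟩
      · exact ⟨0, fun h => absurd h hz⟩
  choose F hF using hex
  have hdiff : DifferentiableOn ℂ F upperHalf := fun z hz => by
    obtain ⟨hw, hA, hwz⟩ := hF z hz
    have hs := hasStrictDerivAt_add_nevV a m hw
    have hne := one_add_deriv_nevV_ne_zero (a := a) hw hA
    have hinv := hs.to_localInverse hne
    have hright : ∀ᶠ v in 𝓝 (F z + nevV a m (F z)),
        HasStrictDerivAt.localInverse _ _ _ hs hne v +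
          nevV a m (HasStrictDerivAt.localInverse _ _ _ hs hne v) = v :=
      (hs.hasStrictFDerivAt_equiv hne).eventually_right_inverse
    have hval : HasStrictDerivAt.localInverse _ _ _ hs hne (F z + nevV a m (F z)) = F z :=
      (hs.hasStrictFDerivAt_equiv hne).localInverse_apply_image
    have hcont := hinv.hasDerivAt.continuousAt
    have hmem : ∀ᶠ v in 𝓝 (F z + nevV a m (F z)),
        0 < (HasStrictDerivAt.localInverse _ _ _ hs hne v).im ∧
          nevA m (HasStrictDerivAt.localInverse _ _ _ hs hne v) < 1 := by
      have hm : ∀ᶠ u in 𝓝 (HasStrictDerivAt.localInverse _ _ _ hs hne (F z + nevV a m (F z))),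
          0 < u.im ∧ nevA m u < 1 := by
        rw [hval]
        exact eventually_mem_of_nevA_lt_one hw hA
      exact hcont.eventually hm
    have hz' : ∀ᶠ v in 𝓝 (F z + nevV a m (F z)), 0 < v.im := by
      rw [hwz]; exact isOpen_upperHalf.mem_nhds hz
    -- The local inverse also takes values where `nevA < 1`, so injectivity identifies it with the
    -- global choice `F`.
    have heq : F =ᶠ[𝓝 (F z + nevV a m (F z))] HasStrictDerivAt.localInverse _ _ _ hs hne := by
      filter_upwards [hright, hmem, hz'] with v h1 h2 h3
      obtain ⟨g1, g2, g3⟩ := hF v h3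
      exact add_nevV_injective (a := a) g1 h2.1 g2 h2.2 (by rw [g3, h1])
    have := (hinv.hasDerivAt.congr_of_eventuallyEq heq).differentiableAt
    rw [hwz] at this
    exact this.differentiableWithinAt
  have him : ∀ z ∈ upperHalf, 0 < (F z).im := fun z hz => (hF z hz).1
  have hlim : Tendsto (fun y : ℝ => F (y * Complex.I) / (y * Complex.I)) atTop (𝓝 1) := by
    obtain ⟨C, hC, hbd⟩ := exists_norm_le_of_im_add_nevV_pos a m
    rw [Metric.tendsto_nhds]
    intro ε hε
    -- For `y ≥ C` one has `|w| ≤ 4y + C ≤ 5y ≤ 5 Im w`. This puts `w` in the cone of slope `5`, and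
    -- then `|V(w)| ≤ (ε / 10) 5y = ε y / 2`.
    obtain ⟨β, hβ, hcone⟩ := exists_norm_nevV_le_of_cone a m 5 (ε := ε / 10) (by positivity)
    filter_upwards [eventually_ge_atTop β, eventually_ge_atTop C, eventually_gt_atTop 0]
      with y hy1 hy2 hy
    have hy' : 0 < (y * Complex.I : ℂ).im := by simpa using hy
    obtain ⟨g1, g2, g3⟩ := hF _ hy'
    set w := F (y * Complex.I) with hw
    have hwy : y ≤ w.im := by
      have := im_add_nevV_le a m g1
      rw [g3] at this
      simpa using this
    have hn := hbd w g1 (by rw [g3]; exact hy')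
    have hny : ‖(y * Complex.I : ℂ)‖ = y := by simp [abs_of_pos hy]
    rw [g3, hny] at hn
    have h1 := hcone w (hy1.trans hwy) ((Complex.abs_re_le_norm w).trans (by linarith))
    have h2 : w / (y * Complex.I) - 1 = -nevV a m w / (y * Complex.I) := by
      have : (y * Complex.I : ℂ) ≠ 0 := fun h => by rw [h] at hy'; simp at hy'
      rw [div_sub_one this]
      congr 1
      linear_combination g3
    rw [dist_eq_norm, h2, norm_div, norm_neg, hny, div_lt_iff₀ hy]
    nlinarith
  obtain ⟨μ, hμ⟩ := exists_recipF_eq hdiff him hlim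
  exact ⟨μ, fun z hz => by rw [hμ z hz]; exact (hF z hz).2.2⟩

/-! ### Truncated cones and Voiculescu transforms obtained by inversion -/

theorem isOpen_truncCone (α β : ℝ) : IsOpen (truncCone α β) :=
  (isOpen_lt continuous_const Complex.continuous_im).inter
    (isOpen_lt (continuous_abs.comp Complex.continuous_re)
      (continuous_const.mul Complex.continuous_im))

theorem mem_truncCone {α β : ℝ} {z : ℂ} : z ∈ truncCone α β ↔ β < z.im ∧ |z.re| < α * z.im :=
  Iff.rfl

theorem ofReal_mul_I_mem_truncCone {α β y : ℝ} (hα : 0 < α) (hβ : 0 < β) (hy : β < y) :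
    (y * Complex.I : ℂ) ∈ truncCone α β := by
  rw [mem_truncCone]
  simp only [Complex.mul_I_im, Complex.ofReal_re, Complex.mul_I_re, Complex.ofReal_im, neg_zero,
    abs_zero]
  exact ⟨hy, mul_pos hα (hβ.trans hy)⟩

theorem truncCone_subset {α α' β β' : ℝ} (hα : α ≤ α') (hβ : β' ≤ β) (hβ0 : 0 ≤ β) :
    truncCone α β ⊆ truncCone α' β' := fun z hz => by
  rw [mem_truncCone] at hz ⊢
  exact ⟨hβ.trans_lt hz.1, hz.2.trans_le (by gcongr; exact hβ0.trans hz.1.le)⟩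

/-- Inside a cone the norm and the imaginary part are comparable, so tending to infinity means
gaining height. -/
theorem eventually_truncCone_iff {α β : ℝ} (hα : 0 ≤ α) (hβ : 0 ≤ β) {p : ℂ → Prop} :
    (∀ᶠ z in Bornology.cobounded ℂ ⊓ 𝓟 (truncCone α β), p z) ↔
      ∃ β' : ℝ, β ≤ β' ∧ ∀ z ∈ truncCone α β', p z := by
  rw [eventually_inf_principal, ← comap_norm_atTop, eventually_comap, eventually_atTop]
  constructor
  · rintro ⟨R, hR⟩
    refine ⟨max β R, le_max_left _ _, fun z hz => ?_⟩
    rw [mem_truncCone] at hz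
    refine hR ‖z‖ ?_ z rfl ⟨(le_max_left _ _).trans_lt hz.1, hz.2⟩
    exact (le_max_right _ _).trans (hz.1.le.trans ((le_abs_self _).trans
      (Complex.abs_im_le_norm z)))
  · rintro ⟨β', hβ', h⟩
    refine ⟨(1 + α) * (β' + 1), fun r hr z hzr hz => h z ?_⟩
    rw [mem_truncCone] at hz ⊢
    refine ⟨?_, hz.2⟩
    have h1 := norm_le_of_cone hz.2.le (hβ.trans_lt hz.1)
    rw [hzr] at h1
    have h2 := hr.trans h1
    have h3 := le_of_mul_le_mul_left h2 (by linarith)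
    linarith

/-- The hypothesis makes `F` a right inverse of `w + V(w)`, while the definition asks for the other
composition. High in the cone `nevA < 1`, and injectivity of `w + V(w)` supplies it. -/
theorem isVoiculescuTransform_nevV {ρ : ProbabilityMeasure ℝ} {a : ℝ} {m : FiniteMeasure ℝ}
    (h : ∀ z : ℂ, 0 < z.im → recipF ρ z + nevV a m (recipF ρ z) = z) :
    IsVoiculescuTransform ρ (nevV a m) := by
  refine ⟨differentiableOn_nevV a m, ?_⟩
  obtain ⟨β, hβ, hA⟩ := exists_nevA_le_of_cone m 1 (ε := 1 / 2) (by norm_num)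
  refine ⟨1, β, one_pos, hβ, ?_, fun z hz => ?_, ?_⟩
  · exact (differentiableOn_nevV a m).mono fun z hz => hβ.trans hz.1
  · rw [mem_truncCone] at hz
    have hz0 : 0 < z.im := hβ.trans hz.1
    have hzA := hA z hz.1.le hz.2.le
    have hpos : 0 < (z + nevV a m z).im := by
      rw [im_add_nevV a m hz0]
      exact mul_pos hz0 (by linarith)
    refine ⟨hpos, ?_⟩
    have h1 := h _ hpos
    have h2 := im_recipF_pos ρ hpos
    exact add_nevV_injective (a := a) h2 hz0
      (nevA_lt_one_of_im_pos (a := a) h2 (by rw [h1]; exact hpos)) (by linarith) h1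
  · rw [Metric.tendsto_nhds]
    intro ε hε
    rw [eventually_truncCone_iff zero_le_one hβ.le]
    obtain ⟨β', hβ', hV⟩ := exists_norm_nevV_le_of_cone a m 1 (half_pos hε)
    refine ⟨max β β', le_max_left _ _, fun z hz => ?_⟩
    rw [mem_truncCone] at hz
    have hz1 : β' < z.im := (le_max_right _ _).trans_lt hz.1
    have hz0 : 0 < ‖z‖ := (hβ'.trans hz1).trans_le ((le_abs_self _).trans
      (Complex.abs_im_le_norm z))
    rw [dist_zero_right, norm_div, div_lt_iff₀ hz0]
    refine (hV z hz1.le hz.2.le).trans_lt ?_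
    gcongr
    linarith

theorem exists_isVoiculescuTransform_nevV (a : ℝ) (m : FiniteMeasure ℝ) :
    ∃ μ : ProbabilityMeasure ℝ, IsVoiculescuTransform μ (nevV a m) := by
  obtain ⟨μ, hμ⟩ := exists_recipF_add_nevV_eq a m
  exact ⟨μ, isVoiculescuTransform_nevV hμ⟩

/-! ### Uniqueness of the Voiculescu transform -/

/-- Identity theorem: continuity at `z₀` and injectivity make the image of `Γ` accumulate at `h z₀`.
-/
theorem eq_of_eqOn_image {f g h : ℂ → ℂ} (hf : DifferentiableOn ℂ f upperHalf)
    (hg : DifferentiableOn ℂ g upperHalf) {Γ : Set ℂ} (hΓ : IsOpen Γ) {z₀ : ℂ} (hz₀ : z₀ ∈ Γ)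
    (hh : ContinuousAt h z₀) (hinj : Set.InjOn h Γ) (hmaps : ∀ z ∈ Γ, 0 < (h z).im)
    (heq : ∀ z ∈ Γ, f (h z) = g (h z)) : ∀ z : ℂ, 0 < z.im → f z = g z := by
  have hfa := hf.analyticOnNhd isOpen_upperHalf
  have hga := hg.analyticOnNhd isOpen_upperHalf
  refine fun z hz => hfa.eqOn_of_preconnected_of_frequently_eq hga isPreconnected_upperHalf
    (hmaps z₀ hz₀) ?_ hz
  have ht : Tendsto h (𝓝[≠] z₀) (𝓝[≠] (h z₀)) := by
    refine tendsto_nhdsWithin_iff.2 ⟨hh.tendsto.mono_left nhdsWithin_le_nhds, ?_⟩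
    filter_upwards [nhdsWithin_le_nhds (hΓ.mem_nhds hz₀), self_mem_nhdsWithin] with z h1 h2 h3
    exact h2 (hinj h1 hz₀ h3)
  refine ht.frequently (Eventually.frequently ?_)
  filter_upwards [nhdsWithin_le_nhds (hΓ.mem_nhds hz₀)] with z hz
  exact heq z hz

/-- At points `z + V(z)` with `z` in the cone the identity is immediate, and such points suffice for
analytic continuation. -/
theorem recipF_add_eq_of_isVoiculescuTransform {ρ : ProbabilityMeasure ℝ} {V : ℂ → ℂ}
    (h : IsVoiculescuTransform ρ V) {z : ℂ} (hz : 0 < z.im) :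
    recipF ρ z + V (recipF ρ z) = z := by
  obtain ⟨hV, α, β, hα, hβ, hd, hF, -⟩ := h
  have hmem := ofReal_mul_I_mem_truncCone hα hβ (lt_add_one β)
  refine eq_of_eqOn_image (f := fun z => recipF ρ z + V (recipF ρ z)) (g := fun z => z)
    (h := fun z => z + V z) ((differentiableOn_recipF ρ).add (hV.comp (differentiableOn_recipF ρ)
      fun z hz => im_recipF_pos ρ hz)) differentiableOn_id (isOpen_truncCone α β) hmem ?_ ?_
    (fun z hz => (hF z hz).1) (fun z hz => ?_) z hz
  · exact (differentiableAt_id.add (hd.differentiableAt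
      ((isOpen_truncCone α β).mem_nhds hmem))).continuousAt
  · intro z hz w hw e
    rw [← (hF z hz).2, ← (hF w hw).2]
    exact congrArg _ e
  · rw [(hF z hz).2]

/-- Both `z + V(z)` and `z + V'(z)` are sent to `z` by `F`, and for high `z` both lie in a cone
where `F` is injective. -/
theorem eq_on_truncCone_of_isVoiculescuNearInfty {ρ : ProbabilityMeasure ℝ} {V V' : ℂ → ℂ}
    (h : IsVoiculescuNearInfty ρ V) (h' : IsVoiculescuNearInfty ρ V') :
    ∃ α β : ℝ, 0 < α ∧ 0 < β ∧ ∀ z ∈ truncCone α β, V z = V' z := by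
  obtain ⟨α₁, β₁, hα₁, hβ₁, -, hF₁, ht₁⟩ := h
  obtain ⟨α₂, β₂, hα₂, hβ₂, -, hF₂, ht₂⟩ := h'
  set α := min α₁ α₂ with hα
  have hα0 : 0 < α := lt_min hα₁ hα₂
  -- When `|V(z)| < Im z / 2`, the point `z + V(z)` has height above `Im z / 2` and real part below
  -- `(α + 1/2) Im z` in modulus, so aperture `2α + 2` suffices.
  obtain ⟨β₀, hβ₀, hinj⟩ := exists_injOn_recipF ρ (2 * α + 2)
  have key : ∀ (α₁ β₁ : ℝ) (V : ℂ → ℂ), 0 < α₁ → 0 < β₁ → α ≤ α₁ →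
      Tendsto (fun z => V z / z) (Bornology.cobounded ℂ ⊓ 𝓟 (truncCone α₁ β₁)) (𝓝 0) →
      ∃ β' : ℝ, β₁ ≤ β' ∧ ∀ z ∈ truncCone α β', 2 * β₀ < z.im →
        z + V z ∈ truncCone (2 * α + 2) β₀ := fun α₁ β₁ V hα₁ hβ₁ hαα ht => by
    have hε : 0 < (2 * (1 + α))⁻¹ := by positivity
    have h1 := (Metric.tendsto_nhds.1 ht) _ hε
    rw [eventually_truncCone_iff hα₁.le hβ₁.le] at h1
    obtain ⟨β', hβ', hb⟩ := h1
    refine ⟨β', hβ', fun z hz hzβ => ?_⟩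
    have hz1 := hb z (truncCone_subset hαα le_rfl (hβ₁.le.trans hβ') hz)
    rw [mem_truncCone] at hz ⊢
    have hz0 : 0 < z.im := (hβ₁.trans_le hβ').trans hz.1
    have hzn : 0 < ‖z‖ := hz0.trans_le ((le_abs_self _).trans (Complex.abs_im_le_norm z))
    rw [dist_zero_right, norm_div, div_lt_iff₀ hzn] at hz1
    have h2 := norm_le_of_cone hz.2.le hz0
    have h3 : ‖V z‖ < z.im / 2 := by
      refine hz1.trans_le ?_
      calc (2 * (1 + α))⁻¹ * ‖z‖ ≤ (2 * (1 + α))⁻¹ * ((1 + α) * z.im) := by gcongr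
        _ = z.im / 2 := by field_simp
    have h4 := (Complex.abs_im_le_norm (V z)).trans_lt h3
    have h5 := (Complex.abs_re_le_norm (V z)).trans_lt h3
    rw [abs_lt] at h4
    refine ⟨by rw [Complex.add_im]; linarith, ?_⟩
    have h6 : |(z + V z).re| ≤ |z.re| + |(V z).re| := by
      rw [Complex.add_re]; exact abs_add_le _ _
    rw [Complex.add_im]
    nlinarith [mul_pos hα0 hz0]
  obtain ⟨b₁, hb₁, hk₁⟩ := key α₁ β₁ V hα₁ hβ₁ (min_le_left _ _) ht₁
  obtain ⟨b₂, hb₂, hk₂⟩ := key α₂ β₂ V' hα₂ hβ₂ (min_le_right _ _) ht₂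
  refine ⟨α, max (max b₁ b₂) (2 * β₀), hα0, by positivity, fun z hz => ?_⟩
  have hz1 : z ∈ truncCone α b₁ := ⟨((le_max_left _ _).trans (le_max_left _ _)).trans_lt hz.1, hz.2⟩
  have hz2 : z ∈ truncCone α b₂ :=
    ⟨((le_max_right _ _).trans (le_max_left _ _)).trans_lt hz.1, hz.2⟩
  have hz3 : 2 * β₀ < z.im := (le_max_right _ _).trans_lt hz.1
  have e := hinj (hk₁ z hz1 hz3) (hk₂ z hz2 hz3) (by
    rw [(hF₁ z (truncCone_subset (min_le_left _ _) hb₁ (hβ₁.le.trans hb₁) hz1)).2,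
      (hF₂ z (truncCone_subset (min_le_right _ _) hb₂ (hβ₂.le.trans hb₂) hz2)).2])
  exact add_left_cancel e

theorem IsVoiculescuTransform.eq {ρ : ProbabilityMeasure ℝ} {V V' : ℂ → ℂ}
    (h : IsVoiculescuTransform ρ V) (h' : IsVoiculescuTransform ρ V') {z : ℂ} (hz : 0 < z.im) :
    V z = V' z := by
  obtain ⟨α, β, hα, hβ, he⟩ := eq_on_truncCone_of_isVoiculescuNearInfty h.2 h'.2
  exact eq_of_eqOn_image h.1 h'.1 (isOpen_truncCone α β)
    (ofReal_mul_I_mem_truncCone hα hβ (lt_add_one β)) continuousAt_id (fun _ _ _ _ e => e)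
    (fun z hz => hβ.trans hz.1) he z hz

theorem eq_of_eq_imaginary_axis {f g : ℂ → ℂ} (hf : DifferentiableOn ℂ f upperHalf)
    (hg : DifferentiableOn ℂ g upperHalf)
    (h : ∀ t : ℝ, 0 < t → f (t * Complex.I) = g (t * Complex.I)) {z : ℂ} (hz : 0 < z.im) :
    f z = g z := by
  have hfa := hf.analyticOnNhd isOpen_upperHalf
  have hga := hg.analyticOnNhd isOpen_upperHalf
  refine hfa.eqOn_of_preconnected_of_frequently_eq hga isPreconnected_upperHalf
    (z₀ := Complex.I) (by simp [mem_upperHalf]) ?_ hz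
  have ht : Tendsto (fun t : ℝ => (t * Complex.I : ℂ)) (𝓝[≠] 1) (𝓝[≠] Complex.I) := by
    refine tendsto_nhdsWithin_iff.2 ⟨?_, ?_⟩
    · have : ContinuousAt (fun t : ℝ => (t * Complex.I : ℂ)) 1 := by fun_prop
      have h2 := this.tendsto
      simp only [Complex.ofReal_one, one_mul] at h2
      exact h2.mono_left nhdsWithin_le_nhds
    · filter_upwards [self_mem_nhdsWithin] with t ht h1
      apply ht
      have h2 := congrArg Complex.im h1
      simpa using h2
  refine ht.frequently (Eventually.frequently ?_)
  filter_upwards [nhdsWithin_le_nhds (lt_mem_nhds one_pos)] with t ht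
  exact h t ht

/-! ## Free infinite divisibility -/

theorem tendsto_nevV_recipF_div (ρ : ProbabilityMeasure ℝ) (a : ℝ) (m : FiniteMeasure ℝ) :
    Tendsto (fun y : ℝ => nevV a m (recipF ρ (y * Complex.I)) / (y * Complex.I)) atTop (𝓝 0) := by
  rw [Metric.tendsto_nhds]
  intro ε hε
  obtain ⟨β, hβ, h⟩ := exists_norm_nevV_le_of_cone a m 2 (ε := ε / 4) (by positivity)
  have hF := (tendsto_recipF_div_I ρ).norm
  rw [norm_one] at hF
  filter_upwards [eventually_ge_atTop β, hF.eventually (gt_mem_nhds one_lt_two)] with y hy hFy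
  have hy0 : 0 < y := hβ.trans_le hy
  have hy' : 0 < (y * Complex.I : ℂ).im := by simpa using hy0
  have hny : ‖(y * Complex.I : ℂ)‖ = y := by simp [abs_of_pos hy0]
  have him : y ≤ (recipF ρ (y * Complex.I)).im := by simpa using im_le_im_recipF ρ hy'
  rw [norm_div, hny, div_lt_iff₀ hy0] at hFy
  have h1 := h _ (hy.trans him) ((Complex.abs_re_le_norm _).trans (by linarith))
  rw [dist_zero_right, norm_div, hny, div_lt_iff₀ hy0]
  nlinarith

/-- By compactness the limit relation reads `V(F(z)) - b F(z) = z - F(z)`. Divided by `z = iy → i∞`,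
the left side tends to `-b` and the right side to `0`. Both infinite divisibility and weak limits
are handled by this statement. -/
theorem exists_isVoiculescuTransform_of_limit {ρ : ProbabilityMeasure ℝ} {ι : Type*}
    (U : Ultrafilter ι) {a : ι → ℝ} {m : ι → FiniteMeasure ℝ} {ω : ι → ℂ → ℂ}
    (hω : ∀ z : ℂ, 0 < z.im → Tendsto (fun i => ω i z) U (𝓝 (recipF ρ z)))
    (hV : ∀ z : ℂ, 0 < z.im →
      Tendsto (fun i => nevV (a i) (m i) (ω i z)) U (𝓝 (z - recipF ρ z))) :
    ∃ (a : ℝ) (m : FiniteMeasure ℝ), IsVoiculescuTransform ρ (nevV a m) := by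
  have hI : 0 < Complex.I.im := by simp
  obtain ⟨a', m', b, hb, h⟩ := exists_nevV_limit U (im_recipF_pos ρ hI) (hω _ hI) (hV _ hI)
  have key : ∀ z : ℂ, 0 < z.im →
      nevV a' m' (recipF ρ z) - b * recipF ρ z = z - recipF ρ z := fun z hz =>
    tendsto_nhds_unique (h _ _ (im_recipF_pos ρ hz) (hω z hz)) (hV z hz)
  have hb0 : b = 0 := by
    have h1 := (tendsto_nevV_recipF_div ρ a' m').sub ((tendsto_recipF_div_I ρ).const_mul (b : ℂ))
    have h2 := (tendsto_recipF_div_I ρ).const_sub 1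
    have h3 := tendsto_nhds_unique (h1.congr' ?_) h2
    · simpa using h3
    · filter_upwards [eventually_gt_atTop 0] with y hy
      have hy' : 0 < (y * Complex.I : ℂ).im := by simpa using hy
      have hne : (y * Complex.I : ℂ) ≠ 0 := fun h => by rw [h] at hy'; simp at hy'
      rw [mul_div_assoc', ← sub_div, key _ hy', sub_div, div_self hne]
  refine ⟨a', m', isVoiculescuTransform_nevV fun z hz => ?_⟩
  have := key z hz
  rw [hb0] at this
  simp only [Complex.ofReal_zero, zero_mul, sub_zero] at this
  rw [this]
  ring

theorem nevV_smul (c : NNReal) (a : ℝ) (m : FiniteMeasure ℝ) (z : ℂ) :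
    nevV (c * a) (c • m) z = c * nevV a m z := by
  unfold nevV
  rw [FiniteMeasure.toMeasure_smul, integral_smul_nnreal_measure, NNReal.smul_def,
    Complex.real_smul]
  push_cast
  ring

/-- Subordination for free convolution powers. -/
theorem recipF_subordination {n : ℕ} (hn : 1 ≤ n) {μ ρ : ProbabilityMeasure ℝ}
    (h : IsFreeConv (fun _ : Fin n => μ) ρ) {z : ℂ} (hz : 0 < z.im) :
    recipF μ ((n : ℝ)⁻¹ * z + (1 - (n : ℝ)⁻¹ : ℝ) * recipF ρ z) = recipF ρ z := by
  obtain ⟨V, hV, hρ⟩ := h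
  have : NeZero n := ⟨by omega⟩
  choose α β hα hβ he using fun i => eq_on_truncCone_of_isVoiculescuNearInfty (hV i) (hV 0)
  obtain ⟨α₁, β₁, hα₁, hβ₁, -, hF₁, -⟩ := hV 0
  obtain ⟨α₂, β₂, hα₂, hβ₂, hd₂, hF₂, -⟩ := hρ
  -- The functions `V i` belong to the same law but are only known to agree on truncated cones, so a
  -- common smaller cone is taken.
  set α₀ := min (Finset.univ.inf' ⟨0, Finset.mem_univ _⟩ α) (min α₁ α₂) with hα₀
  set β₀ := (∑ i, β i) + (β₁ + β₂) with hβ₀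
  have hα₀' : 0 < α₀ := lt_min ((Finset.lt_inf'_iff _).2 fun i _ => hα i) (lt_min hα₁ hα₂)
  have hsum : 0 < ∑ i, β i := Finset.sum_pos (fun i _ => hβ i) ⟨0, Finset.mem_univ _⟩
  have hβ₀' : 0 < β₀ := by positivity
  have hs1 : truncCone α₀ β₀ ⊆ truncCone α₁ β₁ :=
    truncCone_subset ((min_le_right _ _).trans (min_le_left _ _)) (by linarith) hβ₀'.le
  have hs2 : truncCone α₀ β₀ ⊆ truncCone α₂ β₂ :=
    truncCone_subset ((min_le_right _ _).trans (min_le_right _ _)) (by linarith) hβ₀'.le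
  have hs : ∀ i, truncCone α₀ β₀ ⊆ truncCone (α i) (β i) := fun i =>
    truncCone_subset ((min_le_left _ _).trans (Finset.inf'_le _ (Finset.mem_univ i)))
      (by
        have := Finset.single_le_sum (f := β) (fun i _ => (hβ i).le) (Finset.mem_univ i)
        linarith) hβ₀'.le
  have hsumV : ∀ w ∈ truncCone α₀ β₀, ∑ i, V i w = n * V 0 w := fun w hw => by
    rw [Finset.sum_congr rfl fun i _ => he i w (hs i hw)]
    simp
  have hn0 : (0 : ℝ) < n := by exact_mod_cast hn
  have hinv : (n : ℝ)⁻¹ ≤ 1 := inv_le_one_of_one_le₀ (by exact_mod_cast hn)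
  have hmem := ofReal_mul_I_mem_truncCone hα₀' hβ₀' (lt_add_one β₀)
  refine eq_of_eqOn_image (f := fun z => recipF μ ((n : ℝ)⁻¹ * z +
    (1 - (n : ℝ)⁻¹ : ℝ) * recipF ρ z)) (g := recipF ρ) (h := fun w => w + ∑ i, V i w)
    ?_ (differentiableOn_recipF ρ) (isOpen_truncCone α₀ β₀) hmem ?_ ?_
    (fun w hw => (hF₂ w (hs2 hw)).1) (fun w hw => ?_) z hz
  · refine (differentiableOn_recipF μ).comp ((differentiableOn_id.const_mul _).add
      ((differentiableOn_recipF ρ).const_mul _)) fun w hw => ?_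
    change 0 < (_ : ℂ).im
    simp only [Complex.add_im, Complex.im_ofReal_mul]
    have h1 : 0 < (n : ℝ)⁻¹ * w.im := mul_pos (by positivity) hw
    have h2 : 0 ≤ (1 - (n : ℝ)⁻¹) * (recipF ρ w).im :=
      mul_nonneg (by linarith) (im_recipF_pos ρ hw).le
    linarith
  · exact (differentiableAt_id.add (hd₂.differentiableAt
      ((isOpen_truncCone α₂ β₂).mem_nhds (hs2 hmem)))).continuousAt
  · intro w hw w' hw' e
    rw [← (hF₂ w (hs2 hw)).2, ← (hF₂ w' (hs2 hw')).2]
    exact congrArg _ e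
  · have h1 := (hF₂ w (hs2 hw)).2
    have h2 := (hF₁ w (hs1 hw)).2
    simp only at h1 ⊢
    rw [h1, hsumV w hw]
    convert h2 using 2
    have : (n : ℂ) ≠ 0 := by exact_mod_cast hn0.ne'
    push_cast
    field_simp
    ring

/-- `Im F(w) ≥ Im w` gives the sign needed for a representation, and `F(iy) / iy → 1` excludes its
linear term. -/
theorem exists_nevV_eq_mul_sub_recipF (μ : ProbabilityMeasure ℝ) {c : ℝ} (hc : 0 ≤ c) :
    ∃ (a : ℝ) (m : FiniteMeasure ℝ), ∀ w : ℂ, 0 < w.im →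
      nevV a m w = c * (w - recipF μ w) := by
  obtain ⟨a, m, b, hb, h⟩ := exists_nevV_of_im_nonpos (f := fun w => c * (w - recipF μ w))
    ((differentiableOn_id.sub (differentiableOn_recipF μ)).const_mul _) (fun w hw => by
      rw [Complex.im_ofReal_mul, Complex.sub_im]
      have := im_le_im_recipF μ hw
      exact mul_nonpos_of_nonneg_of_nonpos hc (by linarith))
  have hb0 : b = 0 := by
    have h1 := ((tendsto_recipF_div_I μ).const_sub 1).const_mul (c : ℂ)
    have h2 := (tendsto_nevV_div_I a m).sub_const (b : ℂ)
    have h3 := tendsto_nhds_unique (h2.congr' ?_) h1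
    · simpa using h3
    · filter_upwards [eventually_gt_atTop 0] with y hy
      have hy' : 0 < (y * Complex.I : ℂ).im := by simpa using hy
      have hne : (y * Complex.I : ℂ) ≠ 0 := fun h => by rw [h] at hy'; simp at hy'
      have h4 := h _ hy'
      have h5 : nevV a m (y * Complex.I) =
          c * (y * Complex.I - recipF μ (y * Complex.I)) + b * (y * Complex.I) := by
        rw [h4]; ring
      rw [h5, add_div, mul_div_cancel_right₀ _ hne, mul_div_assoc, sub_div, div_self hne]
      ring
  refine ⟨a, m, fun w hw => ?_⟩
  rw [h w hw, hb0]
  simp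

/-- With `μ` an `n`-th root, the Nevanlinna function `n (w - F_μ(w))` takes the value `z - F_ρ(z)`
at the subordination point `ω = z / n + (1 - 1/n) F_ρ(z)`. Since `ω → F_ρ(z)` as `n → ∞`, the limit
criterion applies. Conversely, the pair `(a, m) / n` belongs to an `n`-th root. -/
theorem mem_freeID_iff {ρ : ProbabilityMeasure ℝ} :
    ρ ∈ freeID ↔ ∃ (a : ℝ) (m : FiniteMeasure ℝ), IsVoiculescuTransform ρ (nevV a m) := by
  constructor
  · intro h
    choose μ hμ using fun k : ℕ => h (k + 1) (Nat.le_add_left 1 k)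
    choose a m ham using fun k : ℕ => exists_nevV_eq_mul_sub_recipF (μ k)
      (c := ((k + 1 : ℕ) : ℝ)) (Nat.cast_nonneg _)
    set ω : ℕ → ℂ → ℂ := fun k z =>
      (((k + 1 : ℕ) : ℝ)⁻¹ : ℝ) * z + (1 - ((k + 1 : ℕ) : ℝ)⁻¹ : ℝ) * recipF ρ z with hω
    have hinv : Tendsto (fun k : ℕ => (((k + 1 : ℕ) : ℝ)⁻¹ : ℝ)) atTop (𝓝 0) :=
      tendsto_inv_atTop_zero.comp
        (tendsto_natCast_atTop_atTop.comp (tendsto_add_atTop_nat 1))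
    refine exists_isVoiculescuTransform_of_limit (hyperfilter ℕ) (a := a) (m := m) (ω := ω)
      (fun z hz => ?_) (fun z hz => ?_)
    · have h1 := ((Complex.continuous_ofReal.tendsto _).comp hinv).mul_const z
      have h2 := ((Complex.continuous_ofReal.tendsto _).comp (hinv.const_sub 1)).mul_const
        (recipF ρ z)
      have h3 := h1.add h2
      simp only [Complex.ofReal_zero, zero_mul, sub_zero, Complex.ofReal_one, one_mul,
        zero_add] at h3
      exact h3.mono_left Nat.hyperfilter_le_atTop
    · refine tendsto_const_nhds.congr fun k => ?_
      have hsub := recipF_subordination (Nat.le_add_left 1 k) (hμ k) hz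
      have hk0 : (0 : ℝ) < ((k + 1 : ℕ) : ℝ) := by positivity
      have hinv1 : ((k + 1 : ℕ) : ℝ)⁻¹ ≤ 1 :=
        inv_le_one_of_one_le₀ (by exact_mod_cast Nat.le_add_left 1 k)
      have hpos : 0 < (ω k z).im := by
        simp only [hω, Complex.add_im, Complex.im_ofReal_mul]
        have h1 : 0 < ((k + 1 : ℕ) : ℝ)⁻¹ * z.im := mul_pos (by positivity) hz
        have h2 : 0 ≤ (1 - ((k + 1 : ℕ) : ℝ)⁻¹) * (recipF ρ z).im :=
          mul_nonneg (by linarith) (im_recipF_pos ρ hz).le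
        linarith
      rw [ham k _ hpos]
      have hsub' : recipF (μ k) (ω k z) = recipF ρ z := by
        rw [← hsub]
      rw [hsub']
      have : (((k + 1 : ℕ) : ℝ) : ℂ) ≠ 0 := by exact_mod_cast hk0.ne'
      simp only [hω, Complex.ofReal_sub, Complex.ofReal_inv, Complex.ofReal_one]
      field_simp
      ring
  · rintro ⟨a, m, h⟩ n hn
    set c : NNReal := (n : NNReal)⁻¹ with hc
    obtain ⟨μ, hμ⟩ := exists_isVoiculescuTransform_nevV (c * a) (c • m)
    refine ⟨μ, fun _ => nevV (c * a) (c • m), fun _ => hμ.2, ?_⟩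
    have e : (fun z => ∑ _i : Fin n, nevV (c * a) (c • m) z) = nevV a m := by
      ext z
      have hn0 : (n : ℂ) ≠ 0 := by exact_mod_cast (by omega : n ≠ 0)
      simp only [nevV_smul, Finset.sum_const, Finset.card_univ, Fintype.card_fin, nsmul_eq_mul, hc]
      push_cast
      rw [← mul_assoc, mul_inv_cancel₀ hn0, one_mul]
    rw [e]
    exact h.2

/-! ### Weak closedness of the free infinitely divisible laws -/

theorem continuous_cauchyG {z : ℂ} (hz : 0 < z.im) :
    Continuous fun μ : ProbabilityMeasure ℝ => cauchyG μ z := by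
  rw [continuous_iff_continuousAt]
  intro ρ
  have h := (ProbabilityMeasure.tendsto_iff_forall_integral_rclike_tendsto ℂ).1
    (tendsto_id (α := ProbabilityMeasure ℝ) (x := 𝓝 ρ))
  exact h (BoundedContinuousFunction.ofNormedAddCommGroup (fun x : ℝ => (z - (x : ℂ))⁻¹)
    (continuous_cauchy_kernel hz) z.im⁻¹ (norm_cauchy_kernel_le hz))

/-- Weak convergence gives convergence of the reciprocal Cauchy transforms, and the relation
`V(F(z)) = z - F(z)` passes to the limit by compactness. -/
theorem isClosed_freeID : IsClosed freeID := by
  rw [isClosed_iff_ultrafilter]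
  intro ρ U hU hmem
  have hex : ∀ μ : ProbabilityMeasure ℝ, ∃ (a : ℝ) (m : FiniteMeasure ℝ),
      μ ∈ freeID → IsVoiculescuTransform μ (nevV a m) := fun μ => by
    by_cases h : μ ∈ freeID
    · obtain ⟨a, m, h1⟩ := mem_freeID_iff.1 h
      exact ⟨a, m, fun _ => h1⟩
    · exact ⟨0, 0, fun h' => absurd h' h⟩
  choose a m ham using hex
  have hF : ∀ z : ℂ, 0 < z.im →
      Tendsto (fun μ : ProbabilityMeasure ℝ => recipF μ z) U (𝓝 (recipF ρ z)) := fun z hz =>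
    (((continuous_cauchyG hz).tendsto ρ).mono_left hU).inv₀ (cauchyG_ne_zero ρ hz)
  refine mem_freeID_iff.2 (exists_isVoiculescuTransform_of_limit U (a := a) (m := m)
    (ω := fun μ => recipF μ) hF fun z hz => ?_)
  refine ((hF z hz).const_sub z).congr' ?_
  filter_upwards [hmem] with μ hμ
  have := recipF_add_eq_of_isVoiculescuTransform (ham μ hμ) hz
  exact sub_eq_of_eq_add' this.symm

/-! ## Weak convergence from convergence of the transforms -/

/-- Scheffé's lemma: the positive part of `q - p n` is dominated by `q`, and equality of the
integrals makes it account for half of the `L¹` distance. -/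
theorem tendsto_integral_abs_sub_of_tendsto {α : Type*} [MeasurableSpace α] {ν : Measure α}
    {p : ℕ → α → ℝ} {q : α → ℝ} (hp : ∀ n, Integrable (p n) ν) (hq : Integrable q ν)
    (hp0 : ∀ n x, 0 ≤ p n x) (hint : ∀ n, ∫ x, p n x ∂ν = ∫ x, q x ∂ν)
    (hlim : ∀ x, Tendsto (fun n => p n x) atTop (𝓝 (q x))) :
    Tendsto (fun n => ∫ x, |p n x - q x| ∂ν) atTop (𝓝 0) := by
  have hq0 : ∀ x, 0 ≤ q x := fun x => ge_of_tendsto' (hlim x) fun n => hp0 n x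
  have h1 : Tendsto (fun n => ∫ x, max (q x - p n x) 0 ∂ν) atTop (𝓝 (∫ _x, (0 : ℝ) ∂ν)) := by
    refine tendsto_integral_of_dominated_convergence q (fun n => ?_) hq (fun n => ?_) ?_
    · exact ((hq.sub (hp n)).pos_part).aestronglyMeasurable
    · refine ae_of_all _ fun x => ?_
      rw [Real.norm_of_nonneg (le_max_right _ _)]
      exact max_le (by linarith [hp0 n x]) (hq0 x)
    · refine ae_of_all _ fun x => ?_
      have := ((hlim x).const_sub (q x)).max (tendsto_const_nhds (x := (0 : ℝ)))
      simpa using this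
  rw [integral_zero] at h1
  have h2 := h1.const_mul 2
  rw [mul_zero] at h2
  refine h2.congr fun n => ?_
  have e : ∀ x, |p n x - q x| = (p n x - q x) + 2 * max (q x - p n x) 0 := fun x => by
    rcases le_total (p n x) (q x) with h | h
    · rw [abs_of_nonpos (by linarith), max_eq_left (by linarith)]; ring
    · rw [abs_of_nonneg (by linarith), max_eq_right (by linarith)]; ring
  simp only [e]
  have hsub : Integrable (fun x => p n x - q x) ν := (hp n).sub hq
  have hmax : Integrable (fun x => 2 * max (q x - p n x) 0) ν :=
    ((hq.sub (hp n)).pos_part).const_mul 2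
  rw [integral_add hsub hmax, integral_sub (hp n) hq, hint n, sub_self, zero_add,
    integral_const_mul]

/-! ### Poisson smoothing and recovery of weak convergence -/

/-- The Poisson kernel of the upper half-plane at height `y`. -/
noncomputable def poissonK (y s : ℝ) : ℝ := Real.pi⁻¹ * (y / (s ^ 2 + y ^ 2))

theorem poissonK_nonneg {y : ℝ} (hy : 0 < y) (s : ℝ) : 0 ≤ poissonK y s := by
  unfold poissonK; positivity

theorem continuous_poissonK {y : ℝ} (hy : 0 < y) : Continuous (poissonK y) := by
  unfold poissonK
  exact continuous_const.mul (Continuous.div (by fun_prop) (by fun_prop) fun s => by positivity)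

theorem poissonK_scale {y : ℝ} (hy : 0 < y) (s : ℝ) : y * poissonK y (y * s) = poissonK 1 s := by
  unfold poissonK
  have : s ^ 2 + 1 ≠ 0 := by positivity
  field_simp

theorem integrable_poissonK_one : Integrable (poissonK 1) := by
  have := integrable_inv_one_add_sq.const_mul Real.pi⁻¹
  refine this.congr (ae_of_all _ fun s => ?_)
  simp [poissonK, add_comm]

theorem integral_poissonK_one : ∫ s, poissonK 1 s = 1 := by
  have h : ∀ s, poissonK 1 s = Real.pi⁻¹ * (1 + s ^ 2)⁻¹ := fun s => by
    simp [poissonK, add_comm]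
  simp only [h]
  rw [integral_const_mul, integral_univ_inv_one_add_sq, inv_mul_cancel₀ Real.pi_ne_zero]

theorem integrable_poissonK {y : ℝ} (hy : 0 < y) : Integrable (poissonK y) := by
  have h := integrable_poissonK_one.comp_div hy.ne'
  have h2 := h.const_mul y⁻¹
  refine h2.congr (ae_of_all _ fun s => ?_)
  simp only
  rw [← poissonK_scale hy, mul_div_cancel₀ _ hy.ne', inv_mul_cancel_left₀ hy.ne']

/-- The Fourier transform of the Poisson kernel at height `1`. -/
noncomputable def poissonFT (v : ℝ) : ℂ :=
  ∫ s : ℝ, Complex.exp (v * s * Complex.I) * poissonK 1 s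

theorem norm_exp_mul_I (v : ℝ) : ‖Complex.exp (v * Complex.I)‖ = 1 :=
  Complex.norm_exp_ofReal_mul_I v

/-- Continuity and the value `1` at zero are all that is used of this transform: they make it
nonzero near zero, so that it can be divided out. -/
theorem continuous_poissonFT : Continuous poissonFT := by
  refine continuous_of_dominated (bound := fun s => poissonK 1 s) (fun v => ?_) (fun v => ?_)
    integrable_poissonK_one (ae_of_all _ fun s => by fun_prop)
  · have := continuous_poissonK one_pos
    exact Continuous.aestronglyMeasurable (by fun_prop)
  · refine ae_of_all _ fun s => ?_
    rw [norm_mul, ← Complex.ofReal_mul, norm_exp_mul_I, one_mul, Complex.norm_real,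
      Real.norm_of_nonneg (poissonK_nonneg one_pos s)]

theorem poissonFT_zero : poissonFT 0 = 1 := by
  simp only [poissonFT, Complex.ofReal_zero, zero_mul, Complex.exp_zero, one_mul]
  rw [integral_complex_ofReal, integral_poissonK_one, Complex.ofReal_one]

theorem integral_exp_mul_poissonK {y : ℝ} (hy : 0 < y) (u x : ℝ) :
    ∫ s : ℝ, Complex.exp (u * s * Complex.I) * poissonK y (s - x) =
      Complex.exp (u * x * Complex.I) * poissonFT (u * y) := by
  have h1 := integral_add_right_eq_self (μ := (volume : Measure ℝ))
    (fun s : ℝ => Complex.exp (u * s * Complex.I) * poissonK y (s - x)) x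
  rw [← h1]
  have h2 := Measure.integral_comp_mul_left
    (fun s : ℝ => Complex.exp (u * (s + x : ℝ) * Complex.I) * poissonK y ((s + x) - x)) y
  rw [abs_of_pos (inv_pos.2 hy), Complex.real_smul] at h2
  have hyC : (y : ℂ) ≠ 0 := by exact_mod_cast hy.ne'
  have h3 : ∫ s : ℝ, Complex.exp (u * (s + x : ℝ) * Complex.I) * poissonK y ((s + x) - x) =
      y * ∫ s : ℝ, Complex.exp (u * (y * s + x : ℝ) * Complex.I) * poissonK y ((y * s + x) - x) := by
    rw [h2]; push_cast; rw [mul_inv_cancel_left₀ hyC]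
  rw [h3, ← integral_const_mul, poissonFT, ← integral_const_mul]
  refine integral_congr_ae (ae_of_all _ fun s => ?_)
  simp only [add_sub_cancel_right]
  rw [← poissonK_scale hy s]
  have : (u * (y * s + x : ℝ) * Complex.I : ℂ) =
      u * x * Complex.I + (u * y : ℝ) * s * Complex.I := by push_cast; ring
  rw [this, Complex.exp_add]
  push_cast
  ring

/-- The density of the convolution of `μ` with a Cauchy law. -/
noncomputable def poissonAvg (μ : ProbabilityMeasure ℝ) (y s : ℝ) : ℝ :=
  ∫ x : ℝ, poissonK y (s - x) ∂(μ : Measure ℝ)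

theorem poissonAvg_eq (μ : ProbabilityMeasure ℝ) {y : ℝ} (hy : 0 < y) (s : ℝ) :
    poissonAvg μ y s = -Real.pi⁻¹ * (cauchyG μ (s + y * Complex.I)).im := by
  have hz : 0 < (s + y * Complex.I : ℂ).im := by simpa using hy
  have h : (cauchyG μ (s + y * Complex.I)).im =
      ∫ x : ℝ, (((s + y * Complex.I : ℂ) - (x : ℂ))⁻¹).im ∂(μ : Measure ℝ) :=
    (integral_im (integrable_cauchy_kernel (μ : Measure ℝ) hz)).symm
  rw [h, ← integral_const_mul, poissonAvg]
  refine integral_congr_ae (ae_of_all _ fun x => ?_)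
  simp only [Complex.inv_im, normSq_sub_ofReal, poissonK]
  simp
  ring

theorem integrable_poisson_prod (μ : ProbabilityMeasure ℝ) {y : ℝ} (hy : 0 < y) (u : ℝ) :
    Integrable (fun q : ℝ × ℝ => Complex.exp (u * q.2 * Complex.I) * poissonK y (q.2 - q.1))
      ((μ : Measure ℝ).prod volume) := by
  have hc : Continuous (fun q : ℝ × ℝ =>
      Complex.exp (u * q.2 * Complex.I) * poissonK y (q.2 - q.1)) := by
    have h : Continuous fun q : ℝ × ℝ => poissonK y (q.2 - q.1) :=
      (continuous_poissonK hy).comp (by fun_prop)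
    fun_prop
  have hn : ∀ x s : ℝ, ‖Complex.exp (u * s * Complex.I) * poissonK y (s - x)‖ =
      poissonK y (s - x) := fun x s => by
    rw [norm_mul, ← Complex.ofReal_mul, norm_exp_mul_I, one_mul, Complex.norm_real,
      Real.norm_of_nonneg (poissonK_nonneg hy _)]
  rw [integrable_prod_iff hc.aestronglyMeasurable]
  constructor
  · refine ae_of_all _ fun x => ?_
    refine ((integrable_poissonK hy).comp_sub_right x).mono'
      (hc.comp (by fun_prop : Continuous fun s : ℝ => (x, s))).aestronglyMeasurable (ae_of_all _ fun s => ?_)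
    exact (hn x s).le
  · simp only [hn]
    have : ∀ x : ℝ, ∫ s, poissonK y (s - x) = ∫ s, poissonK y s := fun x =>
      integral_sub_right_eq_self _ x
    simp only [this]
    exact integrable_const _

theorem integral_exp_mul_poissonAvg (μ : ProbabilityMeasure ℝ) {y : ℝ} (hy : 0 < y) (u : ℝ) :
    Integrable (fun s : ℝ => Complex.exp (u * s * Complex.I) * poissonAvg μ y s) ∧
    ∫ s : ℝ, Complex.exp (u * s * Complex.I) * poissonAvg μ y s =
      charFun (μ : Measure ℝ) u * poissonFT (u * y) := by
  have hi := integrable_poisson_prod μ hy u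
  have e : ∀ s : ℝ, Complex.exp (u * s * Complex.I) * poissonAvg μ y s =
      ∫ x : ℝ, Complex.exp (u * s * Complex.I) * poissonK y (s - x) ∂(μ : Measure ℝ) := fun s => by
    rw [integral_const_mul, poissonAvg, integral_complex_ofReal]
  simp only [e]
  refine ⟨hi.integral_prod_right, ?_⟩
  rw [← integral_integral_swap hi]
  simp only [integral_exp_mul_poissonK hy]
  rw [integral_mul_const, charFun_apply_real]

theorem integrable_poissonAvg (μ : ProbabilityMeasure ℝ) {y : ℝ} (hy : 0 < y) :
    Integrable (poissonAvg μ y) := by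
  have h := (integral_exp_mul_poissonAvg μ hy 0).1
  simp only [Complex.ofReal_zero, zero_mul, Complex.exp_zero, one_mul] at h
  exact h.re

theorem integral_poissonAvg (μ : ProbabilityMeasure ℝ) {y : ℝ} (hy : 0 < y) :
    ∫ s, poissonAvg μ y s = 1 := by
  have h := (integral_exp_mul_poissonAvg μ hy 0).2
  simp only [Complex.ofReal_zero, zero_mul, Complex.exp_zero, one_mul, poissonFT_zero, mul_one,
    charFun_zero, probReal_univ] at h
  rw [integral_complex_ofReal] at h
  exact_mod_cast h

/-- Up to the factor `-1/π`, `Im G` on a horizontal line is the density of the law convolved with a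
Cauchy law. Pointwise convergence of these densities becomes `L¹` convergence by Scheffé, hence
convergence of Fourier transforms; the Cauchy factor is removed at a height `y` where it does not
vanish. -/
theorem tendsto_of_tendsto_cauchyG {μ : ℕ → ProbabilityMeasure ℝ} {ρ : ProbabilityMeasure ℝ}
    (h : ∀ z : ℂ, 0 < z.im → Tendsto (fun n => cauchyG (μ n) z) atTop (𝓝 (cauchyG ρ z))) :
    Tendsto μ atTop (𝓝 ρ) := by
  refine ProbabilityMeasure.tendsto_of_tendsto_charFun fun u => ?_
  obtain ⟨y, hy, hne⟩ : ∃ y : ℝ, 0 < y ∧ poissonFT (u * y) ≠ 0 := by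
    have hc : Continuous fun y : ℝ => poissonFT (u * y) :=
      continuous_poissonFT.comp (by fun_prop)
    have h1 := hc.continuousAt (x := 0)
    have h2 : ∀ᶠ y in 𝓝 (0 : ℝ), poissonFT (u * y) ≠ 0 :=
      h1.eventually_ne (by simp [poissonFT_zero])
    have h3 : ∀ᶠ y in 𝓝[>] (0 : ℝ), poissonFT (u * y) ≠ 0 := nhdsWithin_le_nhds h2
    obtain ⟨y, h4, h5⟩ := (h3.and self_mem_nhdsWithin).exists
    exact ⟨y, h5, h4⟩
  have hS := tendsto_integral_abs_sub_of_tendsto (ν := volume) (p := fun n => poissonAvg (μ n) y)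
    (q := poissonAvg ρ y) (fun n => integrable_poissonAvg _ hy) (integrable_poissonAvg _ hy)
    (fun n s => integral_nonneg fun x => poissonK_nonneg hy _)
    (fun n => by rw [integral_poissonAvg _ hy, integral_poissonAvg _ hy])
    (fun s => by
      simp only [poissonAvg_eq _ hy]
      exact ((Complex.continuous_im.tendsto _).comp (h _ (by simpa using hy))).const_mul _)
  have hD : Tendsto (fun n => charFun (μ n : Measure ℝ) u * poissonFT (u * y) -
      charFun (ρ : Measure ℝ) u * poissonFT (u * y)) atTop (𝓝 0) := by
    refine squeeze_zero_norm (fun n => ?_) hS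
    rw [← (integral_exp_mul_poissonAvg (μ n) hy u).2, ← (integral_exp_mul_poissonAvg ρ hy u).2,
      ← integral_sub (integral_exp_mul_poissonAvg (μ n) hy u).1
        (integral_exp_mul_poissonAvg ρ hy u).1]
    refine (norm_integral_le_integral_norm _).trans (le_of_eq ?_)
    refine integral_congr_ae (ae_of_all _ fun s => ?_)
    simp only
    rw [← mul_sub, norm_mul, ← Complex.ofReal_mul, norm_exp_mul_I, one_mul, ← Complex.ofReal_sub,
      Complex.norm_real, Real.norm_eq_abs]
  have h5 := (tendsto_sub_nhds_zero_iff.1 hD).div_const (poissonFT (u * y))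
  simpa [mul_div_cancel_right₀ _ hne] using h5

/-- Let `w = F_ρ(z)` and `v = F_{μ n}(z)`. Both solve `· + V(·) = z` for their own `V`, and the
Lipschitz bound gives `|v - w| (1 - nevA w) / 2 ≤ |V₀(w) - V_n(w)|`, with `nevA` at `w` converging
to a limit below `1`. -/
theorem tendsto_of_tendsto_nevV {μ : ℕ → ProbabilityMeasure ℝ} {ρ : ProbabilityMeasure ℝ}
    {a : ℕ → ℝ} {m : ℕ → FiniteMeasure ℝ} {a₀ : ℝ} {m₀ : FiniteMeasure ℝ}
    (hμ : ∀ n, IsVoiculescuTransform (μ n) (nevV (a n) (m n)))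
    (hρ : IsVoiculescuTransform ρ (nevV a₀ m₀))
    (h : ∀ w : ℂ, 0 < w.im → Tendsto (fun n => nevV (a n) (m n) w) atTop (𝓝 (nevV a₀ m₀ w))) :
    Tendsto μ atTop (𝓝 ρ) := by
  refine tendsto_of_tendsto_cauchyG fun z hz => ?_
  set w := recipF ρ z with hw
  have hw0 : 0 < w.im := im_recipF_pos ρ hz
  have hwz : w + nevV a₀ m₀ w = z := recipF_add_eq_of_isVoiculescuTransform hρ hz
  have hA₀ : nevA m₀ w < 1 := nevA_lt_one_of_im_pos (a := a₀) hw0 (by rw [hwz]; exact hz)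
  have hA : Tendsto (fun n => nevA (m n) w) atTop (𝓝 (nevA m₀ w)) := by
    rw [nevA_eq a₀ m₀ hw0]
    simp only [fun n => nevA_eq (a n) (m n) hw0]
    exact (((Complex.continuous_im.tendsto _).comp (h w hw0)).neg).div_const _
  have hF : Tendsto (fun n => recipF (μ n) z) atTop (𝓝 w) := by
    rw [tendsto_iff_norm_sub_tendsto_zero]
    have h1 : Tendsto (fun n => ‖nevV a₀ m₀ w - nevV (a n) (m n) w‖ /
        ((1 - nevA (m n) w) / 2)) atTop (𝓝 (‖nevV a₀ m₀ w - nevV a₀ m₀ w‖ /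
          ((1 - nevA m₀ w) / 2))) :=
      ((h w hw0).const_sub _).norm.div ((hA.const_sub 1).div_const 2) (by linarith)
    rw [sub_self, norm_zero, zero_div] at h1
    refine squeeze_zero' (Eventually.of_forall fun n => norm_nonneg _) ?_ h1
    filter_upwards [hA.eventually (gt_mem_nhds hA₀)] with n hn
    set v := recipF (μ n) z with hv
    have hv0 : 0 < v.im := im_recipF_pos _ hz
    have hvz : v + nevV (a n) (m n) v = z := recipF_add_eq_of_isVoiculescuTransform (hμ n) hz
    have hAv : nevA (m n) v < 1 :=
      nevA_lt_one_of_im_pos (a := a n) hv0 (by rw [hvz]; exact hz)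
    rw [le_div_iff₀ (by linarith)]
    have h2 := norm_nevV_sub_le (a n) (m n) hw0 hv0
    have h3 : v - w = (nevV a₀ m₀ w - nevV (a n) (m n) w) +
        (nevV (a n) (m n) w - nevV (a n) (m n) v) := by linear_combination hvz - hwz
    have h4 : ‖v - w‖ ≤ ‖nevV a₀ m₀ w - nevV (a n) (m n) w‖ +
        ‖w - v‖ * ((nevA (m n) w + nevA (m n) v) / 2) := by
      calc ‖v - w‖ ≤ ‖nevV a₀ m₀ w - nevV (a n) (m n) w‖ +
            ‖nevV (a n) (m n) w - nevV (a n) (m n) v‖ := by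
            conv_lhs => rw [h3]
            exact norm_add_le _ _
        _ ≤ _ := by gcongr
    rw [norm_sub_rev w v] at h4
    nlinarith [norm_nonneg (v - w)]
  have hne : w ≠ 0 := fun h0 => by rw [h0] at hw0; simp at hw0
  have := hF.inv₀ hne
  simp only [hw, recipF, inv_inv] at this
  exact this

/-- By compactness every ultrafilter limit is holomorphic, and its values on the imaginary axis
determine it. -/
theorem tendsto_nevV_of_tendsto_imaginary_axis {a : ℕ → ℝ} {m : ℕ → FiniteMeasure ℝ} {a₀ : ℝ}
    {m₀ : FiniteMeasure ℝ}
    (h : ∀ t : ℝ, 0 < t → Tendsto (fun n => nevV (a n) (m n) (t * Complex.I)) atTop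
      (𝓝 (nevV a₀ m₀ (t * Complex.I)))) {w : ℂ} (hw : 0 < w.im) :
    Tendsto (fun n => nevV (a n) (m n) w) atTop (𝓝 (nevV a₀ m₀ w)) := by
  rw [tendsto_iff_ultrafilter]
  intro U hU
  have hI : 0 < Complex.I.im := by simp
  have h1 := (h 1 one_pos).mono_left hU
  rw [Complex.ofReal_one, one_mul] at h1
  obtain ⟨a', m', b, hb, h2⟩ := exists_nevV_limit U hI tendsto_const_nhds h1
  have h3 : nevV a₀ m₀ w = nevV a' m' w - b * w := by
    refine eq_of_eq_imaginary_axis (f := nevV a₀ m₀) (g := fun z => nevV a' m' z - b * z)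
      (differentiableOn_nevV a₀ m₀) ((differentiableOn_nevV a' m').sub
        (differentiableOn_id.const_mul _)) (fun t ht => ?_) hw
    exact tendsto_nhds_unique ((h t ht).mono_left hU)
      (h2 _ _ (by simpa using ht) tendsto_const_nhds)
  rw [h3]
  exact h2 _ _ hw tendsto_const_nhds

/-- Limits of Nevanlinna functions along the imaginary axis. -/
theorem exists_nevV_of_tendsto_imaginary_axis {a : ℕ → ℝ} {m : ℕ → FiniteMeasure ℝ} {L : ℝ → ℂ}
    (h : ∀ t : ℝ, 0 < t → Tendsto (fun n => nevV (a n) (m n) (t * Complex.I)) atTop (𝓝 (L t)))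
    (hL : Tendsto (fun t : ℝ => L t / (t * Complex.I)) atTop (𝓝 0)) :
    ∃ (a₀ : ℝ) (m₀ : FiniteMeasure ℝ), ∀ t : ℝ, 0 < t → L t = nevV a₀ m₀ (t * Complex.I) := by
  set U : Ultrafilter ℕ := hyperfilter ℕ
  have hU : (U : Filter ℕ) ≤ atTop := Nat.hyperfilter_le_atTop
  have hI : 0 < Complex.I.im := by simp
  have h1 := (h 1 one_pos).mono_left hU
  rw [Complex.ofReal_one, one_mul] at h1
  obtain ⟨a', m', b, hb, h2⟩ := exists_nevV_limit U hI tendsto_const_nhds h1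
  have h3 : ∀ t : ℝ, 0 < t → L t = nevV a' m' (t * Complex.I) - b * (t * Complex.I) :=
    fun t ht => tendsto_nhds_unique ((h t ht).mono_left hU)
      (h2 _ _ (by simpa using ht) tendsto_const_nhds)
  have hb0 : b = 0 := by
    have h4 := (tendsto_nevV_div_I a' m').sub_const (b : ℂ)
    have h5 := tendsto_nhds_unique (h4.congr' ?_) hL
    · simpa using h5
    · filter_upwards [eventually_gt_atTop 0] with t ht
      have hne : (t * Complex.I : ℂ) ≠ 0 := by simp [ht.ne']
      rw [h3 t ht, sub_div, mul_div_cancel_right₀ _ hne]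
  exact ⟨a', m', fun t ht => by rw [h3 t ht, hb0]; simp⟩

/-! ## Characteristic functions -/

theorem charFun_pmConv (μ ν : ProbabilityMeasure ℝ) (u : ℝ) :
    charFun (pmConv μ ν : Measure ℝ) u = charFun (μ : Measure ℝ) u * charFun (ν : Measure ℝ) u :=
  charFun_conv u

theorem charFun_pmScale (c : ℝ) (μ : ProbabilityMeasure ℝ) (u : ℝ) :
    charFun (pmScale c μ : Measure ℝ) u = charFun (μ : Measure ℝ) (c * u) :=
  charFun_map_mul c u

theorem charFun_pmConvUpTo (ν : ℕ → ProbabilityMeasure ℝ) (n : ℕ) (u : ℝ) :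
    charFun (pmConvUpTo ν n : Measure ℝ) u =
      ∏ j ∈ Finset.range n, charFun (ν (j + 1) : Measure ℝ) u := by
  induction n with
  | zero =>
    change charFun (Measure.dirac (0 : ℝ)) u = _
    simp
  | succ n ih => rw [Finset.prod_range_succ, ← ih]; exact charFun_pmConv _ _ u

theorem eq_of_charFun_eq {μ ν : ProbabilityMeasure ℝ}
    (h : ∀ u : ℝ, charFun (μ : Measure ℝ) u = charFun (ν : Measure ℝ) u) : μ = ν :=
  Subtype.ext (Measure.ext_of_charFun (μ := (μ : Measure ℝ)) (ν := (ν : Measure ℝ)) (funext h))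

/-- Lévy's continuity theorem: a pointwise limit of characteristic functions which is continuous
at `0` is a characteristic function. -/
theorem exists_charFun_eq_of_tendsto {μ : ℕ → ProbabilityMeasure ℝ} {f : ℝ → ℂ}
    (hf : ContinuousAt f 0)
    (h : ∀ u : ℝ, Tendsto (fun n => charFun (μ n : Measure ℝ) u) atTop (𝓝 (f u))) :
    ∃ ρ : ProbabilityMeasure ℝ, (∀ u : ℝ, charFun (ρ : Measure ℝ) u = f u) ∧
      Tendsto μ atTop (𝓝 ρ) := by
  have htight := isTightMeasureSet_of_tendsto_charFun (μ := fun n => (μ n : Measure ℝ)) hf h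
  have hc : IsCompact (closure (Set.range μ)) := by
    refine isCompact_closure_of_isTightMeasureSet ?_
    convert htight using 1
    ext; simp
  obtain ⟨ρ, -, hρ⟩ := hc.ultrafilter_le_nhds ((hyperfilter ℕ).map μ)
    (le_principal_iff.2 (Filter.mem_map.2 (univ_mem' fun n => subset_closure ⟨n, rfl⟩)))
  have hρ' : Tendsto μ (hyperfilter ℕ) (𝓝 ρ) := hρ
  have h1 : ∀ u : ℝ, charFun (ρ : Measure ℝ) u = f u := fun u => by
    rw [ProbabilityMeasure.tendsto_iff_forall_integral_rclike_tendsto ℂ] at hρ'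
    have h2 := hρ' (BoundedContinuousFunction.innerProbChar u)
    simp only [← charFun_eq_integral_innerProbChar] at h2
    exact tendsto_nhds_unique h2 ((h u).mono_left Nat.hyperfilter_le_atTop)
  refine ⟨ρ, h1, ?_⟩
  rw [ProbabilityMeasure.tendsto_iff_tendsto_charFun]
  intro u
  rw [h1]; exact h u

theorem eq_of_exp_eq {f g : ℝ → ℂ} (hf : Continuous f) (hg : Continuous g) (h0 : f 0 = g 0)
    (h : ∀ u, Complex.exp (f u) = Complex.exp (g u)) : f = g :=
  Complex.isCoveringMap_exp.eq_of_comp_eq hf hg (funext fun u => Subtype.ext (h u)) 0 h0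

theorem IsLogCharFun.eq {μ : ProbabilityMeasure ℝ} {ψ ψ' : ℝ → ℂ} (h : IsLogCharFun μ ψ)
    (h' : IsLogCharFun μ ψ') : ψ = ψ' :=
  eq_of_exp_eq h.1 h'.1 (h.2.1.trans h'.2.1.symm) fun u => by rw [← h.2.2, ← h'.2.2]

/-! ## Lévy-Khintchine exponents -/

theorem norm_cexp_I_mul (u x : ℝ) : ‖Complex.exp (Complex.I * u * x)‖ = 1 := by
  have : Complex.I * u * x = ((u * x : ℝ) : ℂ) * Complex.I := by push_cast; ring
  rw [this, Complex.norm_exp_ofReal_mul_I]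

theorem norm_exp_sub_one_sub_le (u x : ℝ) :
    ‖Complex.exp (Complex.I * u * x) - 1 - Complex.I * u * x‖ ≤ 3 * (u * x) ^ 2 := by
  have hn : ‖Complex.I * u * x‖ = |u * x| := by
    simp [abs_mul]
  rcases le_total |u * x| 1 with h | h
  · have := Complex.norm_exp_sub_one_sub_id_le (x := Complex.I * u * x) (by rw [hn]; exact h)
    rw [hn, sq_abs] at this
    nlinarith [sq_nonneg (u * x)]
  · calc _ ≤ ‖Complex.exp (Complex.I * u * x)‖ + ‖(1 : ℂ)‖ + ‖Complex.I * u * x‖ :=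
        (norm_sub_le _ _).trans (add_le_add_left (norm_sub_le _ _) _)
      _ = 2 + |u * x| := by rw [norm_cexp_I_mul, hn, norm_one]; norm_num
      _ ≤ 3 * (u * x) ^ 2 := by rw [← sq_abs]; nlinarith

/-- Compensating by the full linear term `iux` exhibits the second-order cancellation at `x = 0` and
costs only the summand `iux`. -/
theorem lkKernel_eq {x : ℝ} (hx : x ≠ 0) (u : ℝ) :
    lkKernel u x = (Complex.exp (Complex.I * u * x) - 1 - Complex.I * u * x) *
      (((1 + x ^ 2) / x ^ 2 : ℝ) : ℂ) + Complex.I * u * x := by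
  have h1 : (x : ℂ) ≠ 0 := by exact_mod_cast hx
  have h2 : (1 + (x : ℂ) ^ 2) ≠ 0 := by
    have : (1 + x ^ 2 : ℝ) ≠ 0 := by positivity
    exact_mod_cast this
  rw [lkKernel, if_neg hx]
  push_cast
  field_simp
  ring

/-- Taylor expansion serves `|x| ≤ 1`, crude bounds serve `|x| ≥ 1`. Uniformity in `x` together with
quadratic growth in `u` dominates every integral over `m` and every Laplace integral below. -/
theorem norm_lkKernel_le (u x : ℝ) : ‖lkKernel u x‖ ≤ 8 * (1 + u ^ 2) := by
  rcases eq_or_ne x 0 with rfl | hx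
  · simp only [lkKernel, if_true, norm_div, norm_neg, norm_pow, Complex.norm_real, Real.norm_eq_abs,
      sq_abs, Complex.norm_ofNat]
    nlinarith [sq_nonneg u]
  have hx2 : 0 < x ^ 2 := by positivity
  have hu : |u| ≤ (1 + u ^ 2) / 2 := by
    rw [← sq_abs u]; nlinarith [sq_nonneg (|u| - 1)]
  rcases le_total |x| 1 with h | h
  · have hx1 : x ^ 2 ≤ 1 := by rw [← sq_abs]; nlinarith [abs_nonneg x]
    rw [lkKernel_eq hx]
    have hr : 0 ≤ (1 + x ^ 2) / x ^ 2 := by positivity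
    calc _ ≤ 3 * (u * x) ^ 2 * ((1 + x ^ 2) / x ^ 2) + |u| * |x| := by
          refine (norm_add_le _ _).trans (add_le_add ?_ ?_)
          · rw [norm_mul, Complex.norm_real, Real.norm_of_nonneg hr]
            exact mul_le_mul_of_nonneg_right (norm_exp_sub_one_sub_le u x) hr
          · simp
      _ = 3 * u ^ 2 * (1 + x ^ 2) + |u| * |x| := by field_simp
      _ ≤ 3 * u ^ 2 * 2 + |u| * 1 := by gcongr; linarith
      _ ≤ _ := by nlinarith [sq_nonneg u]
  · have hx1 : 1 ≤ x ^ 2 := by rw [← sq_abs]; nlinarith [abs_nonneg x]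
    rw [lkKernel, if_neg hx]
    have hr : ‖(1 + (x : ℂ) ^ 2) / (x : ℂ) ^ 2‖ ≤ 2 := by
      have : (1 + (x : ℂ) ^ 2) / (x : ℂ) ^ 2 = (((1 + x ^ 2) / x ^ 2 : ℝ) : ℂ) := by push_cast; ring
      rw [this, Complex.norm_real, Real.norm_of_nonneg (by positivity), div_le_iff₀ hx2]
      linarith
    have h3 : ‖Complex.I * u * x / (1 + (x : ℂ) ^ 2)‖ ≤ |u| := by
      have : Complex.I * u * x / (1 + (x : ℂ) ^ 2) =
          Complex.I * ((u * (x / (1 + x ^ 2)) : ℝ) : ℂ) := by push_cast; ring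
      rw [this, norm_mul, Complex.norm_I, one_mul, Complex.norm_real, Real.norm_eq_abs, abs_mul]
      refine mul_le_of_le_one_right (abs_nonneg u) ?_
      rw [abs_div, abs_of_pos (by positivity : (0 : ℝ) < 1 + x ^ 2), div_le_one (by positivity),
        ← sq_abs]
      nlinarith [sq_nonneg (|x| - 1)]
    calc _ ≤ (1 + 1 + |u|) * 2 := by
          rw [norm_mul]
          refine mul_le_mul ?_ hr (norm_nonneg _) (by positivity)
          refine (norm_sub_le _ _).trans (add_le_add ((norm_sub_le _ _).trans ?_) h3)
          rw [norm_cexp_I_mul, norm_one]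
      _ ≤ _ := by nlinarith [sq_nonneg u]

theorem measurable_lkKernel : Measurable (fun p : ℝ × ℝ => lkKernel p.1 p.2) := by
  unfold lkKernel
  refine Measurable.ite (measurableSet_eq_fun measurable_snd measurable_const) ?_ ?_
  · fun_prop
  · fun_prop

theorem continuous_lkKernel_left (x : ℝ) : Continuous fun u => lkKernel u x := by
  unfold lkKernel
  split_ifs <;> fun_prop

theorem integrable_lkKernel (m : FiniteMeasure ℝ) (u : ℝ) :
    Integrable (lkKernel u) (m : Measure ℝ) :=
  (integrable_const (8 * (1 + u ^ 2))).mono'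
    (measurable_lkKernel.comp (measurable_const.prodMk measurable_id)).aestronglyMeasurable
    (ae_of_all _ fun x => norm_lkKernel_le u x)

/-- Third-order Taylor expansion. This is how jumps shrinking to zero reproduce a Gaussian
component. -/
theorem tendsto_lkKernel_zero (u : ℝ) :
    Tendsto (lkKernel u) (𝓝[≠] 0) (𝓝 (lkKernel u 0)) := by
  have h1 : Tendsto (fun x : ℝ => Complex.I * u * x) (𝓝[≠] 0) (𝓝 0) := by
    have : Continuous fun x : ℝ => Complex.I * u * x := by fun_prop
    exact tendsto_nhdsWithin_of_tendsto_nhds (by simpa using this.tendsto 0)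
  have hb : ∀ᶠ x : ℝ in 𝓝[≠] 0, ‖(Complex.exp (Complex.I * u * x) - 1 - Complex.I * u * x) *
      (((1 + x ^ 2) / x ^ 2 : ℝ) : ℂ) - (Complex.I * u) ^ 2 / 2 * (1 + x ^ 2 : ℝ)‖ ≤
      |u| ^ 3 * |x| * (1 + x ^ 2) := by
    have h2 : ∀ᶠ x : ℝ in 𝓝[≠] 0, ‖Complex.I * u * x‖ < 1 :=
      h1.norm.eventually (gt_mem_nhds (by simp))
    filter_upwards [h2, self_mem_nhdsWithin] with x hx hx0
    have hx0' : (x : ℂ) ≠ 0 := by exact_mod_cast hx0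
    have hxr : x ≠ 0 := hx0
    have h3 := Complex.exp_bound (x := Complex.I * u * x) hx.le (n := 3) (by norm_num)
    have e : (Complex.exp (Complex.I * u * x) - 1 - Complex.I * u * x) *
        (((1 + x ^ 2) / x ^ 2 : ℝ) : ℂ) - (Complex.I * u) ^ 2 / 2 * (1 + x ^ 2 : ℝ) =
        (Complex.exp (Complex.I * u * x) -
          ∑ i ∈ Finset.range 3, (Complex.I * u * x) ^ i / (i.factorial : ℂ)) *
          (((1 + x ^ 2) / x ^ 2 : ℝ) : ℂ) := by
      simp [Finset.sum_range_succ]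
      field_simp
      ring
    have hr : 0 ≤ (1 + x ^ 2) / x ^ 2 := by positivity
    rw [e, norm_mul, Complex.norm_real, Real.norm_of_nonneg hr]
    refine (mul_le_mul_of_nonneg_right h3 hr).trans ?_
    have hn : ‖Complex.I * u * x‖ = |u| * |x| := by simp
    rw [hn, ← sq_abs x]
    have hxa : 0 < |x| := abs_pos.2 hx0
    have : (|u| * |x|) ^ 3 * ((Nat.succ 3 : ℝ) * ((Nat.factorial 3 : ℝ) * (3 : ℕ))⁻¹) *
        ((1 + |x| ^ 2) / |x| ^ 2) = |u| ^ 3 * |x| * (1 + |x| ^ 2) * (4 / 18) := by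
      norm_num [Nat.factorial]
      field_simp
      rw [sq_abs]
    rw [this]
    refine mul_le_of_le_one_right (by positivity) (by norm_num)
  have h4 : Tendsto (fun x : ℝ => |u| ^ 3 * |x| * (1 + x ^ 2)) (𝓝[≠] 0) (𝓝 0) := by
    have : Continuous fun x : ℝ => |u| ^ 3 * |x| * (1 + x ^ 2) := by fun_prop
    exact tendsto_nhdsWithin_of_tendsto_nhds (by simpa using this.tendsto 0)
  have h5 := squeeze_zero_norm' hb h4
  have h6 : Tendsto (fun x : ℝ => (Complex.I * u) ^ 2 / 2 * (1 + x ^ 2 : ℝ)) (𝓝[≠] 0)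
      (𝓝 (lkKernel u 0)) := by
    have : Continuous fun x : ℝ => (Complex.I * u) ^ 2 / 2 * ((1 + x ^ 2 : ℝ) : ℂ) := by fun_prop
    refine tendsto_nhdsWithin_of_tendsto_nhds ?_
    have h := this.tendsto 0
    convert h using 2
    simp [lkKernel, mul_pow]
  have h7 := (h5.add h6).add h1
  simp only [zero_add, add_zero, sub_add_cancel] at h7
  refine h7.congr' ?_
  filter_upwards [self_mem_nhdsWithin] with x hx
  rw [lkKernel_eq hx]

/-- The logarithm of the characteristic function of the infinitely divisible law with
Lévy-Khintchine parameters `a` and `m`. -/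
noncomputable def levyExp (a : ℝ) (m : FiniteMeasure ℝ) (u : ℝ) : ℂ :=
  Complex.I * u * a + ∫ x, lkKernel u x ∂(m : Measure ℝ)

theorem continuous_levyExp (a : ℝ) (m : FiniteMeasure ℝ) : Continuous (levyExp a m) := by
  refine Continuous.add (by fun_prop) ?_
  rw [continuous_iff_continuousAt]
  intro u₀
  refine continuousAt_of_dominated (bound := fun _ => 8 * (1 + (|u₀| + 1) ^ 2))
    (Eventually.of_forall fun u => (integrable_lkKernel m u).aestronglyMeasurable) ?_
    (integrable_const _) (ae_of_all _ fun x => (continuous_lkKernel_left x).continuousAt)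
  filter_upwards [Metric.ball_mem_nhds u₀ one_pos] with u hu
  refine ae_of_all _ fun x => (norm_lkKernel_le u x).trans ?_
  have h1 : |u| ≤ |u₀| + 1 := by
    have := abs_sub_abs_le_abs_sub u u₀
    rw [Metric.mem_ball, Real.dist_eq] at hu
    linarith
  have : u ^ 2 ≤ (|u₀| + 1) ^ 2 := by rw [← sq_abs]; gcongr
  linarith

theorem levyExp_zero (a : ℝ) (m : FiniteMeasure ℝ) : levyExp a m 0 = 0 := by
  have : ∀ x, lkKernel 0 x = 0 := fun x => by
    unfold lkKernel; split_ifs <;> simp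
  simp [levyExp, this]

theorem norm_levyExp_le (a : ℝ) (m : FiniteMeasure ℝ) :
    ∃ C, 0 ≤ C ∧ ∀ u, ‖levyExp a m u‖ ≤ C * (1 + u ^ 2) := by
  refine ⟨|a| + 8 * (m : Measure ℝ).real Set.univ, by positivity, fun u => ?_⟩
  have h1 : ‖Complex.I * u * a‖ ≤ |a| * (1 + u ^ 2) := by
    have : ‖Complex.I * u * a‖ = |a| * |u| := by simp [mul_comm]
    rw [this]
    gcongr
    rw [← sq_abs u]; nlinarith [sq_nonneg (|u| - 1), abs_nonneg u]
  have h2 : ‖∫ x, lkKernel u x ∂(m : Measure ℝ)‖ ≤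
      8 * (1 + u ^ 2) * (m : Measure ℝ).real Set.univ :=
    norm_integral_le_of_norm_le_const (ae_of_all _ fun x => norm_lkKernel_le u x)
  calc _ ≤ _ := norm_add_le _ _
    _ ≤ _ := add_le_add h1 h2
    _ = _ := by ring

theorem levyExp_smul (c : NNReal) (a : ℝ) (m : FiniteMeasure ℝ) (u : ℝ) :
    levyExp (c * a) (c • m) u = c * levyExp a m u := by
  have : ∫ x, lkKernel u x ∂((c • m : FiniteMeasure ℝ) : Measure ℝ) =
      c * ∫ x, lkKernel u x ∂(m : Measure ℝ) := by
    rw [FiniteMeasure.toMeasure_smul, integral_smul_nnreal_measure]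
    simp [NNReal.smul_def]
  rw [levyExp, this, levyExp]
  push_cast
  ring

theorem hasLevyKhintchine_iff {μ : ProbabilityMeasure ℝ} {a : ℝ} {m : FiniteMeasure ℝ} :
    HasLevyKhintchine μ a m ↔ ∀ u : ℝ, charFun (μ : Measure ℝ) u = Complex.exp (levyExp a m u) :=
  Iff.rfl

/-! ## Existence of infinitely divisible laws -/

/-- The law is the limit of `N`-fold convolutions of `(1 - l/N) δ₀ + Λ/N`, by `(1 + z/N)^N → e^z`.
Taking `N > N₀ ≥ l` keeps the weights nonnegative and `N` nonzero. -/
theorem exists_charFun_eq_compoundPoisson (Λ : Measure ℝ) [IsFiniteMeasure Λ] :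
    ∃ ρ : ProbabilityMeasure ℝ, ∀ u : ℝ, charFun (ρ : Measure ℝ) u =
      Complex.exp (charFun Λ u - (Λ.real Set.univ : ℝ)) := by
  set l : ℝ := Λ.real Set.univ with hl
  have hl0 : 0 ≤ l := measureReal_nonneg
  obtain ⟨N₀, hN₀⟩ := exists_nat_ge l
  have hstep : ∀ n : ℕ, ∃ σ : ProbabilityMeasure ℝ, ∀ u : ℝ, charFun (σ : Measure ℝ) u =
      1 + (charFun Λ u - l) / ((n + (N₀ + 1) : ℕ) : ℂ) := fun n => by
    have hN : (0 : ℝ) < ((n + (N₀ + 1) : ℕ) : ℝ) := by positivity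
    have hNl : l ≤ ((n + (N₀ + 1) : ℕ) : ℝ) := by push_cast; linarith [Nat.cast_nonneg (α := ℝ) n]
    set N : ℝ := ((n + (N₀ + 1) : ℕ) : ℝ) with hNdef
    have h1 : 0 ≤ 1 - l / N := sub_nonneg.2 ((div_le_one hN).2 hNl)
    have h2 : 0 ≤ N⁻¹ := by positivity
    let σ : Measure ℝ := ENNReal.ofReal (1 - l / N) • Measure.dirac 0 + ENNReal.ofReal N⁻¹ • Λ
    have hσ : IsProbabilityMeasure σ := ⟨by
      have : Λ Set.univ = ENNReal.ofReal l := by rw [hl, ofReal_measureReal]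
      simp only [σ, Measure.add_apply, Measure.smul_apply, smul_eq_mul, measure_univ, mul_one, this]
      rw [← ENNReal.ofReal_mul h2, ← ENNReal.ofReal_add h1 (by positivity), inv_mul_eq_div]
      simp⟩
    refine ⟨⟨σ, hσ⟩, fun u => ?_⟩
    have hb : ∀ (κ : Measure ℝ) [IsFiniteMeasure κ],
        Integrable (fun x : ℝ => Complex.exp (u * x * Complex.I)) κ := fun κ _ => by
      refine (integrable_const (1 : ℝ)).mono' (by fun_prop) (ae_of_all _ fun x => ?_)
      rw [← Complex.ofReal_mul, Complex.norm_exp_ofReal_mul_I]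
    change charFun σ u = _
    rw [charFun_apply_real, charFun_apply_real]
    simp only [σ]
    rw [integral_add_measure ((hb _).smul_measure ENNReal.ofReal_ne_top)
      ((hb _).smul_measure ENNReal.ofReal_ne_top), integral_smul_measure, integral_smul_measure,
      ENNReal.toReal_ofReal h1, ENNReal.toReal_ofReal h2, integral_dirac, Complex.real_smul,
      Complex.real_smul]
    have hNC : ((n + (N₀ + 1) : ℕ) : ℂ) = (N : ℂ) := by rw [hNdef]; norm_cast
    rw [hNC]
    push_cast
    simp
    ring
  choose σ hσ using hstep
  have hc : Continuous fun u : ℝ => Complex.exp (charFun Λ u - l) := by fun_prop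
  obtain ⟨ρ, hρ, -⟩ := exists_charFun_eq_of_tendsto
    (μ := fun n => pmConvUpTo (fun _ => σ n) (n + (N₀ + 1))) hc.continuousAt fun u => by
    simp only [charFun_pmConvUpTo, hσ, Finset.prod_const, Finset.card_range]
    exact (Complex.tendsto_one_add_div_pow_exp (charFun Λ u - l)).comp
      (tendsto_add_atTop_nat (N₀ + 1))
  exact ⟨ρ, hρ⟩

/-- Jumps `f x` bounded away from zero give the finite Lévy measure `(1 + f²) / f² · m`, carried by
`f`. The law is then compound Poisson plus a drift, and the compensator shifts `a` by `∫ 1 / f`. -/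
theorem exists_charFun_eq_of_le_abs (a : ℝ) (m : FiniteMeasure ℝ) {f : ℝ → ℝ} (hf : Measurable f)
    {h : ℝ} (hh : 0 < h) (hfh : ∀ x, h ≤ |f x|) :
    ∃ ρ : ProbabilityMeasure ℝ, ∀ u : ℝ, charFun (ρ : Measure ℝ) u =
      Complex.exp (Complex.I * u * a + ∫ x, lkKernel u (f x) ∂(m : Measure ℝ)) := by
  have hf0 : ∀ x, f x ≠ 0 := fun x h0 => by
    have := hfh x
    rw [h0, abs_zero] at this
    exact absurd this (not_le.2 hh)
  set w : ℝ → ℝ := fun x => (1 + f x ^ 2) / f x ^ 2 with hw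
  have hw0 : ∀ x, 0 ≤ w x := fun x => by simp only [hw]; positivity
  have hwm : Measurable w := by fun_prop
  have hsq : ∀ x, h ^ 2 ≤ f x ^ 2 := fun x => by
    rw [← sq_abs (f x)]; have := hfh x; gcongr
  have hwb : ∀ x, w x ≤ 1 + (h ^ 2)⁻¹ := fun x => by
    have h1 : 0 < f x ^ 2 := by have := hf0 x; positivity
    have h2 : w x = 1 + (f x ^ 2)⁻¹ := by
      simp only [hw]
      rw [add_div, div_self h1.ne', one_div, add_comm]
    rw [h2]
    have := hsq x
    gcongr
  have hwi : Integrable w (m : Measure ℝ) := by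
    refine (integrable_const (1 + (h ^ 2)⁻¹)).mono' hwm.aestronglyMeasurable
      (ae_of_all _ fun x => ?_)
    rw [Real.norm_of_nonneg (hw0 x)]; exact hwb x
  have hii : Integrable (fun x => (f x)⁻¹) (m : Measure ℝ) := by
    refine (integrable_const h⁻¹).mono' hf.inv.aestronglyMeasurable (ae_of_all _ fun x => ?_)
    rw [norm_inv, Real.norm_eq_abs]
    exact inv_anti₀ hh (hfh x)
  have : IsFiniteMeasure ((m : Measure ℝ).withDensity fun x => ENNReal.ofReal (w x)) :=
    isFiniteMeasure_withDensity_ofReal hwi.2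
  set D : Measure ℝ := (m : Measure ℝ).withDensity fun x => ENNReal.ofReal (w x) with hD
  have hint : ∀ g : ℝ → ℂ, ∫ x, g x ∂D = ∫ x, (w x : ℂ) * g x ∂(m : Measure ℝ) := fun g => by
    rw [hD, integral_withDensity_eq_integral_toReal_smul hwm.ennreal_ofReal
      (ae_of_all _ fun x => ENNReal.ofReal_lt_top)]
    refine integral_congr_ae (ae_of_all _ fun x => ?_)
    simp only [ENNReal.toReal_ofReal (hw0 x), Complex.real_smul]
  obtain ⟨ρ, hρ⟩ := exists_charFun_eq_compoundPoisson (D.map f)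
  set b : ℝ := a - ∫ x, (f x)⁻¹ ∂(m : Measure ℝ) with hb
  obtain ⟨δ, hδ⟩ : ∃ δ : ProbabilityMeasure ℝ, (δ : Measure ℝ) = Measure.dirac b :=
    ⟨⟨Measure.dirac b, inferInstance⟩, rfl⟩
  refine ⟨pmConv δ ρ, fun u => ?_⟩
  rw [charFun_pmConv, hρ, hδ, charFun_dirac, ← Complex.exp_add]
  congr 1
  have hbd : ∀ x : ℝ, ‖Complex.exp (u * f x * Complex.I)‖ = 1 := fun x => by
    rw [← Complex.ofReal_mul, Complex.norm_exp_ofReal_mul_I]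
  have h1 : charFun (D.map f) u = ∫ x, (w x : ℂ) * Complex.exp (u * f x * Complex.I)
      ∂(m : Measure ℝ) := by
    rw [charFun_apply_real, integral_map hf.aemeasurable (by fun_prop), hint]
  have h2 : (((D.map f).real Set.univ : ℝ) : ℂ) = ∫ x, (w x : ℂ) ∂(m : Measure ℝ) := by
    have h3 := hint fun _ => 1
    simp only [mul_one] at h3
    rw [← h3, integral_const, map_measureReal_apply hf MeasurableSet.univ]
    simp
  have hi1 : Integrable (fun x => (w x : ℂ) * Complex.exp (u * f x * Complex.I))
      (m : Measure ℝ) := by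
    refine hwi.mono' (by fun_prop) (ae_of_all _ fun x => ?_)
    rw [norm_mul, hbd, mul_one, Complex.norm_real, Real.norm_of_nonneg (hw0 x)]
  have hwiC : Integrable (fun x => (w x : ℂ)) (m : Measure ℝ) := hwi.ofReal
  have hiiC : Integrable (fun x => (((f x)⁻¹ : ℝ) : ℂ)) (m : Measure ℝ) := hii.ofReal
  rw [h1, h2, ← integral_sub hi1 hwiC]
  have h4 : ∀ x, (w x : ℂ) * Complex.exp (u * f x * Complex.I) - w x =
      lkKernel u (f x) + Complex.I * u * ((f x)⁻¹ : ℝ) := fun x => by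
    have hx : (f x : ℂ) ≠ 0 := by exact_mod_cast hf0 x
    have hx2 : (1 + (f x : ℂ) ^ 2) ≠ 0 := by
      have : (1 + f x ^ 2 : ℝ) ≠ 0 := by positivity
      exact_mod_cast this
    have e : (u * f x * Complex.I : ℂ) = Complex.I * u * f x := by ring
    rw [lkKernel, if_neg (hf0 x), e]
    simp only [hw]
    push_cast
    field_simp
    ring
  have hi2 : Integrable (fun x => lkKernel u (f x)) (m : Measure ℝ) :=
    (integrable_const (8 * (1 + u ^ 2))).mono'
      (measurable_lkKernel.comp (measurable_const.prodMk hf)).aestronglyMeasurable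
      (ae_of_all _ fun x => norm_lkKernel_le u (f x))
  simp only [h4]
  rw [integral_add hi2 (hiiC.const_mul _), integral_const_mul, integral_complex_ofReal, hb]
  simp
  ring

/-- Jumps smaller than `1 / (n + 1)` in modulus are replaced by jumps of exactly that size. As `n →
∞` the exponents converge by domination, an atom of `m` at zero yielding the Gaussian part, and
Lévy's theorem applies. -/
theorem exists_hasLevyKhintchine (a : ℝ) (m : FiniteMeasure ℝ) :
    ∃ ρ : ProbabilityMeasure ℝ, HasLevyKhintchine ρ a m := by
  set f : ℕ → ℝ → ℝ := fun n x => if ((n + 1 : ℕ) : ℝ)⁻¹ ≤ |x| then x else ((n + 1 : ℕ) : ℝ)⁻¹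
    with hf
  have hpos : ∀ n : ℕ, 0 < ((n + 1 : ℕ) : ℝ)⁻¹ := fun n => by positivity
  have hlim0 : Tendsto (fun n : ℕ => ((n + 1 : ℕ) : ℝ)⁻¹) atTop (𝓝 0) :=
    tendsto_inv_atTop_zero.comp (tendsto_natCast_atTop_atTop.comp (tendsto_add_atTop_nat 1))
  have hfm : ∀ n, Measurable (f n) := fun n =>
    Measurable.ite (measurableSet_le measurable_const (by fun_prop)) measurable_id measurable_const
  have hfh : ∀ n x, ((n + 1 : ℕ) : ℝ)⁻¹ ≤ |f n x| := fun n x => by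
    simp only [hf]
    split_ifs with h
    · exact h
    · exact le_abs_self _
  choose ρ hρ using fun n => exists_charFun_eq_of_le_abs a m (hfm n) (hpos n) (hfh n)
  have hc : Continuous fun u => Complex.exp (levyExp a m u) := (continuous_levyExp a m).cexp
  obtain ⟨ρ', hρ', -⟩ := exists_charFun_eq_of_tendsto (μ := ρ) hc.continuousAt fun u => by
    simp only [hρ]
    refine (Complex.continuous_exp.tendsto _).comp (tendsto_const_nhds.add ?_)
    refine tendsto_integral_of_dominated_convergence (fun _ => 8 * (1 + u ^ 2))
      (fun n => (measurable_lkKernel.comp (measurable_const.prodMk (hfm n))).aestronglyMeasurable)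
      (integrable_const _) (fun n => ae_of_all _ fun x => norm_lkKernel_le u _)
      (ae_of_all _ fun x => ?_)
    rcases eq_or_ne x 0 with rfl | hx
    · have e : ∀ n, f n 0 = ((n + 1 : ℕ) : ℝ)⁻¹ := fun n => by
        simp only [hf, abs_zero, not_le.2 (hpos n), if_false]
      simp only [e]
      exact (tendsto_lkKernel_zero u).comp (tendsto_nhdsWithin_iff.2
        ⟨hlim0, Eventually.of_forall fun n => (hpos n).ne'⟩)
    · refine tendsto_const_nhds.congr' ?_
      filter_upwards [hlim0.eventually (gt_mem_nhds (abs_pos.2 hx))] with n hn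
      simp only [hf, hn.le, if_true]
  exact ⟨ρ', hρ'⟩

theorem exists_charFun_eq_exp_levyExp (a : ℝ) (m : FiniteMeasure ℝ) {s : ℝ} (hs : 0 ≤ s) (c : ℝ) :
    ∃ ρ : ProbabilityMeasure ℝ, ∀ u : ℝ, charFun (ρ : Measure ℝ) u =
      Complex.exp (s * levyExp a m (c * u)) := by
  lift s to NNReal using hs
  obtain ⟨ρ, hρ⟩ := exists_hasLevyKhintchine (s * a) (s • m)
  refine ⟨pmScale c ρ, fun u => ?_⟩
  rw [charFun_pmScale, hasLevyKhintchine_iff.1 hρ, levyExp_smul]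

theorem isInfDiv_of_charFun_eq {a : ℝ} {m : FiniteMeasure ℝ} {s : ℝ} (hs : 0 ≤ s) {c : ℝ}
    {ρ : ProbabilityMeasure ℝ} (h : ∀ u : ℝ, charFun (ρ : Measure ℝ) u =
      Complex.exp (s * levyExp a m (c * u))) : IsInfDiv ρ := fun n hn => by
  obtain ⟨ν, hν⟩ := exists_charFun_eq_exp_levyExp a m (div_nonneg hs n.cast_nonneg) c
  refine ⟨ν, eq_of_charFun_eq fun u => ?_⟩
  have : (n : ℂ) ≠ 0 := by exact_mod_cast (by omega : n ≠ 0)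
  rw [charFun_pmConvUpTo, h]
  simp only [hν, Finset.prod_const, Finset.card_range]
  rw [← Complex.exp_nat_mul]
  congr 1
  push_cast
  field_simp

/-! ## The Laplace transform of a Lévy-Khintchine exponent -/

theorem integrableOn_one_add_sq_mul_exp {t : ℝ} (ht : 0 < t) :
    IntegrableOn (fun u : ℝ => (1 + u ^ 2) * Real.exp (-(t * u))) (Set.Ioi 0) := by
  have h0 := integrableOn_exp_mul_Ioi (a := -t) (by linarith) 0
  have h2 := integrableOn_rpow_mul_exp_neg_mul_rpow (p := 1) (s := 2) (b := t) (by norm_num)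
    one_pos ht
  refine (h0.add h2).congr_fun (fun u _ => ?_) measurableSet_Ioi
  simp only [Pi.add_apply, Real.rpow_one, Real.rpow_two]
  rw [neg_mul]; ring

theorem norm_cexp_neg_mul (t u : ℝ) : ‖Complex.exp (-((t : ℂ) * (u : ℂ)))‖ = Real.exp (-(t * u)) := by
  rw [Complex.norm_exp]; simp

/-- The transform `ψ ↦ it² ∫_0^∞ ψ(-u) e^{-tu} du` of an exponent. -/
noncomputable def freeTransform (ψ : ℝ → ℂ) (t : ℝ) : ℂ :=
  Complex.I * (t : ℂ) ^ 2 * ∫ u in Set.Ioi (0 : ℝ), ψ (-u) * Complex.exp (-((t : ℂ) * (u : ℂ)))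

theorem integral_exp_neg_mul_complex {c : ℂ} (hc : 0 < c.re) :
    ∫ u in Set.Ioi (0 : ℝ), Complex.exp (-(c * u)) = c⁻¹ := by
  have := integral_exp_mul_complex_Ioi (a := -c) (by simpa using hc) 0
  simp only [neg_mul] at this
  rw [this]
  simp

theorem integral_mul_exp_neg {t : ℝ} (ht : 0 < t) :
    ∫ u in Set.Ioi (0 : ℝ), (u : ℂ) * Complex.exp (-((t : ℂ) * (u : ℂ))) = 1 / (t : ℂ) ^ 2 := by
  have := Complex.integral_cpow_mul_exp_neg_mul_Ioi (a := ((1 : ℕ) + 1 : ℂ)) (by simp) ht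
  simp only [add_sub_cancel_right, Complex.cpow_natCast, pow_one] at this
  rw [this, Complex.Gamma_nat_eq_factorial, ← Nat.cast_add_one, Complex.cpow_natCast]
  simp

theorem integral_sq_mul_exp_neg {t : ℝ} (ht : 0 < t) :
    ∫ u in Set.Ioi (0 : ℝ), (u : ℂ) ^ 2 * Complex.exp (-((t : ℂ) * (u : ℂ))) = 2 / (t : ℂ) ^ 3 := by
  have := Complex.integral_cpow_mul_exp_neg_mul_Ioi (a := ((2 : ℕ) + 1 : ℂ)) (by simp; norm_num) ht
  simp only [add_sub_cancel_right, Complex.cpow_natCast] at this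
  rw [this, Complex.Gamma_nat_eq_factorial, ← Nat.cast_add_one, Complex.cpow_natCast]
  simp
  ring

theorem integrableOn_mul_exp {t : ℝ} (ht : 0 < t) {f : ℝ → ℂ} (hf : Measurable f) {C : ℝ}
    (hC : ∀ u, ‖f u‖ ≤ C * (1 + u ^ 2)) :
    IntegrableOn (fun u : ℝ => f u * Complex.exp (-((t : ℂ) * (u : ℂ)))) (Set.Ioi 0) := by
  refine ((integrableOn_one_add_sq_mul_exp ht).const_mul C).mono'
    (Measurable.aestronglyMeasurable (by fun_prop)) (ae_of_all _ fun u => ?_)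
  rw [norm_mul, norm_cexp_neg_mul, ← mul_assoc]
  exact mul_le_mul_of_nonneg_right (hC u) (Real.exp_nonneg _)

/-- For `x ≠ 0` the functions `e^{-iux}`, `1` and `u` have Laplace transforms `1 / (t + ix)`, `1 /
t` and `1 / t²`; the remainder is algebra with `i² = -1`. For `x = 0` the transform of `u²` is used.
-/
theorem freeTransform_lkKernel {t : ℝ} (ht : 0 < t) (x : ℝ) :
    freeTransform (fun u => lkKernel u x) t =
      (1 + t * Complex.I * x) / (t * Complex.I - x) := by
  have htC : (t : ℂ) ≠ 0 := by exact_mod_cast ht.ne'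
  have hI2 : Complex.I ^ 2 = -1 := Complex.I_sq
  unfold freeTransform
  rcases eq_or_ne x 0 with rfl | hx
  · have : ∀ u : ℝ, lkKernel (-u) 0 * Complex.exp (-((t : ℂ) * u)) =
        (-1 / 2) * ((u : ℂ) ^ 2 * Complex.exp (-((t : ℂ) * u))) := fun u => by
      simp [lkKernel]; ring
    simp only [this]
    rw [integral_const_mul, integral_sq_mul_exp_neg ht]
    simp
    field_simp
  have hxC : (x : ℂ) ≠ 0 := by exact_mod_cast hx
  have hx2 : (1 + (x : ℂ) ^ 2) ≠ 0 := by
    have : (1 + x ^ 2 : ℝ) ≠ 0 := by positivity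
    exact_mod_cast this
  have hd : (t * Complex.I - x : ℂ) ≠ 0 := fun h => by
    have := congrArg Complex.im h
    simp at this
    exact ht.ne' this
  have hd2 : (t + Complex.I * x : ℂ) ≠ 0 := fun h => by
    have := congrArg Complex.re h
    simp at this
    exact ht.ne' this
  have e : ∀ u : ℝ, lkKernel (-u) x * Complex.exp (-((t : ℂ) * u)) =
      (Complex.exp (-((t + Complex.I * x) * u)) - Complex.exp (-((t : ℂ) * u)) +
        Complex.I * x / (1 + (x : ℂ) ^ 2) * (u * Complex.exp (-((t : ℂ) * u)))) *
        ((1 + (x : ℂ) ^ 2) / (x : ℂ) ^ 2) := fun u => by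
    have : Complex.exp (-((t + Complex.I * x) * u)) =
        Complex.exp (Complex.I * (-u : ℝ) * x) * Complex.exp (-((t : ℂ) * u)) := by
      rw [← Complex.exp_add]; congr 1; push_cast; ring
    rw [lkKernel, if_neg hx, this]
    push_cast
    field_simp
    ring
  have i1 : IntegrableOn (fun u : ℝ => Complex.exp (-((t + Complex.I * x) * u))) (Set.Ioi 0) := by
    have := integrableOn_exp_mul_complex_Ioi (a := -(t + Complex.I * x)) (by simpa using ht) 0
    simpa only [neg_mul] using this
  have i2 : IntegrableOn (fun u : ℝ => Complex.exp (-((t : ℂ) * u))) (Set.Ioi 0) := by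
    have := integrableOn_exp_mul_complex_Ioi (a := -(t : ℂ)) (by simpa using ht) 0
    simpa only [neg_mul] using this
  have i3 : IntegrableOn (fun u : ℝ => (u : ℂ) * Complex.exp (-((t : ℂ) * u))) (Set.Ioi 0) := by
    refine integrableOn_mul_exp ht (f := fun u => (u : ℂ)) (C := 1) (by fun_prop) fun u => ?_
    rw [Complex.norm_real, Real.norm_eq_abs, ← sq_abs u]
    nlinarith [sq_nonneg (|u| - 1), abs_nonneg u]
  have i12 : IntegrableOn (fun u : ℝ => Complex.exp (-((t + Complex.I * x) * u)) -
      Complex.exp (-((t : ℂ) * u))) (Set.Ioi 0) := i1.sub i2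
  simp only [e]
  rw [integral_mul_const, integral_add i12 (i3.const_mul _), integral_sub i1 i2,
    integral_const_mul, integral_mul_exp_neg ht, integral_exp_neg_mul_complex (by simpa using ht),
    integral_exp_neg_mul_complex (by simpa using ht)]
  have hs : (t * Complex.I - x : ℂ) = Complex.I * (t + Complex.I * x) := by
    linear_combination -(x : ℂ) * hI2
  have hI := Complex.I_ne_zero
  rw [hs]
  field_simp
  linear_combination
    (-(t : ℂ) * Complex.I * x ^ 3 + Complex.I ^ 2 * (x : ℂ) ^ 2 - (x : ℂ) ^ 2) * hI2

/-- Fubini reduces this to the kernel. Passing to the free counterpart therefore keeps the pair of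
parameters. -/
theorem freeTransform_levyExp (a : ℝ) (m : FiniteMeasure ℝ) {t : ℝ} (ht : 0 < t) :
    freeTransform (levyExp a m) t = nevV a m (t * Complex.I) := by
  have htC : (t : ℂ) ≠ 0 := by exact_mod_cast ht.ne'
  have hm : Measurable fun p : ℝ × ℝ => lkKernel (-p.1) p.2 * Complex.exp (-((t : ℂ) * p.1)) :=
    (measurable_lkKernel.comp (f := fun p : ℝ × ℝ => (-p.1, p.2)) (by fun_prop)).mul (by fun_prop)
  have hF : Integrable (fun p : ℝ × ℝ => lkKernel (-p.1) p.2 * Complex.exp (-((t : ℂ) * p.1)))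
      ((volume.restrict (Set.Ioi 0)).prod (m : Measure ℝ)) := by
    have hb := ((integrableOn_one_add_sq_mul_exp ht).const_mul 8).mul_prod
      (integrable_const (μ := (m : Measure ℝ)) (1 : ℝ))
    refine hb.mono' hm.aestronglyMeasurable (ae_of_all _ fun p => ?_)
    rw [norm_mul, norm_cexp_neg_mul, mul_one, ← mul_assoc]
    have := norm_lkKernel_le (-p.1) p.2
    rw [neg_sq] at this
    exact mul_le_mul_of_nonneg_right this (Real.exp_nonneg _)
  have e : ∀ u : ℝ, levyExp a m (-u) * Complex.exp (-((t : ℂ) * u)) =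
      (-Complex.I * a) * (u * Complex.exp (-((t : ℂ) * u))) +
        ∫ x, lkKernel (-u) x * Complex.exp (-((t : ℂ) * u)) ∂(m : Measure ℝ) := fun u => by
    rw [integral_mul_const, levyExp]; push_cast; ring
  have i3 : IntegrableOn (fun u : ℝ => (u : ℂ) * Complex.exp (-((t : ℂ) * u))) (Set.Ioi 0) := by
    refine integrableOn_mul_exp ht (f := fun u => (u : ℂ)) (C := 1) (by fun_prop) fun u => ?_
    rw [Complex.norm_real, Real.norm_eq_abs, ← sq_abs u]
    nlinarith [sq_nonneg (|u| - 1), abs_nonneg u]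
  unfold freeTransform
  simp only [e]
  rw [integral_add (i3.const_mul _) hF.integral_prod_left, integral_const_mul,
    integral_mul_exp_neg ht, integral_integral_swap hF, mul_add, ← integral_const_mul, nevV]
  congr 1
  · field_simp
    linear_combination -(a : ℂ) * Complex.I_sq
  · exact integral_congr_ae (ae_of_all _ fun x => freeTransform_lkKernel ht x)

theorem freeLK_eq_nevV (a : ℝ) (m : FiniteMeasure ℝ) (t : ℝ) :
    freeLK a m t = nevV a m (t * Complex.I) := by
  rw [freeLK, nevV, mul_comm]

/-! ## Growth of characteristic exponents -/

theorem integrable_cexp_mul_I (μ : Measure ℝ) [IsFiniteMeasure μ] (u : ℝ) :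
    Integrable (fun x : ℝ => Complex.exp (u * x * Complex.I)) μ := by
  refine (integrable_const (1 : ℝ)).mono' (by fun_prop) (ae_of_all _ fun x => ?_)
  rw [← Complex.ofReal_mul, Complex.norm_exp_ofReal_mul_I]

theorem re_charFun (μ : Measure ℝ) [IsFiniteMeasure μ] (u : ℝ) :
    (charFun μ u).re = ∫ x, Real.cos (u * x) ∂μ := by
  rw [charFun_apply_real]
  refine (integral_re (integrable_cexp_mul_I μ u)).symm.trans ?_
  refine integral_congr_ae (ae_of_all _ fun x => ?_)
  simp only [RCLike.re_to_complex, ← Complex.ofReal_mul, Complex.exp_ofReal_mul_I_re]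

theorem im_charFun (μ : Measure ℝ) [IsFiniteMeasure μ] (u : ℝ) :
    (charFun μ u).im = ∫ x, Real.sin (u * x) ∂μ := by
  rw [charFun_apply_real]
  refine (integral_im (integrable_cexp_mul_I μ u)).symm.trans ?_
  refine integral_congr_ae (ae_of_all _ fun x => ?_)
  simp only [RCLike.im_to_complex, ← Complex.ofReal_mul, Complex.exp_ofReal_mul_I_im]

theorem integrable_cos_mul (μ : Measure ℝ) [IsFiniteMeasure μ] (u : ℝ) :
    Integrable (fun x => Real.cos (u * x)) μ :=
  (integrable_const (1 : ℝ)).mono' (by fun_prop) (ae_of_all _ fun x => Real.abs_cos_le_one _)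

theorem integrable_sin_mul (μ : Measure ℝ) [IsFiniteMeasure μ] (u : ℝ) :
    Integrable (fun x => Real.sin (u * x)) μ :=
  (integrable_const (1 : ℝ)).mono' (by fun_prop) (ae_of_all _ fun x => Real.abs_sin_le_one _)

/-- Integrate `1 - cos 2θ = 2 (1 - cos θ)(1 + cos θ) ≤ 4 (1 - cos θ)`. -/
theorem re_charFun_two_mul (μ : ProbabilityMeasure ℝ) (u : ℝ) :
    1 - (charFun (μ : Measure ℝ) (2 * u)).re ≤ 4 * (1 - (charFun (μ : Measure ℝ) u).re) := by
  rw [re_charFun, re_charFun]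
  have h : ∫ x, (4 * Real.cos (u * x) - 3) ∂(μ : Measure ℝ) ≤
      ∫ x, Real.cos (2 * u * x) ∂(μ : Measure ℝ) := by
    refine integral_mono (((integrable_cos_mul _ u).const_mul 4).sub (integrable_const _))
      (integrable_cos_mul _ _) fun x => ?_
    simp only [mul_assoc, Real.cos_two_mul]
    nlinarith [Real.cos_le_one (u * x), sq_nonneg (1 - Real.cos (u * x))]
  rw [integral_sub ((integrable_cos_mul _ u).const_mul 4) (integrable_const _), integral_const_mul]
    at h
  simp at h
  linarith

/-- Integrate `|sin 2θ - 2 sin θ| ≤ 2 (1 - cos θ)`. -/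
theorem im_charFun_two_mul (μ : ProbabilityMeasure ℝ) (u : ℝ) :
    |(charFun (μ : Measure ℝ) (2 * u)).im| ≤
      2 * |(charFun (μ : Measure ℝ) u).im| + 2 * (1 - (charFun (μ : Measure ℝ) u).re) := by
  rw [re_charFun, im_charFun, im_charFun]
  have hs := integrable_sin_mul (μ : Measure ℝ) u
  have hc := integrable_cos_mul (μ : Measure ℝ) u
  have h1 : ∫ x, Real.sin (2 * u * x) ∂(μ : Measure ℝ) - 2 * ∫ x, Real.sin (u * x) ∂(μ : Measure ℝ) =
      ∫ x, (Real.sin (2 * u * x) - 2 * Real.sin (u * x)) ∂(μ : Measure ℝ) := by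
    rw [integral_sub (integrable_sin_mul _ _) (hs.const_mul 2), integral_const_mul]
  have h2 : |∫ x, (Real.sin (2 * u * x) - 2 * Real.sin (u * x)) ∂(μ : Measure ℝ)| ≤
      ∫ x, 2 * (1 - Real.cos (u * x)) ∂(μ : Measure ℝ) := by
    rw [← Real.norm_eq_abs]
    refine norm_integral_le_of_norm_le (((integrable_const _).sub hc).const_mul 2)
      (ae_of_all _ fun x => ?_)
    rw [mul_assoc, Real.sin_two_mul, Real.norm_eq_abs]
    have : 2 * Real.sin (u * x) * Real.cos (u * x) - 2 * Real.sin (u * x) =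
        2 * (Real.sin (u * x) * (Real.cos (u * x) - 1)) := by ring
    rw [this, abs_mul, abs_mul, abs_of_nonpos (by linarith [Real.cos_le_one (u * x)] :
      Real.cos (u * x) - 1 ≤ 0)]
    norm_num
    nlinarith [Real.abs_sin_le_one (u * x), Real.cos_le_one (u * x)]
  rw [integral_const_mul, integral_sub (integrable_const _) hc] at h2
  simp only [integral_const, probReal_univ, smul_eq_mul, mul_one] at h2
  have h3 := abs_add_le (∫ x, Real.sin (2 * u * x) ∂(μ : Measure ℝ) -
    2 * ∫ x, Real.sin (u * x) ∂(μ : Measure ℝ)) (2 * ∫ x, Real.sin (u * x) ∂(μ : Measure ℝ))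
  rw [sub_add_cancel, h1, abs_mul] at h3
  norm_num at h3
  linarith

/-- The doubling inequalities propagate a bound on `[-1, 1]` to the line with quadratic growth. The
constant depends neither on `σ` nor on `c`, so a whole sequence of compound Poisson exponents is
dominated at once. -/
theorem norm_mul_charFun_sub_one_le {σ : ProbabilityMeasure ℝ} {c M : ℝ} (hc : 0 ≤ c)
    (hM : ∀ u : ℝ, |u| ≤ 1 → ‖(c : ℂ) * (charFun (σ : Measure ℝ) u - 1)‖ ≤ M) (u : ℝ) :
    ‖(c : ℂ) * (charFun (σ : Measure ℝ) u - 1)‖ ≤ 8 * M * (1 + u ^ 2) := by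
  set R : ℝ → ℝ := fun u => c * (1 - (charFun (σ : Measure ℝ) u).re) with hR
  set S : ℝ → ℝ := fun u => c * |(charFun (σ : Measure ℝ) u).im| with hS
  have hM0 : 0 ≤ M := (norm_nonneg _).trans (hM 0 (by simp))
  have hre : ∀ u, ((c : ℂ) * (charFun (σ : Measure ℝ) u - 1)).re = -R u := fun u => by
    simp [hR]; ring
  have him : ∀ u, |((c : ℂ) * (charFun (σ : Measure ℝ) u - 1)).im| = S u := fun u => by
    simp [hS, abs_mul, abs_of_nonneg hc]
  have hR1 : ∀ u, |u| ≤ 1 → R u ≤ M := fun u hu => by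
    have := (Complex.abs_re_le_norm _).trans (hM u hu)
    rw [hre, abs_neg] at this
    exact (le_abs_self _).trans this
  have hS1 : ∀ u, |u| ≤ 1 → S u ≤ M := fun u hu => by
    have := (Complex.abs_im_le_norm _).trans (hM u hu)
    rwa [him] at this
  have hR2 : ∀ u, R (2 * u) ≤ 4 * R u := fun u => by
    have := mul_le_mul_of_nonneg_left (re_charFun_two_mul σ u) hc
    simp only [hR]; linarith
  have hS2 : ∀ u, S (2 * u) ≤ 2 * S u + 2 * R u := fun u => by
    have := mul_le_mul_of_nonneg_left (im_charFun_two_mul σ u) hc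
    simp only [hR, hS]; linarith
  -- The majorant reproduces itself under doubling: for `|u| ≥ 1` its value at `u / 2` is `M u²`,
  -- and both inequalities then give `4 M u²` at `u`.
  have key : ∀ k : ℕ, ∀ u : ℝ, |u| ≤ 2 ^ k →
      R u ≤ M * max 1 (4 * u ^ 2) ∧ S u ≤ M * max 1 (4 * u ^ 2) := by
    intro k
    induction k with
    | zero =>
      intro u hu
      rw [pow_zero] at hu
      have : M ≤ M * max 1 (4 * u ^ 2) := le_mul_of_one_le_right hM0 (le_max_left _ _)
      exact ⟨(hR1 u hu).trans this, (hS1 u hu).trans this⟩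
    | succ k ih =>
      intro u hu
      rcases le_total |u| 1 with h | h
      · have : M ≤ M * max 1 (4 * u ^ 2) := le_mul_of_one_le_right hM0 (le_max_left _ _)
        exact ⟨(hR1 u h).trans this, (hS1 u h).trans this⟩
      · have hv : |u / 2| ≤ 2 ^ k := by
          rw [abs_div, abs_two, div_le_iff₀ two_pos, ← pow_succ]; exact hu
        obtain ⟨h1, h2⟩ := ih _ hv
        have hu2 : 1 ≤ u ^ 2 := by rw [← sq_abs]; nlinarith
        have e1 : max 1 (4 * (u / 2) ^ 2) = u ^ 2 := by
          rw [max_eq_right (by linarith)]; ring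
        have e2 : max 1 (4 * u ^ 2) = 4 * u ^ 2 := max_eq_right (by linarith)
        rw [e1] at h1 h2
        rw [e2]
        have h3 := hR2 (u / 2)
        have h4 := hS2 (u / 2)
        rw [mul_div_cancel₀ u two_ne_zero] at h3 h4
        constructor <;> linarith
  obtain ⟨k, hk⟩ := pow_unbounded_of_one_lt |u| (one_lt_two (α := ℝ))
  obtain ⟨h1, h2⟩ := key k u hk.le
  have hR0 : 0 ≤ R u := by
    have h3 := (Complex.abs_re_le_norm _).trans (norm_charFun_le_one (μ := (σ : Measure ℝ)) (t := u))
    exact mul_nonneg hc (by linarith [le_abs_self (charFun (σ : Measure ℝ) u).re])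
  have h4 := Complex.norm_le_abs_re_add_abs_im ((c : ℂ) * (charFun (σ : Measure ℝ) u - 1))
  rw [hre, him, abs_neg, abs_of_nonneg hR0] at h4
  have h5 : M * max 1 (4 * u ^ 2) ≤ M * (4 * (1 + u ^ 2)) :=
    mul_le_mul_of_nonneg_left (max_le (by nlinarith) (by nlinarith)) hM0
  linarith

/-- This compound Poisson exponent has Lévy measure `c σ`, hence `m = c x² / (1 + x²) · σ` and drift
`c ∫ x / (1 + x²) dσ`. The density vanishes at `x = 0`, so the Gaussian value of the kernel does not
interfere. -/
theorem exists_levyExp_eq_mul_charFun_sub_one (σ : ProbabilityMeasure ℝ) {c : ℝ} (hc : 0 ≤ c) :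
    ∃ (a : ℝ) (m : FiniteMeasure ℝ), ∀ u : ℝ,
      (c : ℂ) * (charFun (σ : Measure ℝ) u - 1) = levyExp a m u := by
  set w : ℝ → ℝ := fun x => c * (x ^ 2 / (1 + x ^ 2)) with hw
  have hw0 : ∀ x, 0 ≤ w x := fun x => by simp only [hw]; positivity
  have hwm : Measurable w := by fun_prop
  have hwi : Integrable w (σ : Measure ℝ) := by
    refine (integrable_const c).mono' hwm.aestronglyMeasurable (ae_of_all _ fun x => ?_)
    rw [Real.norm_of_nonneg (hw0 x)]
    exact mul_le_of_le_one_right hc ((div_le_one (by positivity)).2 (by linarith))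
  have hv : Integrable (fun x : ℝ => x / (1 + x ^ 2)) (σ : Measure ℝ) := by
    refine (integrable_const 1).mono' (Measurable.aestronglyMeasurable (by fun_prop))
      (ae_of_all _ fun x => ?_)
    rw [Real.norm_eq_abs, abs_div, abs_of_pos (by positivity : (0 : ℝ) < 1 + x ^ 2),
      div_le_one (by positivity), ← sq_abs]
    nlinarith [sq_nonneg (|x| - 1), abs_nonneg x]
  have hvC : Integrable (fun x : ℝ => ((x / (1 + x ^ 2) : ℝ) : ℂ)) (σ : Measure ℝ) := hv.ofReal
  obtain ⟨m, hm⟩ : ∃ m : FiniteMeasure ℝ,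
      (m : Measure ℝ) = (σ : Measure ℝ).withDensity fun x => ENNReal.ofReal (w x) :=
    ⟨⟨_, isFiniteMeasure_withDensity_ofReal hwi.2⟩, rfl⟩
  refine ⟨c * ∫ x, x / (1 + x ^ 2) ∂(σ : Measure ℝ), m, fun u => ?_⟩
  rw [levyExp, hm,
    integral_withDensity_eq_integral_toReal_smul hwm.ennreal_ofReal
      (ae_of_all _ fun x => ENNReal.ofReal_lt_top)]
  have e : ∀ x, (ENNReal.ofReal (w x)).toReal • lkKernel u x =
      c * (Complex.exp (u * x * Complex.I) - 1 - Complex.I * u * ((x / (1 + x ^ 2) : ℝ) : ℂ)) :=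
    fun x => by
    rw [ENNReal.toReal_ofReal (hw0 x), Complex.real_smul]
    rcases eq_or_ne x 0 with rfl | hx
    · simp [hw]
    have h1 : (x : ℂ) ≠ 0 := by exact_mod_cast hx
    have h2 : (1 + (x : ℂ) ^ 2) ≠ 0 := by
      have : (1 + x ^ 2 : ℝ) ≠ 0 := by positivity
      exact_mod_cast this
    have e : (u * x * Complex.I : ℂ) = Complex.I * u * x := by ring
    rw [lkKernel, if_neg hx, e]
    simp only [hw]
    push_cast
    field_simp
  simp only [e]
  have h1 := integrable_cexp_mul_I (σ : Measure ℝ) u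
  have h2 : Integrable (fun x : ℝ => Complex.exp (u * x * Complex.I) - 1) (σ : Measure ℝ) :=
    h1.sub (integrable_const _)
  rw [integral_const_mul, integral_sub h2 (hvC.const_mul _), integral_sub h1 (integrable_const _),
    integral_const_mul, integral_complex_ofReal, ← charFun_apply_real]
  simp
  ring

/-! ## Limits of the transforms of exponents -/

theorem tendsto_freeTransform {f : ℕ → ℝ → ℂ} {ψ : ℝ → ℂ} (hf : ∀ n, Measurable (f n)) {C : ℝ}
    (hC : ∀ n u, ‖f n u‖ ≤ C * (1 + u ^ 2)) (h : ∀ u, Tendsto (fun n => f n u) atTop (𝓝 (ψ u)))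
    {t : ℝ} (ht : 0 < t) :
    Tendsto (fun n => freeTransform (f n) t) atTop (𝓝 (freeTransform ψ t)) := by
  refine Tendsto.const_mul _ ?_
  refine tendsto_integral_of_dominated_convergence (fun u => C * ((1 + u ^ 2) * Real.exp (-(t * u))))
    (fun n => ?_) ((integrableOn_one_add_sq_mul_exp ht).const_mul C) (fun n => ae_of_all _ fun u => ?_)
    (ae_of_all _ fun u => (h (-u)).mul_const _)
  · have := hf n
    exact Measurable.aestronglyMeasurable (by fun_prop)
  · rw [norm_mul, norm_cexp_neg_mul, ← mul_assoc]
    have := hC n (-u)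
    rw [neg_sq] at this
    exact mul_le_mul_of_nonneg_right this (Real.exp_nonneg _)

/-- The substitution `v = tu` turns the quotient into `∫ ψ(-v/t) e^{-v} dv`, which tends to `ψ(0) =
0`. It serves to exclude a linear term in limits of Nevanlinna functions. -/
theorem tendsto_freeTransform_div {ψ : ℝ → ℂ} (hψ : Continuous ψ) (h0 : ψ 0 = 0) {C : ℝ}
    (hC : ∀ u, ‖ψ u‖ ≤ C * (1 + u ^ 2)) :
    Tendsto (fun t : ℝ => freeTransform ψ t / (t * Complex.I)) atTop (𝓝 0) := by
  have hC0 : 0 ≤ C := by simpa using (norm_nonneg _).trans (hC 0)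
  have h1 : Tendsto (fun t : ℝ => ∫ v in Set.Ioi (0 : ℝ), ψ (-(t⁻¹ * v)) * Complex.exp (-(v : ℂ)))
      atTop (𝓝 (∫ v in Set.Ioi (0 : ℝ), (0 : ℂ))) := by
    refine tendsto_integral_filter_of_dominated_convergence
      (fun v => C * ((1 + v ^ 2) * Real.exp (-(1 * v)))) (Eventually.of_forall fun t => ?_) ?_
      ((integrableOn_one_add_sq_mul_exp one_pos).const_mul C) (ae_of_all _ fun v => ?_)
    · exact Continuous.aestronglyMeasurable (by fun_prop)
    · filter_upwards [eventually_ge_atTop 1] with t ht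
      refine ae_of_all _ fun v => ?_
      have e := norm_cexp_neg_mul 1 v
      rw [Complex.ofReal_one, one_mul] at e
      rw [norm_mul, e, ← mul_assoc]
      refine mul_le_mul_of_nonneg_right ((hC _).trans ?_) (Real.exp_nonneg _)
      refine mul_le_mul_of_nonneg_left ?_ hC0
      have h2 : t⁻¹ ^ 2 ≤ 1 := pow_le_one₀ (by positivity) (inv_le_one_of_one_le₀ ht)
      nlinarith [sq_nonneg v]
    · have h3 : Tendsto (fun t : ℝ => -(t⁻¹ * v)) atTop (𝓝 0) := by
        simpa using (tendsto_inv_atTop_zero.mul_const v).neg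
      have h4 := ((hψ.tendsto 0).comp h3).mul_const (Complex.exp (-(v : ℂ)))
      simpa [h0] using h4
  rw [integral_zero] at h1
  refine h1.congr' ?_
  filter_upwards [eventually_gt_atTop 0] with t ht
  have htC : (t : ℂ) ≠ 0 := by exact_mod_cast ht.ne'
  have h5 := integral_comp_mul_left_Ioi
    (fun v : ℝ => ψ (-(t⁻¹ * v)) * Complex.exp (-(v : ℂ))) 0 ht
  simp only [mul_zero, inv_mul_cancel_left₀ ht.ne', Complex.ofReal_mul] at h5
  rw [freeTransform, h5, Complex.real_smul]
  have := Complex.I_ne_zero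
  push_cast
  field_simp

theorem exists_nevV_of_tendsto_charFun {σ : ℕ → ProbabilityMeasure ℝ} {c : ℕ → ℝ}
    (hc : ∀ n, 0 ≤ c n) {ψ : ℝ → ℂ} (hψ : Continuous ψ) (h0 : ψ 0 = 0)
    (hlim : ∀ u, Tendsto (fun n => (c n : ℂ) * (charFun (σ n : Measure ℝ) u - 1)) atTop (𝓝 (ψ u)))
    {M : ℝ} (hM : ∀ n (u : ℝ), |u| ≤ 1 → ‖(c n : ℂ) * (charFun (σ n : Measure ℝ) u - 1)‖ ≤ M) :
    ∃ (a : ℝ) (m : FiniteMeasure ℝ), ∀ t : ℝ, 0 < t →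
      freeTransform ψ t = nevV a m (t * Complex.I) := by
  have hb : ∀ n u, ‖(c n : ℂ) * (charFun (σ n : Measure ℝ) u - 1)‖ ≤ 8 * M * (1 + u ^ 2) :=
    fun n u => norm_mul_charFun_sub_one_le (hc n) (hM n) u
  have hbψ : ∀ u, ‖ψ u‖ ≤ 8 * M * (1 + u ^ 2) := fun u =>
    le_of_tendsto' (hlim u).norm fun n => hb n u
  choose a m ham using fun n => exists_levyExp_eq_mul_charFun_sub_one (σ n) (hc n)
  refine exists_nevV_of_tendsto_imaginary_axis (a := a) (m := m) (fun t ht => ?_)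
    (tendsto_freeTransform_div hψ h0 hbψ)
  simp only [← freeTransform_levyExp _ _ ht]
  refine tendsto_freeTransform (C := 8 * M) (fun n => (continuous_levyExp _ _).measurable) (fun n u => ?_)
    (fun u => ?_) ht
  · rw [← ham]; exact hb n u
  · simp only [← ham]; exact hlim u

/-- If all roots of the laws with exponents `χ n` exist and `χ n → ψ`, then the transform of `ψ`
has a Nevanlinna representation. -/
theorem exists_nevV_of_tendsto_exponent {χ : ℕ → ℝ → ℂ} {ψ : ℝ → ℂ} (hψ : Continuous ψ)
    (h0 : ψ 0 = 0) (hlim : ∀ u, Tendsto (fun n => χ n u) atTop (𝓝 (ψ u))) {M : ℝ}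
    (hM : ∀ n (u : ℝ), |u| ≤ 1 → ‖χ n u‖ ≤ M)
    (hroot : ∀ n N : ℕ, 1 ≤ N → ∃ σ : ProbabilityMeasure ℝ, ∀ u : ℝ,
      charFun (σ : Measure ℝ) u = Complex.exp (χ n u / N)) :
    ∃ (a : ℝ) (m : FiniteMeasure ℝ), ∀ t : ℝ, 0 < t →
      freeTransform ψ t = nevV a m (t * Complex.I) := by
  -- The order `N = n + 1` of the root grows with `n`, so `N (e^{χ/N} - 1) - χ` is of order `|χ|² /
  -- N` and the compound Poisson exponents have the limit `ψ` as well.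
  choose σ hσ using fun n => hroot n (n + 1) (Nat.le_add_left 1 n)
  refine exists_nevV_of_tendsto_charFun (σ := σ) (c := fun n => ((n + 1 : ℕ) : ℝ))
    (fun n => by positivity) hψ h0 (fun u => ?_) (M := 2 * M) fun n u hu => ?_
  · have hN : Tendsto (fun n : ℕ => ((n + 1 : ℕ) : ℝ)⁻¹) atTop (𝓝 0) :=
      tendsto_inv_atTop_zero.comp (tendsto_natCast_atTop_atTop.comp (tendsto_add_atTop_nat 1))
    have h1 : Tendsto (fun n => ‖χ n u‖ * ((n + 1 : ℕ) : ℝ)⁻¹) atTop (𝓝 0) := by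
      simpa using (hlim u).norm.mul hN
    have h2 : Tendsto (fun n => ‖χ n u‖ * (‖χ n u‖ * ((n + 1 : ℕ) : ℝ)⁻¹)) atTop (𝓝 0) := by
      simpa using (hlim u).norm.mul h1
    have h3 : Tendsto (fun n => (((n + 1 : ℕ) : ℝ) : ℂ) * (charFun (σ n : Measure ℝ) u - 1) - χ n u)
        atTop (𝓝 0) := by
      refine squeeze_zero_norm' ?_ h2
      filter_upwards [h1.eventually (gt_mem_nhds one_pos)] with n hn
      have hNC : ((n + 1 : ℕ) : ℂ) ≠ 0 := by exact_mod_cast Nat.succ_ne_zero n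
      have hn' : ‖χ n u / (n + 1 : ℕ)‖ = ‖χ n u‖ * ((n + 1 : ℕ) : ℝ)⁻¹ := by
        rw [norm_div, Complex.norm_natCast, div_eq_mul_inv]
      have h4 := Complex.norm_exp_sub_one_sub_id_le (x := χ n u / (n + 1 : ℕ)) (by
        rw [hn']; exact hn.le)
      have e : (((n + 1 : ℕ) : ℝ) : ℂ) * (charFun (σ n : Measure ℝ) u - 1) - χ n u =
          ((n + 1 : ℕ) : ℂ) * (Complex.exp (χ n u / (n + 1 : ℕ)) - 1 - χ n u / (n + 1 : ℕ)) := by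
        rw [hσ, Complex.ofReal_natCast]
        field_simp
      rw [e, norm_mul, Complex.norm_natCast]
      refine (mul_le_mul_of_nonneg_left h4 (Nat.cast_nonneg _)).trans (le_of_eq ?_)
      rw [hn']
      have : ((n + 1 : ℕ) : ℝ) ≠ 0 := by positivity
      field_simp
    have h5 := h3.add (hlim u)
    simpa using h5
  · have hNpos : (0 : ℝ) < ((n + 1 : ℕ) : ℝ) := by positivity
    rw [norm_mul, Complex.norm_real, Real.norm_of_nonneg hNpos.le]
    have hn' : ‖χ n u / (n + 1 : ℕ)‖ = ‖χ n u‖ / ((n + 1 : ℕ) : ℝ) := by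
      rw [norm_div, Complex.norm_natCast]
    -- If `|χ / N| ≤ 1` then `|e^{χ/N} - 1| ≤ 2 |χ| / N`. Otherwise `N ≤ |χ|`, and the trivial bound
    -- `2` suffices.
    rcases le_total ‖χ n u / (n + 1 : ℕ)‖ 1 with h | h
    · have h1 := Complex.norm_exp_sub_one_le h
      rw [← hσ, hn'] at h1
      calc _ ≤ ((n + 1 : ℕ) : ℝ) * (2 * (‖χ n u‖ / ((n + 1 : ℕ) : ℝ))) :=
            mul_le_mul_of_nonneg_left h1 hNpos.le
        _ = 2 * ‖χ n u‖ := by field_simp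
        _ ≤ _ := by linarith [hM n u hu]
    · rw [hn', le_div_iff₀ hNpos, one_mul] at h
      have h1 : ‖charFun (σ n : Measure ℝ) u - 1‖ ≤ 2 := by
        rw [norm_sub_rev]; exact norm_one_sub_charFun_le_two
      calc _ ≤ ((n + 1 : ℕ) : ℝ) * 2 := mul_le_mul_of_nonneg_left h1 hNpos.le
        _ ≤ _ := by linarith [hM n u hu]

/-! ## Convergence of logarithms of characteristic functions -/

/-- The modulus of continuity is the integral of a bounded continuous function, so it is stable
under weak convergence and yields equicontinuity. -/
theorem norm_charFun_sub_le (μ : ProbabilityMeasure ℝ) (u v : ℝ) {h : ℝ} (huv : |u - v| ≤ h) :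
    ‖charFun (μ : Measure ℝ) u - charFun (μ : Measure ℝ) v‖ ≤
      ∫ x, min 2 (h * |x|) ∂(μ : Measure ℝ) := by
  have hh : 0 ≤ h := (abs_nonneg _).trans huv
  rw [charFun_apply_real, charFun_apply_real,
    ← integral_sub (integrable_cexp_mul_I _ u) (integrable_cexp_mul_I _ v)]
  refine norm_integral_le_of_norm_le ?_ (ae_of_all _ fun x => ?_)
  · refine (integrable_const (2 : ℝ)).mono' (Continuous.aestronglyMeasurable (by fun_prop))
      (ae_of_all _ fun x => ?_)
    rw [Real.norm_of_nonneg (le_min zero_le_two (by positivity))]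
    exact min_le_left _ _
  · have e1 : ∀ w : ℝ, ‖Complex.exp (w * x * Complex.I)‖ = 1 := fun w => by
      rw [← Complex.ofReal_mul, Complex.norm_exp_ofReal_mul_I]
    refine le_min ?_ ?_
    · refine (norm_sub_le _ _).trans ?_
      rw [e1, e1]; norm_num
    · have e2 : Complex.exp (u * x * Complex.I) - Complex.exp (v * x * Complex.I) =
          Complex.exp (v * x * Complex.I) *
            (Complex.exp (Complex.I * ((u - v) * x : ℝ)) - 1) := by
        rw [mul_sub, ← Complex.exp_add, mul_one]
        congr 2
        push_cast; ring
      rw [e2, norm_mul, e1, one_mul]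
      refine (Real.norm_exp_I_mul_ofReal_sub_one_le).trans ?_
      rw [Real.norm_eq_abs, abs_mul]
      exact mul_le_mul_of_nonneg_right huv (abs_nonneg x)

theorem exists_integral_min_lt (μ : ProbabilityMeasure ℝ) {ε : ℝ} (hε : 0 < ε) :
    ∃ h : ℝ, 0 < h ∧ ∫ x, min 2 (h * |x|) ∂(μ : Measure ℝ) < ε := by
  have h1 : Tendsto (fun h : ℝ => ∫ x, min 2 (h * |x|) ∂(μ : Measure ℝ)) (𝓝[>] 0)
      (𝓝 (∫ _x : ℝ, (0 : ℝ) ∂(μ : Measure ℝ))) := by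
    refine tendsto_integral_filter_of_dominated_convergence (fun _ => (2 : ℝ))
      (Eventually.of_forall fun h => Continuous.aestronglyMeasurable (by fun_prop)) ?_
      (integrable_const _) (ae_of_all _ fun x => ?_)
    · filter_upwards [self_mem_nhdsWithin] with h hh
      refine ae_of_all _ fun x => ?_
      have hh' : 0 < h := hh
      rw [Real.norm_of_nonneg (le_min zero_le_two (by positivity))]
      exact min_le_left _ _
    · have : Continuous fun h : ℝ => min 2 (h * |x|) := by fun_prop
      have h2 := this.tendsto 0
      simp only [zero_mul] at h2
      rw [min_eq_right zero_le_two] at h2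
      exact tendsto_nhdsWithin_of_tendsto_nhds h2
  rw [integral_zero] at h1
  obtain ⟨h, h2, h3⟩ := ((h1.eventually (gt_mem_nhds hε)).and self_mem_nhdsWithin).exists
  exact ⟨h, h3, h2⟩

theorem tendsto_charFun_of_tendsto {ι : Type*} {l : Filter ι} {μ : ι → ProbabilityMeasure ℝ}
    {ρ : ProbabilityMeasure ℝ} (h : Tendsto μ l (𝓝 ρ)) {v : ι → ℝ} {u : ℝ}
    (hv : Tendsto v l (𝓝 u)) :
    Tendsto (fun i => charFun (μ i : Measure ℝ) (v i)) l (𝓝 (charFun (ρ : Measure ℝ) u)) := by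
  have h1 : Tendsto (fun i => charFun (μ i : Measure ℝ) u) l (𝓝 (charFun (ρ : Measure ℝ) u)) := by
    have h2 := (ProbabilityMeasure.tendsto_iff_forall_integral_rclike_tendsto ℂ).1 h
      (BoundedContinuousFunction.innerProbChar u)
    simpa only [← charFun_eq_integral_innerProbChar] using h2
  have h3 : Tendsto (fun i => charFun (μ i : Measure ℝ) (v i) - charFun (μ i : Measure ℝ) u) l
      (𝓝 0) := by
    rw [Metric.tendsto_nhds]
    intro ε hε
    obtain ⟨r, hr, hrε⟩ := exists_integral_min_lt ρ hε
    have hb : ∀ x : ℝ, ‖min 2 (r * |x|)‖ ≤ 2 := fun x => by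
      rw [Real.norm_of_nonneg (le_min zero_le_two (by positivity))]
      exact min_le_left _ _
    have h4 := ProbabilityMeasure.tendsto_iff_forall_integral_tendsto.1 h
      (BoundedContinuousFunction.ofNormedAddCommGroup (fun x : ℝ => min 2 (r * |x|))
        (by fun_prop) 2 hb)
    simp only [BoundedContinuousFunction.coe_ofNormedAddCommGroup] at h4
    filter_upwards [h4.eventually (gt_mem_nhds hrε), (Metric.tendsto_nhds.1 hv) r hr] with i h5 h6
    rw [dist_zero_right]
    refine lt_of_le_of_lt (norm_charFun_sub_le (μ i) _ _ ?_) h5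
    rw [Real.dist_eq] at h6
    exact h6.le
  simpa using h3.add h1

/-- Otherwise infinitely many indices have a bad point in `[-T, T]`. Along an ultrafilter these
points converge to some `u`, and the quotient at them tends to `1`. -/
theorem eventually_norm_charFun_div_sub_one_le {μ : ℕ → ProbabilityMeasure ℝ}
    {ρ : ProbabilityMeasure ℝ} (h : Tendsto μ atTop (𝓝 ρ))
    (hρ : ∀ u : ℝ, charFun (ρ : Measure ℝ) u ≠ 0) (T : ℝ) :
    ∀ᶠ n in atTop, ∀ u : ℝ, |u| ≤ T →
      ‖charFun (μ n : Measure ℝ) u / charFun (ρ : Measure ℝ) u - 1‖ ≤ 1 / 2 := by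
  by_contra hcon
  set P : ℕ → Prop := fun n => ∃ u : ℝ, |u| ≤ T ∧
    1 / 2 < ‖charFun (μ n : Measure ℝ) u / charFun (ρ : Measure ℝ) u - 1‖ with hP
  have hfreq : ∃ᶠ n in atTop, P n := by
    rw [Filter.not_eventually] at hcon
    refine hcon.mono fun n hn => ?_
    push Not at hn
    exact hn
  have hne : NeBot (atTop ⊓ 𝓟 {n | P n}) := frequently_mem_iff_neBot.1 hfreq
  set U := Ultrafilter.of (atTop ⊓ 𝓟 {n | P n}) with hU
  have hU1 : (U : Filter ℕ) ≤ atTop := (Ultrafilter.of_le _).trans inf_le_left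
  have hU2 : ∀ᶠ n in (U : Filter ℕ), P n :=
    ((Ultrafilter.of_le _).trans inf_le_right) (mem_principal_self _)
  obtain ⟨v, hv⟩ : ∃ v : ℕ → ℝ, ∀ n, P n → |v n| ≤ T ∧
      1 / 2 < ‖charFun (μ n : Measure ℝ) (v n) / charFun (ρ : Measure ℝ) (v n) - 1‖ := by
    classical
    refine ⟨fun n => if hn : P n then hn.choose else 0, fun n hn => ?_⟩
    simp only [dif_pos hn]
    exact hn.choose_spec
  obtain ⟨u, -, hu⟩ := (isCompact_Icc (a := -T) (b := T)).ultrafilter_le_nhds (U.map v)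
    (le_principal_iff.2 (hU2.mono fun n hn => abs_le.1 (hv n hn).1))
  have hvu : Tendsto v U (𝓝 u) := hu
  have h1 := tendsto_charFun_of_tendsto (h.mono_left hU1) hvu
  have h2 : Tendsto (fun n => charFun (ρ : Measure ℝ) (v n)) U (𝓝 (charFun (ρ : Measure ℝ) u)) :=
    tendsto_charFun_of_tendsto tendsto_const_nhds hvu
  have h3 := ((h1.div h2 (hρ u)).sub_const 1).norm
  rw [div_self (hρ u), sub_self, norm_zero] at h3
  obtain ⟨n, h4, h5⟩ := ((h3.eventually (gt_mem_nhds one_half_pos)).and hU2).exists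
  exact absurd h4 (not_lt.2 (hv n h5).2.le)

/-- While `e^δ` stays within `1/2` of `1`, the cosine of `Im δ` cannot vanish. Starting from `δ(0) =
0`, continuity keeps `|Im δ|` below `π / 2`, so `δ` is the principal logarithm of `e^δ`. -/
theorem norm_le_of_norm_exp_sub_one_le {δ : ℝ → ℂ} (hδ : Continuous δ) (h0 : δ 0 = 0) {T : ℝ}
    (h : ∀ u, |u| ≤ T → ‖Complex.exp (δ u) - 1‖ ≤ 1 / 2) {u : ℝ} (hu : |u| ≤ T) :
    ‖δ u‖ ≤ 3 / 2 * ‖Complex.exp (δ u) - 1‖ := by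
  have hcos : ∀ v, |v| ≤ T → Real.cos (δ v).im ≠ 0 := fun v hv hc => by
    have h1 := (Complex.abs_re_le_norm _).trans (h v hv)
    rw [Complex.sub_re, Complex.exp_re, hc, mul_zero, Complex.one_re] at h1
    norm_num at h1
  have hlt : |(δ u).im| < Real.pi / 2 := by
    by_contra hcon
    push Not at hcon
    have hg : Continuous fun v => |(δ v).im| := by fun_prop
    have h1 := intermediate_value_uIcc (hg.continuousOn (s := Set.uIcc 0 u))
    have h2 : Real.pi / 2 ∈ Set.uIcc |(δ 0).im| |(δ u).im| := by
      rw [h0, Complex.zero_im, abs_zero, Set.uIcc_of_le (abs_nonneg _)]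
      exact ⟨by positivity, hcon⟩
    obtain ⟨v, hv, hv'⟩ := h1 h2
    have hvT : |v| ≤ T := by
      have := Set.abs_sub_left_of_mem_uIcc hv
      simp only [sub_zero] at this
      exact this.trans hu
    refine hcos v hvT ?_
    have hv2 : |(δ v).im| = Real.pi / 2 := hv'
    rw [← Real.cos_abs, hv2, Real.cos_pi_div_two]
  rw [abs_lt] at hlt
  have hlog : Complex.log (Complex.exp (δ u)) = δ u :=
    Complex.log_exp (by linarith [Real.pi_pos]) (by linarith [Real.pi_pos])
  have h3 := Complex.norm_log_one_add_half_le_self (h u hu)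
  rwa [add_sub_cancel, hlog] at h3

theorem eventually_norm_sub_le_of_isLogCharFun {μ : ℕ → ProbabilityMeasure ℝ}
    {ρ : ProbabilityMeasure ℝ} (h : Tendsto μ atTop (𝓝 ρ)) {χ : ℕ → ℝ → ℂ} {ψ : ℝ → ℂ}
    (hχ : ∀ n, IsLogCharFun (μ n) (χ n)) (hψ : IsLogCharFun ρ ψ) (T : ℝ) :
    ∀ᶠ n in atTop, ∀ u : ℝ, |u| ≤ T → ‖χ n u - ψ u‖ ≤
        3 / 2 * ‖charFun (μ n : Measure ℝ) u / charFun (ρ : Measure ℝ) u - 1‖ ∧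
      ‖charFun (μ n : Measure ℝ) u / charFun (ρ : Measure ℝ) u - 1‖ ≤ 1 / 2 := by
  have hρ : ∀ u : ℝ, charFun (ρ : Measure ℝ) u ≠ 0 := fun u => by
    rw [hψ.2.2]; exact Complex.exp_ne_zero _
  filter_upwards [eventually_norm_charFun_div_sub_one_le h hρ T] with n hn u hu
  have e : ∀ u, charFun (μ n : Measure ℝ) u / charFun (ρ : Measure ℝ) u =
      Complex.exp (χ n u - ψ u) := fun u => by
    rw [(hχ n).2.2, hψ.2.2, Complex.exp_sub]
  refine ⟨?_, hn u hu⟩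
  rw [e]
  refine norm_le_of_norm_exp_sub_one_le (δ := fun u => χ n u - ψ u) ((hχ n).1.sub hψ.1)
    (by simp [(hχ n).2.1, hψ.2.1]) (fun v hv => ?_) hu
  rw [← e]; exact hn v hv

theorem tendsto_of_isLogCharFun {μ : ℕ → ProbabilityMeasure ℝ}
    {ρ : ProbabilityMeasure ℝ} (h : Tendsto μ atTop (𝓝 ρ)) {χ : ℕ → ℝ → ℂ} {ψ : ℝ → ℂ}
    (hχ : ∀ n, IsLogCharFun (μ n) (χ n)) (hψ : IsLogCharFun ρ ψ) (u : ℝ) :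
    Tendsto (fun n => χ n u) atTop (𝓝 (ψ u)) := by
  have hρ : charFun (ρ : Measure ℝ) u ≠ 0 := by
    rw [hψ.2.2]; exact Complex.exp_ne_zero _
  have h1 := tendsto_charFun_of_tendsto h (tendsto_const_nhds (x := u))
  have h2 := (((h1.div_const (charFun (ρ : Measure ℝ) u)).sub_const 1).norm).const_mul (3 / 2)
  rw [div_self hρ, sub_self, norm_zero, mul_zero] at h2
  rw [← tendsto_sub_nhds_zero_iff]
  refine squeeze_zero_norm' ?_ h2
  filter_upwards [eventually_norm_sub_le_of_isLogCharFun h hχ hψ |u|] with n hn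
  exact (hn u le_rfl).1

/-! ## Free counterparts of the measures in the classes `𝕌_k` -/

/-- Uniqueness of lifts for the covering `z ↦ z^D` of the punctured plane. It identifies the
characteristic function of a `D`-th convolution root with `exp (θ / D)`. -/
theorem eq_of_pow_eq_pow {f g : ℝ → ℂ} (hf : Continuous f) (hg : Continuous g) {D : ℕ} (hD : D ≠ 0)
    (h : ∀ u, f u ^ D = g u ^ D) (hg0 : ∀ u, g u ≠ 0) (h0 : f 0 = g 0) : f = g := by
  have hf0 : ∀ u, f u ≠ 0 := fun u hu => by
    have := h u
    rw [hu, zero_pow hD] at this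
    exact pow_ne_zero D (hg0 u) this.symm
  have hDC : (D : ℂ) ≠ 0 := by exact_mod_cast hD
  have := (isCoveringMap_npow (𝕜 := ℂ) D hDC).eq_of_comp_eq
    (g₁ := fun u : ℝ => ⟨f u, hf0 u⟩) (g₂ := fun u : ℝ => ⟨g u, hg0 u⟩)
    (hf.subtype_mk _) (hg.subtype_mk _) (funext fun u => Subtype.ext (h u)) 0 (Subtype.ext h0)
  exact funext fun u => congrArg Subtype.val (congrFun this u)

theorem exists_charFun_eq_exp_div {ν : ℕ → ProbabilityMeasure ℝ}
    (hν : ∀ n, 1 ≤ n → IsInfDiv (ν n)) {n : ℕ} {θ : ℝ → ℂ} (hθ : IsLogCharFun (pmConvUpTo ν n) θ)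
    {D : ℕ} (hD : 1 ≤ D) :
    ∃ τ : ProbabilityMeasure ℝ, ∀ u : ℝ, charFun (τ : Measure ℝ) u = Complex.exp (θ u / D) := by
  choose r hr using fun j : ℕ => hν (j + 1) (Nat.le_add_left 1 j) D hD
  have hD0 : (D : ℂ) ≠ 0 := by exact_mod_cast (by omega : D ≠ 0)
  have hc := hθ.1
  refine ⟨pmConvUpTo (fun j => r (j - 1)) n, fun u => congrFun (eq_of_pow_eq_pow (D := D)
    (f := fun u => charFun (pmConvUpTo (fun j => r (j - 1)) n : Measure ℝ) u)
    (g := fun u => Complex.exp (θ u / D)) (by fun_prop) (by fun_prop) (by omega) (fun u => ?_)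
    (fun u => Complex.exp_ne_zero _) ?_) u⟩
  · rw [← Complex.exp_nat_mul, mul_div_cancel₀ _ hD0, ← hθ.2.2, charFun_pmConvUpTo,
      charFun_pmConvUpTo, ← Finset.prod_pow]
    refine Finset.prod_congr rfl fun j _ => ?_
    rw [← hr j, charFun_pmConvUpTo]
    simp
  · simp [hθ.2.1]

/-- The normalised sums have exponents `n^{-k} θ_n(u / n)`, which converge to `ψ` and are uniformly
bounded on `[-1, 1]` from some index on. They are infinitely divisible because the `ν_j` are. -/
theorem exists_nevV_of_mem_classicalU {k : ℕ} {μ : ProbabilityMeasure ℝ} (hμ : μ ∈ classicalU k)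
    {ψ : ℝ → ℂ} (hψ : IsLogCharFun μ ψ) :
    ∃ (a : ℝ) (m : FiniteMeasure ℝ), ∀ t : ℝ, 0 < t →
      freeTransform ψ t = nevV a m (t * Complex.I) := by
  obtain ⟨ν, η, hν, hη, hlim⟩ := hμ
  choose θ hθ hηθ using fun n : ℕ => hη (n + 1) (Nat.le_add_left 1 n)
  set χ : ℕ → ℝ → ℂ := fun n u =>
    ((((n + 1 : ℕ) : ℝ) ^ k)⁻¹ : ℝ) * θ n (((n + 1 : ℕ) : ℝ)⁻¹ * u) with hχdef
  have hχ : ∀ n, IsLogCharFun (pmScale ((n + 1 : ℕ) : ℝ)⁻¹ (η (n + 1))) (χ n) := fun n => by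
    have := (hθ n).1
    refine ⟨by simp only [hχdef]; fun_prop, ?_, fun u => ?_⟩
    · simp [hχdef, (hθ n).2.1]
    · rw [charFun_pmScale, hηθ]
  have hlim' := hlim.comp (tendsto_add_atTop_nat 1)
  have hpt := tendsto_of_isLogCharFun hlim' hχ hψ
  obtain ⟨n₀, hn₀⟩ := eventually_atTop.1 (eventually_norm_sub_le_of_isLogCharFun hlim' hχ hψ 1)
  obtain ⟨M, hM⟩ := (isCompact_Icc (a := (-1 : ℝ)) (b := 1)).exists_bound_of_continuousOn
    hψ.1.continuousOn
  -- Dropping the first `n₀` terms makes the bound hold for every index; `3/4` is `3/2 · 1/2` from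
  -- the comparison of logarithms.
  refine exists_nevV_of_tendsto_exponent (χ := fun n => χ (n + n₀)) hψ.1 hψ.2.1
    (fun u => (hpt u).comp (tendsto_add_atTop_nat n₀)) (M := M + 3 / 4) (fun n u hu => ?_)
    fun n N hN => ?_
  · obtain ⟨h1, h2⟩ := hn₀ (n + n₀) (Nat.le_add_left _ _) u hu
    have h3 := hM u (abs_le.1 hu)
    calc _ = ‖ψ u + (χ (n + n₀) u - ψ u)‖ := by rw [add_sub_cancel]
      _ ≤ _ := norm_add_le _ _
      _ ≤ _ := add_le_add h3 (by linarith)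
  -- The power `(n + n₀ + 1)^{-k}` and the `N`-th root combine into one root of integer order of the
  -- convolution.
  · have hpos : 1 ≤ (n + n₀ + 1) ^ k * N :=
      Nat.one_le_iff_ne_zero.2 (mul_ne_zero (pow_ne_zero _ (by omega)) (by omega))
    obtain ⟨τ, hτ⟩ := exists_charFun_eq_exp_div hν (hθ (n + n₀)) hpos
    refine ⟨pmScale ((n + n₀ + 1 : ℕ) : ℝ)⁻¹ τ, fun u => ?_⟩
    rw [charFun_pmScale, hτ]
    congr 1
    simp only [hχdef]
    push_cast
    rw [div_eq_mul_inv, div_eq_mul_inv, mul_inv]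
    ring

theorem IsVoiculescuTransform.congr {ρ : ProbabilityMeasure ℝ} {V V' : ℂ → ℂ}
    (hV : IsVoiculescuTransform ρ V) (h : ∀ z : ℂ, 0 < z.im → V z = V' z) :
    IsVoiculescuTransform ρ V' := by
  obtain ⟨h1, α, β, hα, hβ, h2, h3, h4⟩ := hV
  have hs : ∀ z ∈ truncCone α β, V z = V' z := fun z hz => h z (hβ.trans hz.1)
  refine ⟨h1.congr fun z hz => (h z hz).symm, α, β, hα, hβ, h2.congr fun z hz => (hs z hz).symm,
    fun z hz => ?_, h4.congr' ?_⟩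
  · rw [← hs z hz]; exact h3 z hz
  · filter_upwards [mem_inf_of_right (mem_principal_self (truncCone α β))] with z hz
    rw [hs z hz]

theorem isVoiculescuTransform_nevV_of_imaginary_axis {ρ : ProbabilityMeasure ℝ} {V : ℂ → ℂ}
    (hV : IsVoiculescuTransform ρ V) {a : ℝ} {m : FiniteMeasure ℝ}
    (h : ∀ t : ℝ, 0 < t → V (t * Complex.I) = nevV a m (t * Complex.I)) :
    IsVoiculescuTransform ρ (nevV a m) :=
  hV.congr fun _ hz => eq_of_eq_imaginary_axis hV.1 (differentiableOn_nevV a m) h hz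

theorem freeU_subset_freeID (k : ℕ) : freeU k ⊆ freeID := by
  rintro ρ ⟨μ, hμ, ψ, V, hψ, hV, hVt⟩
  obtain ⟨a, m, ham⟩ := exists_nevV_of_mem_classicalU hμ hψ
  exact mem_freeID_iff.2 ⟨a, m, isVoiculescuTransform_nevV_of_imaginary_axis hV fun t ht => by
    rw [hVt t ht, ← ham t ht, freeTransform]⟩

/-! ## Random integrals -/

/-- If `ψ` is the exponent of `Y(1)`, this is the exponent `∫_0^1 ψ(v^{1/k} u) dv` of
`∫_{(0,1]} t dY(t^k)`. -/
noncomputable def randomIntegralExp (k : ℕ) (ψ : ℝ → ℂ) (u : ℝ) : ℂ :=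
  ∫ v in (0 : ℝ)..1, ψ (v ^ ((k : ℝ)⁻¹) * u)

/-- The Riemann-Stieltjes sums of `∫_0^1 ψ(su) d(s^k)`. -/
noncomputable def riemannExp (k : ℕ) (ψ : ℝ → ℂ) (n : ℕ) (u : ℝ) : ℂ :=
  ∑ j ∈ Finset.range n, (((((j + 1 : ℕ) : ℝ) / n) ^ k - ((j : ℝ) / n) ^ k : ℝ) : ℂ) *
    ψ (((j + 1 : ℕ) : ℝ) / n * u)

theorem continuous_rpow_inv_natCast (k : ℕ) : Continuous fun v : ℝ => v ^ ((k : ℝ)⁻¹) :=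
  Real.continuous_rpow_const (by positivity)

theorem continuous_randomIntegralExp (k : ℕ) {ψ : ℝ → ℂ} (hψ : Continuous ψ) :
    Continuous (randomIntegralExp k ψ) := by
  refine intervalIntegral.continuous_parametric_intervalIntegral_of_continuous'
    (f := fun u v => ψ (v ^ ((k : ℝ)⁻¹) * u)) ?_ 0 1
  exact hψ.comp (((continuous_rpow_inv_natCast k).comp continuous_snd).mul continuous_fst)

theorem randomIntegralExp_zero (k : ℕ) {ψ : ℝ → ℂ} (h0 : ψ 0 = 0) :
    randomIntegralExp k ψ 0 = 0 := by
  simp [randomIntegralExp, h0]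

theorem norm_comp_rpow_mul_le (k : ℕ) {ψ : ℝ → ℂ} {C : ℝ} (hC : ∀ u, ‖ψ u‖ ≤ C * (1 + u ^ 2))
    (u : ℝ) {v : ℝ} (hv : v ∈ Set.uIoc (0 : ℝ) 1) :
    ‖ψ (v ^ ((k : ℝ)⁻¹) * u)‖ ≤ C * (1 + u ^ 2) := by
  have hC0 : 0 ≤ C := by simpa using (norm_nonneg _).trans (hC 0)
  rw [Set.uIoc_of_le zero_le_one] at hv
  refine (hC _).trans (mul_le_mul_of_nonneg_left ?_ hC0)
  have h1 : v ^ ((k : ℝ)⁻¹) ≤ 1 := Real.rpow_le_one hv.1.le hv.2 (by positivity)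
  have h2 : 0 ≤ v ^ ((k : ℝ)⁻¹) := Real.rpow_nonneg hv.1.le _
  have h3 : (v ^ ((k : ℝ)⁻¹)) ^ 2 ≤ 1 := pow_le_one₀ h2 h1
  nlinarith [sq_nonneg u]

theorem norm_randomIntegralExp_le (k : ℕ) {ψ : ℝ → ℂ} {C : ℝ}
    (hC : ∀ u, ‖ψ u‖ ≤ C * (1 + u ^ 2)) (u : ℝ) :
    ‖randomIntegralExp k ψ u‖ ≤ C * (1 + u ^ 2) := by
  have := intervalIntegral.norm_integral_le_of_norm_le_const (a := (0 : ℝ)) (b := 1)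
    fun v hv => norm_comp_rpow_mul_le k hC u hv
  simpa [randomIntegralExp] using this

/-- The source of the limit in `k`: `v^{1/k} → 1` for every `v` in `(0, 1]`, with the domination
uniform in `k`. -/
theorem tendsto_randomIntegralExp {ψ : ℝ → ℂ} (hψ : Continuous ψ) {C : ℝ}
    (hC : ∀ u, ‖ψ u‖ ≤ C * (1 + u ^ 2)) (u : ℝ) :
    Tendsto (fun k => randomIntegralExp k ψ u) atTop (𝓝 (ψ u)) := by
  have h1 : ψ u = ∫ _v in (0 : ℝ)..1, ψ u := by simp
  rw [h1]
  refine intervalIntegral.tendsto_integral_filter_of_dominated_convergence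
    (fun _ => C * (1 + u ^ 2)) (Eventually.of_forall fun k => ?_)
    (Eventually.of_forall fun k => ae_of_all _ fun v hv => norm_comp_rpow_mul_le k hC u hv)
    intervalIntegrable_const (ae_of_all _ fun v hv => ?_)
  · exact (hψ.comp ((continuous_rpow_inv_natCast k).mul continuous_const)).aestronglyMeasurable
  · rw [Set.uIoc_of_le zero_le_one] at hv
    refine (hψ.tendsto u).comp ?_
    have h2 : Tendsto (fun k : ℕ => v ^ ((k : ℝ)⁻¹)) atTop (𝓝 (v ^ (0 : ℝ))) :=
      ((Real.continuous_const_rpow hv.1.ne').tendsto 0).comp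
        (tendsto_inv_atTop_zero.comp tendsto_natCast_atTop_atTop)
    simpa using h2.mul_const u

theorem tendsto_riemannExp {k : ℕ} (hk : 1 ≤ k) {ψ : ℝ → ℂ} (hψ : Continuous ψ) (u : ℝ) :
    Tendsto (fun n => riemannExp k ψ n u) atTop (𝓝 (randomIntegralExp k ψ u)) := by
  have hk0 : k ≠ 0 := by omega
  have hg : ContinuousOn (fun s : ℝ => ψ (s * u)) (Set.Icc 0 1) := by fun_prop
  have huc := isCompact_Icc.uniformContinuousOn_of_continuous hg
  rw [Metric.uniformContinuousOn_iff] at huc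
  rw [Metric.tendsto_atTop]
  intro ε hε
  obtain ⟨δ, hδ, hδε⟩ := huc (ε / 2) (by positivity)
  obtain ⟨n₀, hn₀⟩ := exists_nat_gt δ⁻¹
  refine ⟨n₀ + 1, fun n hn => ?_⟩
  have hnpos : (0 : ℝ) < n := by exact_mod_cast (by omega : 0 < n)
  have hnδ : (n : ℝ)⁻¹ < δ := by
    rw [inv_lt_comm₀ hnpos hδ]
    exact hn₀.trans (by exact_mod_cast (by omega : n₀ < n))
  -- In the variable `v = s^k` the partition points are `(j/n)^k`. On each piece `v^{1/k}` lies
  -- between `j/n` and `(j+1)/n`, so uniform continuity of `s ↦ ψ(su)` applies.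
  set b : ℕ → ℝ := fun j => ((j : ℝ) / n) ^ k with hb
  have hcont : Continuous fun v : ℝ => ψ (v ^ ((k : ℝ)⁻¹) * u) :=
    hψ.comp ((continuous_rpow_inv_natCast k).mul continuous_const)
  have hb0 : b 0 = 0 := by simp [hb, hk0]
  have hbn : b n = 1 := by simp only [hb, div_self hnpos.ne', one_pow]
  have hmono : ∀ j, b j ≤ b (j + 1) := fun j => by
    simp only [hb]
    have : (j : ℝ) ≤ ((j + 1 : ℕ) : ℝ) := by exact_mod_cast Nat.le_succ j
    gcongr
  have h1 : randomIntegralExp k ψ u =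
      ∑ j ∈ Finset.range n, ∫ v in b j..b (j + 1), ψ (v ^ ((k : ℝ)⁻¹) * u) := by
    rw [intervalIntegral.sum_integral_adjacent_intervals
      fun j _ => hcont.intervalIntegrable _ _, hb0, hbn, randomIntegralExp]
  have h2 : riemannExp k ψ n u =
      ∑ j ∈ Finset.range n, ∫ _v in b j..b (j + 1), ψ (((j + 1 : ℕ) : ℝ) / n * u) := by
    refine Finset.sum_congr rfl fun j _ => ?_
    rw [intervalIntegral.integral_const, Complex.real_smul]
  have h3 : ∀ j ∈ Finset.range n, ‖(∫ _v in b j..b (j + 1), ψ (((j + 1 : ℕ) : ℝ) / n * u)) -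
      ∫ v in b j..b (j + 1), ψ (v ^ ((k : ℝ)⁻¹) * u)‖ ≤ ε / 2 * (b (j + 1) - b j) := fun j hj => by
    have hjn : j + 1 ≤ n := Finset.mem_range.1 hj
    rw [← intervalIntegral.integral_sub intervalIntegrable_const (hcont.intervalIntegrable _ _),
      ← abs_of_nonneg (sub_nonneg.2 (hmono j))]
    refine intervalIntegral.norm_integral_le_of_norm_le_const fun v hv => ?_
    rw [Set.uIoc_of_le (hmono j)] at hv
    have hj0 : (0 : ℝ) ≤ (j : ℝ) / n := by positivity
    have hj1 : (0 : ℝ) ≤ ((j + 1 : ℕ) : ℝ) / n := by positivity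
    have hv0 : 0 ≤ v := (pow_nonneg hj0 k).trans hv.1.le
    have hki : (0 : ℝ) ≤ (k : ℝ)⁻¹ := by positivity
    have h4 : (j : ℝ) / n ≤ v ^ ((k : ℝ)⁻¹) := by
      have := Real.rpow_le_rpow (pow_nonneg hj0 k) hv.1.le hki
      rwa [Real.pow_rpow_inv_natCast hj0 hk0] at this
    have h5 : v ^ ((k : ℝ)⁻¹) ≤ ((j + 1 : ℕ) : ℝ) / n := by
      have := Real.rpow_le_rpow hv0 hv.2 hki
      rwa [Real.pow_rpow_inv_natCast hj1 hk0] at this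
    have h6 : ((j + 1 : ℕ) : ℝ) / n ≤ 1 := (div_le_one hnpos).2 (by exact_mod_cast hjn)
    have h7 : ((j + 1 : ℕ) : ℝ) / n - (j : ℝ) / n = (n : ℝ)⁻¹ := by
      push_cast; field_simp; ring
    have h8 := hδε (((j + 1 : ℕ) : ℝ) / n) ⟨hj1, h6⟩ (v ^ ((k : ℝ)⁻¹))
      ⟨hj0.trans h4, h5.trans h6⟩ (by
        rw [Real.dist_eq, abs_of_nonneg (by linarith)]; linarith)
    rw [dist_eq_norm] at h8
    exact h8.le
  rw [dist_eq_norm, h1, h2, ← Finset.sum_sub_distrib]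
  calc _ ≤ ∑ j ∈ Finset.range n, ε / 2 * (b (j + 1) - b j) := norm_sum_le_of_le _ h3
    _ = ε / 2 * (b n - b 0) := by rw [← Finset.mul_sum, Finset.sum_range_sub]
    _ < ε := by rw [hb0, hbn]; linarith

theorem charFun_riemann_sum {k n : ℕ} {ψ : ℝ → ℂ} {ξ : ℕ → ProbabilityMeasure ℝ}
    (hξ : ∀ j, 1 ≤ j → j ≤ n → ∀ u : ℝ, charFun (ξ j : Measure ℝ) u =
      Complex.exp (((((j : ℝ) / n) ^ k - (((j : ℝ) - 1) / n) ^ k : ℝ) : ℂ) * ψ u)) (u : ℝ) :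
    charFun (pmConvUpTo (fun j => pmScale ((j : ℝ) / n) (ξ j)) n : Measure ℝ) u =
      Complex.exp (riemannExp k ψ n u) := by
  rw [charFun_pmConvUpTo, riemannExp, Complex.exp_sum]
  refine Finset.prod_congr rfl fun j hj => ?_
  rw [charFun_pmScale, hξ _ (Nat.le_add_left 1 j) (Finset.mem_range.1 hj)]
  simp

theorem isLogCharFun_levyExp {ν : ProbabilityMeasure ℝ} {a : ℝ} {m : FiniteMeasure ℝ}
    (h : HasLevyKhintchine ν a m) : IsLogCharFun ν (levyExp a m) :=
  ⟨continuous_levyExp a m, levyExp_zero a m, h⟩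

theorem exists_isRandomIntegralLaw (a : ℝ) (m : FiniteMeasure ℝ) {k : ℕ} (hk : 1 ≤ k) :
    ∃ ν ρ : ProbabilityMeasure ℝ, HasLevyKhintchine ν a m ∧
      IsRandomIntegralLaw (fun t => t) (fun t => t ^ k) ν ρ ∧
      IsLogCharFun ρ (randomIntegralExp k (levyExp a m)) := by
  obtain ⟨ν, hν⟩ := exists_hasLevyKhintchine a m
  have hc := continuous_randomIntegralExp k (continuous_levyExp a m)
  -- The maximum with `0` only serves to define `ξ n 0`, where the increment is negative for even
  -- `k` and `n ≥ 1`. For `j ≥ 1` it has no effect.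
  choose ξ hξ using fun n j : ℕ => exists_charFun_eq_exp_levyExp a m
    (le_max_right (((j : ℝ) / n) ^ k - (((j : ℝ) - 1) / n) ^ k) 0) 1
  have hξ' : ∀ n j : ℕ, 1 ≤ j → ∀ u : ℝ, charFun (ξ n j : Measure ℝ) u =
      Complex.exp (((((j : ℝ) / n) ^ k - (((j : ℝ) - 1) / n) ^ k : ℝ) : ℂ) * levyExp a m u) :=
    fun n j hj u => by
    have h1 : (0 : ℝ) ≤ (j : ℝ) - 1 := sub_nonneg.2 (by exact_mod_cast hj)
    have h2 : (0 : ℝ) ≤ ((j : ℝ) / n) ^ k - (((j : ℝ) - 1) / n) ^ k := by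
      rw [sub_nonneg]
      have : (j : ℝ) - 1 ≤ j := by linarith
      gcongr
    rw [hξ, max_eq_left h2, one_mul]
  obtain ⟨ρ, hρ, hlim⟩ := exists_charFun_eq_of_tendsto
    (μ := fun n => pmConvUpTo (fun j => pmScale ((j : ℝ) / n) (ξ n j)) n)
    (f := fun u => Complex.exp (randomIntegralExp k (levyExp a m) u))
    hc.cexp.continuousAt fun u => by
    simp only [charFun_riemann_sum fun j hj _ => hξ' _ j hj]
    exact (Complex.continuous_exp.tendsto _).comp
      (tendsto_riemannExp hk (continuous_levyExp a m) u)
  exact ⟨ν, ρ, hν, ⟨ξ, fun n j hj _ => ⟨levyExp a m, isLogCharFun_levyExp hν, hξ' n j hj⟩, hlim⟩,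
    hc, randomIntegralExp_zero k (levyExp_zero a m), hρ⟩

theorem IsRandomIntegralLaw.isLogCharFun {a : ℝ} {m : FiniteMeasure ℝ} {k : ℕ} (hk : 1 ≤ k)
    {ν ρ : ProbabilityMeasure ℝ} (hν : HasLevyKhintchine ν a m)
    (h : IsRandomIntegralLaw (fun t => t) (fun t => t ^ k) ν ρ) :
    IsLogCharFun ρ (randomIntegralExp k (levyExp a m)) := by
  obtain ⟨ξ, hξ, hlim⟩ := h
  refine ⟨continuous_randomIntegralExp k (continuous_levyExp a m),
    randomIntegralExp_zero k (levyExp_zero a m), fun u => ?_⟩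
  have h1 := ProbabilityMeasure.tendsto_iff_tendsto_charFun.1 hlim u
  have hξ' : ∀ n j : ℕ, 1 ≤ j → j ≤ n → ∀ u : ℝ, charFun (ξ n j : Measure ℝ) u =
      Complex.exp (((((j : ℝ) / n) ^ k - (((j : ℝ) - 1) / n) ^ k : ℝ) : ℂ) * levyExp a m u) :=
    fun n j hj hjn u => by
    obtain ⟨ψ, hψ, h2⟩ := hξ n j hj hjn
    rw [h2, hψ.eq (isLogCharFun_levyExp hν)]
  simp only [charFun_riemann_sum (hξ' _)] at h1
  exact tendsto_nhds_unique h1 ((Complex.continuous_exp.tendsto _).comp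
    (tendsto_riemannExp hk (continuous_levyExp a m) u))

/-- Give `ν_j` the exponent `(j^k - (j-1)^k) ψ(ju)`. After the power `n^{-k}` and the dilation by
`1/n`, the sum of the first `n` exponents is exactly `riemannExp`. -/
theorem mem_classicalU_of_isLogCharFun {a : ℝ} {m : FiniteMeasure ℝ} {k : ℕ} (hk : 1 ≤ k)
    {ρ : ProbabilityMeasure ℝ} (hρ : IsLogCharFun ρ (randomIntegralExp k (levyExp a m))) :
    ρ ∈ classicalU k := by
  have hw : ∀ j : ℕ, (0 : ℝ) ≤ (j : ℝ) ^ k - ((j - 1 : ℕ) : ℝ) ^ k := fun j => by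
    rw [sub_nonneg]
    have : ((j - 1 : ℕ) : ℝ) ≤ j := by exact_mod_cast Nat.sub_le j 1
    gcongr
  choose ν hν using fun j : ℕ => exists_charFun_eq_exp_levyExp a m (hw j) j
  choose ζ hζ using fun n j : ℕ => exists_charFun_eq_exp_levyExp a m
    (mul_nonneg (by positivity : (0 : ℝ) ≤ ((n : ℝ) ^ k)⁻¹) (hw j)) j
  have hc := continuous_levyExp a m
  refine ⟨ν, fun n => pmConvUpTo (ζ n) n, fun n _ => isInfDiv_of_charFun_eq (hw n) (hν n),
    fun n _ => ?_, ?_⟩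
  · refine ⟨fun u => ∑ j ∈ Finset.range n, ((((j + 1 : ℕ) : ℝ) ^ k - (j : ℝ) ^ k : ℝ) : ℂ) *
      levyExp a m (((j + 1 : ℕ) : ℝ) * u), ⟨by fun_prop, by simp [levyExp_zero], fun u => ?_⟩,
      fun u => ?_⟩
    · rw [charFun_pmConvUpTo, Complex.exp_sum]
      refine Finset.prod_congr rfl fun j _ => ?_
      rw [hν, Nat.add_sub_cancel]
    · rw [charFun_pmConvUpTo, Finset.mul_sum, Complex.exp_sum]
      refine Finset.prod_congr rfl fun j _ => ?_
      rw [hζ, Nat.add_sub_cancel, Complex.ofReal_mul, mul_assoc]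
  · rw [ProbabilityMeasure.tendsto_iff_tendsto_charFun]
    intro u
    have h1 : ∀ n : ℕ, charFun (pmScale ((n : ℝ)⁻¹) (pmConvUpTo (ζ n) n) : Measure ℝ) u =
        Complex.exp (riemannExp k (levyExp a m) n u) := fun n => by
      rw [charFun_pmScale, charFun_pmConvUpTo, riemannExp, Complex.exp_sum]
      refine Finset.prod_congr rfl fun j _ => ?_
      rw [hζ, Nat.add_sub_cancel]
      congr 3
      · rw [div_pow, div_pow, ← sub_div, div_eq_inv_mul]
      · rw [div_eq_mul_inv, mul_assoc]
    simp only [h1]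
    rw [hρ.2.2]
    exact (Complex.continuous_exp.tendsto _).comp (tendsto_riemannExp hk hc u)

theorem randomIntegralExp_levyExp_smul (k : ℕ) (c : NNReal) (a : ℝ) (m : FiniteMeasure ℝ) (u : ℝ) :
    randomIntegralExp k (levyExp (c * a) (c • m)) u = c * randomIntegralExp k (levyExp a m) u := by
  simp only [randomIntegralExp, levyExp_smul]
  exact intervalIntegral.integral_const_mul _ _

/-- The exponent of the random integral is linear in `(a, m)`, so its `N`-th root is the random
integral with parameters `(a, m) / N`. The criterion for limits of exponents, applied to a constant
sequence, then produces the parameters of the counterpart. -/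
theorem exists_hasBackground (a : ℝ) (m : FiniteMeasure ℝ) {k : ℕ} (hk : 1 ≤ k) :
    ∃ ν' : ProbabilityMeasure ℝ, HasBackground k a m ν' := by
  obtain ⟨ν, ρ, hν, hρ, hlog⟩ := exists_isRandomIntegralLaw a m hk
  obtain ⟨C, hC0, hC⟩ := norm_levyExp_le a m
  obtain ⟨a', m', h⟩ := exists_nevV_of_tendsto_exponent
    (χ := fun _ => randomIntegralExp k (levyExp a m)) hlog.1 hlog.2.1
    (fun u => tendsto_const_nhds) (M := C * 2) (fun n u hu => by
      refine (norm_randomIntegralExp_le k hC u).trans (mul_le_mul_of_nonneg_left ?_ hC0)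
      have : u ^ 2 ≤ 1 := by rw [← sq_abs]; exact pow_le_one₀ (abs_nonneg u) hu
      linarith) fun n N hN => by
      obtain ⟨-, σ, -, -, hσ⟩ := exists_isRandomIntegralLaw
        ((N : NNReal)⁻¹ * a) ((N : NNReal)⁻¹ • m) hk
      refine ⟨σ, fun u => ?_⟩
      have e := randomIntegralExp_levyExp_smul k (N : NNReal)⁻¹ a m u
      rw [hσ.2.2, e]
      congr 1
      push_cast
      rw [div_eq_inv_mul]
  obtain ⟨ν', hν'⟩ := exists_isVoiculescuTransform_nevV a' m'
  exact ⟨ν', ν, ρ, hν, hρ, _, _, hlog, hν', fun t ht => by rw [← h t ht, freeTransform]⟩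

theorem HasBackground.exists_transform {k : ℕ} (hk : 1 ≤ k) {a : ℝ} {m : FiniteMeasure ℝ}
    {ν' : ProbabilityMeasure ℝ} (h : HasBackground k a m ν') :
    ν' ∈ freeU k ∧ ∃ V : ℂ → ℂ, IsVoiculescuTransform ν' V ∧ ∀ t : ℝ, 0 < t →
      V (t * Complex.I) = freeTransform (randomIntegralExp k (levyExp a m)) t := by
  obtain ⟨ν, ρ, hν, hρ, hfree⟩ := h
  have hlog := IsRandomIntegralLaw.isLogCharFun hk hν hρ
  refine ⟨⟨ρ, mem_classicalU_of_isLogCharFun hk hlog, hfree⟩, ?_⟩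
  obtain ⟨ψ, V, hψ, hV, hVt⟩ := hfree
  rw [hψ.eq hlog] at hVt
  exact ⟨V, hV, hVt⟩

theorem tendsto_freeTransform_randomIntegralExp (a : ℝ) (m : FiniteMeasure ℝ) {t : ℝ} (ht : 0 < t) :
    Tendsto (fun k => freeTransform (randomIntegralExp k (levyExp a m)) t) atTop
      (𝓝 (freeLK a m t)) := by
  obtain ⟨C, -, hC⟩ := norm_levyExp_le a m
  have hc := continuous_levyExp a m
  rw [freeLK_eq_nevV, ← freeTransform_levyExp a m ht]
  exact tendsto_freeTransform (fun k => (continuous_randomIntegralExp k hc).measurable)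
    (fun k u => norm_randomIntegralExp_le k hC u) (fun u => tendsto_randomIntegralExp hc hC u) ht

theorem tendsto_transform_of_hasBackground {a : ℝ} {m : FiniteMeasure ℝ}
    {ν' : ℕ → ProbabilityMeasure ℝ} (h : ∀ k, 1 ≤ k → HasBackground k a m (ν' k)) {V : ℕ → ℂ → ℂ}
    (hV : ∀ k, 1 ≤ k → IsVoiculescuTransform (ν' k) (V k)) {t : ℝ} (ht : 0 < t) :
    Tendsto (fun k => V k (t * Complex.I)) atTop (𝓝 (freeLK a m t)) := by
  refine (tendsto_freeTransform_randomIntegralExp a m ht).congr' ?_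
  filter_upwards [eventually_ge_atTop 1] with k hk
  obtain ⟨-, W, hW, hWt⟩ := (h k hk).exists_transform hk
  rw [← hWt t ht]
  exact hW.eq (hV k hk) (by simpa using ht)

/-! ### Transforms of the free infinitely divisible laws and the two closures -/

theorem mem_transformsOf_freeID_iff {v : Set.Ioi (0 : ℝ) → ℂ} :
    v ∈ transformsOf freeID ↔
      ∃ (a : ℝ) (m : FiniteMeasure ℝ), ∀ t : Set.Ioi (0 : ℝ), v t = freeLK a m t := by
  constructor
  · rintro ⟨ν, hν, V, hV, hv⟩
    obtain ⟨a, m, ham⟩ := mem_freeID_iff.1 hν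
    refine ⟨a, m, fun t => ?_⟩
    rw [hv, freeLK_eq_nevV]
    exact hV.eq ham (by have := t.2.out; simpa using this)
  · rintro ⟨a, m, hv⟩
    obtain ⟨ν, hν⟩ := exists_isVoiculescuTransform_nevV a m
    exact ⟨ν, mem_freeID_iff.2 ⟨a, m, hν⟩, nevV a m, hν, fun t => by rw [hv, freeLK_eq_nevV]⟩

/-- Every pair `(a, m)` is approximated by counterparts with background `(a, m)`. -/
theorem exists_seq_freeU (a : ℝ) (m : FiniteMeasure ℝ) :
    ∃ (ν : ℕ → ProbabilityMeasure ℝ) (b : ℕ → ℝ) (σ : ℕ → FiniteMeasure ℝ),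
      (∀ k, ν k ∈ freeU (k + 1)) ∧ (∀ k, IsVoiculescuTransform (ν k) (nevV (b k) (σ k))) ∧
      ∀ t : ℝ, 0 < t → Tendsto (fun k => nevV (b k) (σ k) (t * Complex.I)) atTop
        (𝓝 (nevV a m (t * Complex.I))) := by
  choose ν hν using fun k : ℕ => exists_hasBackground a m (Nat.le_add_left 1 k)
  choose hU W hW hWt using fun k : ℕ => (hν k).exists_transform (Nat.le_add_left 1 k)
  choose b σ hb using fun k : ℕ => mem_freeID_iff.1 (freeU_subset_freeID _ (hU k))
  refine ⟨ν, b, σ, hU, hb, fun t ht => ?_⟩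
  rw [← freeLK_eq_nevV]
  refine ((tendsto_freeTransform_randomIntegralExp a m ht).comp (tendsto_add_atTop_nat 1)).congr
    fun k => ?_
  rw [Function.comp_apply, ← hWt k t ht]
  exact (hW k).eq (hb k) (by simpa using ht)

/-- One inclusion is weak closedness. For the other, the counterparts with background `(a, m)` have
transforms converging on the imaginary axis, and this already implies weak convergence. -/
theorem closure_iUnion_freeU : closure (⋃ k ∈ Set.Ici (1 : ℕ), freeU k) = freeID := by
  refine Set.Subset.antisymm (closure_minimal (Set.iUnion₂_subset fun k _ => freeU_subset_freeID k)
    isClosed_freeID) fun ρ hρ => ?_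
  obtain ⟨a, m, ham⟩ := mem_freeID_iff.1 hρ
  obtain ⟨ν, b, σ, hU, hb, hlim⟩ := exists_seq_freeU a m
  refine mem_closure_of_tendsto (tendsto_of_tendsto_nevV hb ham fun w hw =>
    tendsto_nevV_of_tendsto_imaginary_axis hlim hw) (Eventually.of_forall fun k => ?_)
  exact Set.mem_iUnion₂.2 ⟨k + 1, Nat.le_add_left 1 k, hU k⟩

theorem transformsOf_freeID_subset_closure :
    transformsOf freeID ⊆ closure (transformsOf (⋃ k ∈ Set.Ici (1 : ℕ), freeU k)) := by
  intro v hv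
  obtain ⟨a, m, ham⟩ := mem_transformsOf_freeID_iff.1 hv
  obtain ⟨ν, b, σ, hU, hb, hlim⟩ := exists_seq_freeU a m
  refine mem_closure_of_tendsto (f := fun (k : ℕ) (t : Set.Ioi (0 : ℝ)) =>
    nevV (b k) (σ k) (((t : ℝ) : ℂ) * Complex.I)) (b := atTop) (tendsto_pi_nhds.2 fun t => ?_)
    (Eventually.of_forall fun k => ?_)
  · rw [ham, freeLK_eq_nevV]
    exact hlim t t.2
  · exact ⟨ν k, Set.mem_iUnion₂.2 ⟨k + 1, Nat.le_add_left 1 k, hU k⟩, _, hb k, fun t => rfl⟩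

theorem corollary2 :
    -- for each `k ≥ 1` and parameters `(a, m)` there is a counterpart with background `(a, m)`
    (∀ (a : ℝ) (m : FiniteMeasure ℝ) (k : ℕ), 1 ≤ k →
      ∃ ν' : ProbabilityMeasure ℝ, HasBackground k a m ν') ∧
    -- such measures lie in `(𝕌_k, ⊞)`, have a Voiculescu transform on the upper half-plane, and
    -- these transforms converge on the imaginary axis
    (∀ (a : ℝ) (m : FiniteMeasure ℝ) (ν' : ℕ → ProbabilityMeasure ℝ),
      (∀ k, 1 ≤ k → HasBackground k a m (ν' k)) →
      (∀ k, 1 ≤ k → ν' k ∈ freeU k) ∧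
      ∀ V : ℕ → ℂ → ℂ, (∀ k, 1 ≤ k → IsVoiculescuTransform (ν' k) (V k)) →
        ∀ t : ℝ, 0 < t →
          Tendsto (fun k => V k (t * Complex.I)) atTop (𝓝 (freeLK a m t))) ∧
    -- the limits are exactly the transforms of the free infinitely divisible measures
    transformsOf freeID =
      {v | ∃ (a : ℝ) (m : FiniteMeasure ℝ), ∀ t : Set.Ioi (0 : ℝ), v t = freeLK a m t} ∧
    -- the closure, in the weak topology of probability measures
    closure (⋃ k ∈ Set.Ici (1 : ℕ), freeU k) = freeID ∧
    -- the closure, within `(ID, ⊞)`, for the pointwise convergence of Voiculescu transforms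
    closure (transformsOf (⋃ k ∈ Set.Ici (1 : ℕ), freeU k)) ∩ transformsOf freeID =
      transformsOf freeID := by
  exact ⟨fun a m k hk => exists_hasBackground a m hk,
    fun a m ν' h => ⟨fun k hk => ((h k hk).exists_transform hk).1,
      fun V hV t ht => tendsto_transform_of_hasBackground h hV ht⟩,
    Set.ext fun v => mem_transformsOf_freeID_iff, closure_iUnion_freeU,
    Set.inter_eq_right.2 transformsOf_freeID_subset_closure⟩
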